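/- Let $n\in\{2,3\}$. There is a finite list of non-zero polynomials with integer coefficients (the resonances, depending only on $n$), each in the coordinates of finitely many vectors of $n$-space, such that the following holds for every $m\ge 0$ and every list $S=\{v_1,\dots,v_m\}$ of distinct vectors of $\mathbb Z^n$ that is generic, i.e. such that no resonance in $k$ vectors vanishes at any $k$ distinct members of $S$ (in any order). **Graph.** Let $S^c=\mathbb Z^n\setminus S$. For $i\ne j$ and $a,b\in S^c$, there is a black edge from $a$ to $b$ marked $(i,j)$ if $b-a=v_j-v_i$ and $|b|^2-|a|^2=|v_j|^2-|v_i|^2$, and a red edge between $a$ and $b$ marked $(i,j)$ if $a+b=v_i+v_j$ and $|a|^2+|b|^2=|v_i|^2+|v_j|^2$. Let $\Gamma$ be the resulting graph on $S^c$. Choose a root in each connected component $A$ of $\Gamma$, and for each $a\in A$ a path from the root to $a$ (the trivial one if $a$ is the root). Let $\sigma(a)=\pm1$ be the parity of the number of red edges of this path, and let $L(a)\in\mathbb Z^m$ be obtained by starting from $0$ at the root and replacing $L$ by $L+e_j-e_i$ along a black edge marked $(i,j)$ and by $e_i+e_j-L$ along a red edge marked $(i,j)$. **Matrices.** Let $\xi_1,\dots,\xi_m>0$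 and $x\in\mathbb R^m$. Let $Q$ be the quadratic form in $z_k,\bar z_k$ ($k\in S^c$) $$Q=4\sum\sqrt{\xi_i\xi_j}\,e^{\mathrm i(x_i-x_j)}z_h\bar z_k+2\sum\sqrt{\xi_i\xi_j}\,e^{-\mathrm i(x_i+x_j)}z_hz_k+2\sum\sqrt{\xi_i\xi_j}\,e^{\mathrm i(x_i+x_j)}\bar z_h\bar z_k ,$$ where the first sum is over $i\ne j$ and $h,k\in S^c$ with $h+v_i=k+v_j$, $|h|^2+|v_i|^2=|k|^2+|v_j|^2$, and the other two are over $i<j$ and $h,k\in S^c$ with $h+k=v_i+v_j$, $|h|^2+|k|^2=|v_i|^2+|v_j|^2$. Write $Q=\frac12\sum q_{(k,\sigma),(h,\tau)}z_k^{\sigma}z_h^{\tau}$ with $q$ symmetric, $z_k^{+}=z_k$, $z_k^-=\bar z_k$, and let $M_{(k,\sigma),(h,\tau)}=\tau\,q_{(k,\sigma),(h,-\tau)}$. Put $\omega_i=|v_i|^2-2\xi_i+4\sum_j\xi_j$ and $\Omega_k=|k|^2+4\sum_j\xi_j$, let $\Omega'$ and $X$ be the diagonal matrices with entries $\sigma(\Omega_k-(\omega,L(k)))$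 and $e^{\mathrm i\sigma (L(k),x)}$ at $(k,\sigma)$, and let $M'=\Omega'+XMX^{-1}$. For a component $A$ let $M'_A$ be the block of $M'$ with rows and columns indexed by $(a,\sigma(a))$, $a\in A$. Let $C_A$ be the matrix indexed by $A$ with diagonal entries $\sigma(a)(\xi,L(a))$, with entry $2\sigma(b)\sqrt{\xi_i\xi_j}$ at $(a,b)$ if $a,b$ are joined by an edge marked $(i,j)$, and with all other entries $0$. **Theorem (LIRRI).** Every component $A$ is finite; the characteristic polynomials in $t$ of $M'_A$ and of $C_A$ are polynomials in $t,\xi_1,\dots,\xi_m$ with integer coefficients (independent of $x$), and both are irreducible in $\mathbb C[t,\xi_1,\dots,\xi_m]$ (hence, being monic in $t$, also over $\mathbb Z$ and $\mathbb Q$). -/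

import Mathlib

open scoped Matrix

noncomputable section

namespace NLSBlocks

variable {n m : ℕ}

/-- The family `v = (v_1, ..., v_m)` of tangential sites determines the set of normal sites
`S^c`, the integer vectors that are not tangential sites. -/
abbrev NormalSite (v : Fin m → Fin n → ℤ) : Type :=
  {k : Fin n → ℤ // k ∉ Set.range v}

/-- `a` and `b` are joined by a black edge, oriented from `a` to `b` and marked `v_j - v_i`. -/
def BlackEdge (v : Fin m → Fin n → ℤ) (i j : Fin m) (a b : Fin n → ℤ) : Prop :=
  i ≠ j ∧ b - a = v j - v i ∧ b ⬝ᵥ b - a ⬝ᵥ a = v j ⬝ᵥ v j - v i ⬝ᵥ v i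

/-- `a` and `b` are joined by a red edge marked `v_i + v_j`. -/
def RedEdge (v : Fin m → Fin n → ℤ) (i j : Fin m) (a b : Fin n → ℤ) : Prop :=
  i ≠ j ∧ a + b = v i + v j ∧ a ⬝ᵥ a + b ⬝ᵥ b = v i ⬝ᵥ v i + v j ⬝ᵥ v j

/-- The geometric graph on the normal sites: two distinct sites are adjacent when they are joined
by a black edge (with one of its two orientations) or by a red edge. -/
def geomGraph (v : Fin m → Fin n → ℤ) : SimpleGraph (NormalSite v) :=
  SimpleGraph.fromRel fun a b => ∃ i j, BlackEdge v i j a.1 b.1 ∨ RedEdge v i j a.1 b.1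

/-- `PathLabel v r a s L` says that some path from `r` to `a` in the geometric graph has sign `s`
(`1` or `-1` according to the parity of its number of red edges) and linear form `L`. The form of
a path is built edge by edge: `L(p) = L(e) + sign(e) L(p')` if `p` is `p'` followed by the edge
`e`, where `L(e) = e_j - e_i` for a black and `L(e) = e_j + e_i` for a red edge `e`. -/
inductive PathLabel (v : Fin m → Fin n → ℤ) (r : NormalSite v) :
    NormalSite v → ℤˣ → (Fin m → ℤ) → Prop
  | nil : PathLabel v r r 1 0
  | black {a b : NormalSite v} {s : ℤˣ} {L : Fin m → ℤ} {i j : Fin m} :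
      PathLabel v r a s L → BlackEdge v i j a.1 b.1 →
        PathLabel v r b s (Pi.single j 1 - Pi.single i 1 + L)
  | red {a b : NormalSite v} {s : ℤˣ} {L : Fin m → ℤ} {i j : Fin m} :
      PathLabel v r a s L → RedEdge v i j a.1 b.1 →
        PathLabel v r b (-s) (Pi.single j 1 + Pi.single i 1 - L)

/-- A choice of a root in every connected component of the geometric graph, together with the
sign `σ(k)` and the linear form `L(k)` of a path from the root to each normal site `k`. -/
structure Rooting (v : Fin m → Fin n → ℤ) where
  root : NormalSite v → NormalSite v
  sign : NormalSite v → ℤˣ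
  form : NormalSite v → Fin m → ℤ
  root_eq : ∀ k l, (geomGraph v).Reachable k l → root k = root l
  label : ∀ k, PathLabel v (root k) k (sign k) (form k)
  sign_root : ∀ k, sign (root k) = 1
  form_root : ∀ k, form (root k) = 0

/-- The frequencies `ω_i(ξ) = |v_i|² - 2 ξ_i + 4 ∑_j ξ_j` of the tangential sites. -/
def tangentialFreq (v : Fin m → Fin n → ℤ) (ξ : Fin m → ℝ) (i : Fin m) : ℝ :=
  ((v i ⬝ᵥ v i : ℤ) : ℝ) - 2 * ξ i + 4 * ∑ j, ξ j

/-- The frequencies `Ω_k(ξ) = |k|² + 4 ∑_j ξ_j` of the normal sites. -/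
def normalFreq {v : Fin m → Fin n → ℤ} (ξ : Fin m → ℝ) (k : NormalSite v) : ℝ :=
  ((k.1 ⬝ᵥ k.1 : ℤ) : ℝ) + 4 * ∑ j, ξ j

open Classical in
/-- The sum over all `i ≠ j` with `h + v_i = k + v_j`, `|h|² + |v_i|² = |k|² + |v_j|²` of
`√(ξ_i ξ_j) exp(i (x_i - x_j))`. -/
def blackSum (v : Fin m → Fin n → ℤ) (ξ x : Fin m → ℝ) (h k : NormalSite v) : ℂ :=
  ∑ i, ∑ j, if BlackEdge v i j k.1 h.1 then
    (Real.sqrt (ξ i * ξ j) : ℂ) * Complex.exp (Complex.I * ((x i - x j : ℝ) : ℂ)) else 0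

open Classical in
/-- The sum over all `i < j` with `h + k = v_i + v_j`, `|h|² + |k|² = |v_i|² + |v_j|²` of
`√(ξ_i ξ_j) exp(i s (x_i + x_j))`. -/
def redSum (v : Fin m → Fin n → ℤ) (ξ x : Fin m → ℝ) (s : ℤ) (h k : NormalSite v) : ℂ :=
  ∑ i, ∑ j, if i < j ∧ RedEdge v i j h.1 k.1 then
    (Real.sqrt (ξ i * ξ j) : ℂ) * Complex.exp (Complex.I * (s : ℂ) * ((x i + x j : ℝ) : ℂ)) else 0

/-- The symmetric coefficients `q` of the quadratic form
`Q(w) = 4 ∑ √(ξ_i ξ_j) exp(i (x_i - x_j)) z_h z̄_k + 2 ∑ √(ξ_i ξ_j) exp(-i (x_i + x_j)) z_h z_k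
  + 2 ∑ √(ξ_i ξ_j) exp(i (x_i + x_j)) z̄_h z̄_k = (1/2) ∑ q_{(h,σ),(k,τ)} z_h^σ z_k^τ`,
where `z_k^1 = z_k` and `z_k^{-1} = z̄_k`; the first sum runs over the normal sites `h, k` and the
`i, j` in `blackSum`, the other two over `h, k` and the `i, j` in `redSum`. -/
def quadCoeff (v : Fin m → Fin n → ℤ) (ξ x : Fin m → ℝ) (p q : NormalSite v × ℤˣ) : ℂ :=
  if p.2 = 1 then
    if q.2 = 1 then 4 * redSum v ξ x (-1) p.1 q.1 else 4 * blackSum v ξ x p.1 q.1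
  else
    if q.2 = 1 then 4 * blackSum v ξ x q.1 p.1 else 4 * redSum v ξ x 1 p.1 q.1

/-- The matrix `M` with `Q(w) = -(1/2) (w, M J w)`, that is
`M_{(k,σ),(h,τ)} = τ q_{(k,σ),(h,-τ)}`. -/
def matM (v : Fin m → Fin n → ℤ) (ξ x : Fin m → ℝ) :
    Matrix (NormalSite v × ℤˣ) (NormalSite v × ℤˣ) ℂ :=
  fun p q => ((q.2 : ℤ) : ℂ) * quadCoeff v ξ x p (q.1, -q.2)

/-- The diagonal entries `σ (Ω_k - (ω, L(k)))` of `Ω'`. -/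
def diagOmega {v : Fin m → Fin n → ℤ} (R : Rooting v) (ξ : Fin m → ℝ)
    (p : NormalSite v × ℤˣ) : ℂ :=
  ((p.2 : ℤ) : ℂ) *
    ((normalFreq ξ p.1 - ∑ i, tangentialFreq v ξ i * (R.form p.1 i : ℝ) : ℝ) : ℂ)

/-- The diagonal entries `exp(i σ L(k).x)` of the change of variables `X`. -/
def diagX {v : Fin m → Fin n → ℤ} (R : Rooting v) (x : Fin m → ℝ)
    (p : NormalSite v × ℤˣ) : ℂ :=
  Complex.exp (Complex.I * ((p.2 : ℤ) : ℂ) * ((∑ i, (R.form p.1 i : ℝ) * x i : ℝ) : ℂ))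

open Classical in
/-- The matrix `M' = Ω' + X M X⁻¹`. -/
def matM' {v : Fin m → Fin n → ℤ} (R : Rooting v) (ξ x : Fin m → ℝ) :
    Matrix (NormalSite v × ℤˣ) (NormalSite v × ℤˣ) ℂ :=
  fun p q => (if p = q then diagOmega R ξ p else 0)
    + diagX R x p * matM v ξ x p q * (diagX R x q)⁻¹

/-- The block `M'_A` of `M'` on the indices `(a, σ(a))`, for `a` in the component `A`. -/
def blockM' {v : Fin m → Fin n → ℤ} (R : Rooting v) (A : (geomGraph v).ConnectedComponent)
    (ξ x : Fin m → ℝ) : Matrix A.supp A.supp ℂ :=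
  (matM' R ξ x).submatrix (fun a => (a.1, R.sign a.1)) (fun a => (a.1, R.sign a.1))

open Classical in
/-- The matrix `C_A`: the diagonal entry at `a` is `σ(a) (ξ, L(a))`; off the diagonal, the entry
at `(a, b)` is `2 σ(b) √(ξ_i ξ_j)` if `a` and `b` are joined by an edge marked `(i, j)`, and `0`
if they are not joined. -/
def blockC {v : Fin m → Fin n → ℤ} (R : Rooting v) (A : (geomGraph v).ConnectedComponent)
    (ξ : Fin m → ℝ) : Matrix A.supp A.supp ℂ :=
  fun a b =>
    if a = b then ((R.sign a.1 : ℤ) : ℂ) * ((∑ i, ξ i * (R.form a.1 i : ℝ) : ℝ) : ℂ)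
    else 2 * ((R.sign b.1 : ℤ) : ℂ) *
      ∑ i, ∑ j, if BlackEdge v i j a.1.1 b.1.1 ∨ (i < j ∧ RedEdge v i j a.1.1 b.1.1) then
        (Real.sqrt (ξ i * ξ j) : ℂ) else 0

open Classical in
/-- The characteristic polynomial of the family `N(ξ, x)`, where `ξ` are positive parameters and
`x` are angles, is a polynomial in `t` and `ξ` with integer coefficients (it does not depend on
`x`), and this polynomial is irreducible in `ℂ[ξ][t] = ℂ[t, ξ]`. -/
def HasIrreducibleCharpoly {ι : Type*} [Fintype ι]
    (N : (Fin m → ℝ) → (Fin m → ℝ) → Matrix ι ι ℂ) : Prop :=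
  ∃ P : Polynomial (MvPolynomial (Fin m) ℤ),
    (∀ ξ x : Fin m → ℝ, (∀ i, 0 < ξ i) →
      (N ξ x).charpoly =
        P.map (MvPolynomial.eval₂Hom (Int.castRingHom ℂ) (fun i => (ξ i : ℂ)))) ∧
    Irreducible (P.map (MvPolynomial.map (Int.castRingHom ℂ)))

/-- The tangential sites avoid a finite list of resonances: no polynomial of the list, a
polynomial with integer coefficients in the coordinates of some number `k` of vectors, vanishes
at `k` distinct members of the family `v`. -/
def IsGeneric (res : Finset (Σ k : ℕ, MvPolynomial (Fin k × Fin n) ℤ))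
    (v : Fin m → Fin n → ℤ) : Prop :=
  ∀ p ∈ res, ∀ f : Fin p.1 ↪ Fin m, MvPolynomial.eval (fun q => v (f q.1) q.2) p.2 ≠ 0

end NLSBlocks

end

open scoped Matrix

noncomputable section

namespace NLSBlocks

/-! Give each site its signed label d = σ(a)L(a). An edge marked (i,j) changes d by ±e_i ± e_j, and
1 + ∑ d_k is the sign. Conjugation by the diagonal matrix of the ∏ √ξ_k^{d_k} turns C_A into a
matrix with integer polynomial entries (`labelMatrix`): the linear forms (d,ξ) on the diagonal, and
twice a signed monomial for every edge. After removal of the phases, M'_A is 2 C_A plus the scalar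
|r|² + 4∑ξ_i, with r the root (`blockM'_eq`). So everything reduces to the irreducibility of the
characteristic polynomial of the label matrix, and to control of the labels that occur.

If the labels of a component are pairwise incongruent modulo 2, reduction at a place of ℂ above 2
makes the matrix diagonal with distinct entries, so a factorisation FG splits the sites into two
sets. Some edge x–y crosses between them. At t = (d_x,ξ) the characteristic polynomial equals 4
times an arrow determinant, and Gauss's lemma puts the whole factor 4 into F. Modulo 2 the
determinant is then divisible by F/4 and by G, where G contains the factor of y. That factor
vanishes for ξ_i = ξ_j, whereas the determinant does not (`det_arrowMatrix_ne_zero`,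
`irreducible_charpoly_labelMatrix`).

The geometry bounds the labels. A label d with root r satisfies one equation in r, affine if d is
black and spherical if it is red (`Realizes.equation`). For generic sites a system of labels is
realised only if it is realised on a Zariski dense set, which has two consequences. A linear
relation between labels also holds between the off-diagonal entries of the matrices d dᵀ
(`Dense.sum_mul_eq_zero`). And n + 1 independent labels, two of them black, never occur
(`Dense.not_linearIndependent`): eliminating r leaves an identity in the sites whose leading part,
in one coordinate, forces a black label e_l - e_k and then r = v_k, which is not a normal site.

Let five labels form a connected set. Three have the same sign, so relative to one of these two
others are black, and for n ≤ 3 the five cannot be affinely independent. If four of them were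
pairwise incongruent modulo 2, the relations between squares and a 2-adic descent would make them
affinely independent (`two_dvd_of_affine_relation`). Hence every four of the five contain a
congruent pair. Congruent labels are neither adjacent nor have a common neighbour, since a site is
joined to at most one other in the plane of two tangential sites. This leaves a path of five labels
in which two congruent pairs overlap, and the relation between squares excludes it
(`Cluster.card_ne_five`). So a component has at most four labels, and closed paths have trivial
label (`PathLabel.unique`).

Four labels that include a congruent pair form a path with steps x + y, y + z, z + x, where x, y, z
are signed variables. Its quartic characteristic polynomial is restricted to the three lines x = 0,
y = 0, z = 0 of the plane x + y + z = 1. The possible factors on the lines do not agree at the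
common points (`irreducible_pathPoly`). -/

/-! ### Signed labels and the polynomial form of the matrix C_A. -/

/-- Two labels differ by the label of an edge marked `i, j`. -/
def Marked {m : ℕ} (i j : Fin m) (a b : Fin m → ℤ) : Prop :=
  i ≠ j ∧ ∃ ε ε' : ℤˣ, b = a + Pi.single i (ε : ℤ) + Pi.single j (ε' : ℤ)

/-- Two labels are joined by an edge. -/
def Adjacent {m : ℕ} (a b : Fin m → ℤ) : Prop := ∃ i j, Marked i j a b

open Classical in
/-- The conjugate of `C_A` with polynomial entries, in terms of the signed labels of the sites. -/
def labelMatrix {m : ℕ} {ι : Type*} (Λ : Type*) [CommRing Λ] (δ : ι → Fin m → ℤ) :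
    Matrix ι ι (MvPolynomial (Fin m) Λ) := fun a b =>
  if a = b then ∑ k, ((δ a k : ℤ) : MvPolynomial (Fin m) Λ) * MvPolynomial.X k
  else if Adjacent (δ a) (δ b) then
    2 * (((1 + ∑ k, δ b k : ℤ) : MvPolynomial (Fin m) Λ) *
      ∏ k, MvPolynomial.X k ^ (δ a k - δ b k).toNat)
  else 0

theorem Marked.symm {m : ℕ} {i j : Fin m} {a b : Fin m → ℤ} (h : Marked i j a b) :
    Marked i j b a := by
  obtain ⟨hij, ε, ε', rfl⟩ := h
  refine ⟨hij, -ε, -ε', ?_⟩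
  funext k
  simp only [Pi.add_apply, Pi.single_apply, Units.val_neg]
  split_ifs <;> ring

theorem Adjacent.symm {m : ℕ} {a b : Fin m → ℤ} (h : Adjacent a b) : Adjacent b a := by
  obtain ⟨i, j, h⟩ := h
  exact ⟨i, j, h.symm⟩

theorem labelMatrix_map {m : ℕ} {ι Λ Λ' : Type*} [CommRing Λ] [CommRing Λ'] (f : Λ →+* Λ')
    (δ : ι → Fin m → ℤ) :
    (labelMatrix Λ δ).map (MvPolynomial.map f) = labelMatrix Λ' δ := by
  ext1 a b
  simp only [labelMatrix, Matrix.map_apply]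
  split_ifs <;> simp

theorem labelMatrix_charpoly_map {m : ℕ} {ι Λ Λ' : Type*} [CommRing Λ] [CommRing Λ'] [Fintype ι]
    [DecidableEq ι] (f : Λ →+* Λ') (δ : ι → Fin m → ℤ) :
    (labelMatrix Λ δ).charpoly.map (MvPolynomial.map f) = (labelMatrix Λ' δ).charpoly := by
  rw [← Matrix.charpoly_map, labelMatrix_map]

/-! ### Gauss's lemma over a valuation ring, and a place above 2. -/

section Valuation

open MvPolynomial

variable {σ O : Type*} [CommRing O] [IsDomain O] [ValuationRing O]

theorem exists_dvd_all_of_valuationRing (s : Finset O) (hs : s.Nonempty) :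
    ∃ c ∈ s, ∀ d ∈ s, c ∣ d := by
  induction hs using Finset.Nonempty.cons_induction with
  | singleton a => exact ⟨a, by simp, by simp⟩
  | cons a s ha hs ih =>
    obtain ⟨c, hc, h⟩ := ih
    rcases ValuationRing.dvd_total a c with h1 | h1
    · exact ⟨a, by simp, by
        intro d hd
        rcases Finset.mem_cons.1 hd with rfl | hd
        · exact dvd_rfl
        · exact h1.trans (h d hd)⟩
    · exact ⟨c, by simp [hc], by
        intro d hd
        rcases Finset.mem_cons.1 hd with rfl | hd
        · exact h1
        · exact h d hd⟩

/-- In a valuation ring some coefficient divides all the others, and it serves as the content: the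
quotient has a coefficient 1, which survives in the residue field. -/
theorem exists_eq_C_mul_primitive {p : MvPolynomial σ O} (hp : p ≠ 0) :
    ∃ c q, p = C c * q ∧ MvPolynomial.map (IsLocalRing.residue O) q ≠ 0 := by
  classical
  obtain ⟨c, hc, h⟩ := exists_dvd_all_of_valuationRing (p.support.image p.coeff)
    (by simpa using hp)
  obtain ⟨i, hi, rfl⟩ := Finset.mem_image.1 hc
  have hd : C (p.coeff i) ∣ p := by
    rw [C_dvd_iff_dvd_coeff]
    intro j
    by_cases hj : j ∈ p.support
    · exact h _ (Finset.mem_image_of_mem _ hj)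
    · rw [notMem_support_iff.1 hj]; exact dvd_zero _
  obtain ⟨q, hq⟩ := hd
  refine ⟨_, q, hq, fun h0 => ?_⟩
  have h1 : p.coeff i = p.coeff i * q.coeff i := by
    conv_lhs => rw [hq]
    rw [coeff_C_mul]
  have h2 : q.coeff i = 1 := by
    have h3 := mem_support_iff.1 hi
    exact mul_left_cancel₀ h3 (by rw [← h1, mul_one])
  have h4 := congrArg (coeff i) h0
  rw [coeff_map, h2] at h4
  simp at h4

/-- Gauss's lemma: after division by the content of p, a remaining non-unit constant e would make a
product of two non-zero polynomials over the residue field vanish. -/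
theorem C_dvd_of_primitive_mul {p q y : MvPolynomial σ O} {c : O} (h : p * q = C c * y)
    (hq : MvPolynomial.map (IsLocalRing.residue O) q ≠ 0) : C c ∣ p := by
  by_cases hp : p = 0
  · rw [hp]; exact dvd_zero _
  obtain ⟨d, p', hp', hne⟩ := exists_eq_C_mul_primitive hp
  have hd : d ≠ 0 := by rintro rfl; simp at hp'; exact hp hp'
  suffices hcd : c ∣ d by
    rw [hp']
    exact (map_dvd C hcd).mul_right _
  rcases ValuationRing.dvd_total c d with h1 | ⟨e, rfl⟩
  · exact h1
  · have h2 : p' * q = C e * y := by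
      have h3 : C (σ := σ) d ≠ 0 := by simpa using hd
      apply mul_left_cancel₀ h3
      rw [← mul_assoc, ← hp', h, map_mul, mul_assoc]
    have h4 : IsUnit e := by
      by_contra he
      have h5 : IsLocalRing.residue O e = 0 := by
        rwa [IsLocalRing.residue_eq_zero_iff, IsLocalRing.mem_maximalIdeal, mem_nonunits_iff]
      have h6 := congrArg (MvPolynomial.map (IsLocalRing.residue O)) h2
      rw [map_mul, map_mul, map_C, h5, map_zero, zero_mul] at h6
      exact (mul_ne_zero hne hq) h6
    exact (associated_mul_unit_left d e h4).dvd

end Valuation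

/-- The localisation of ℤ at 2 embeds in K and is dominated by a valuation ring of K. As the
inclusion is local, 2 stays a non-unit. -/
theorem exists_valuationSubring_two_mem (K : Type*) [Field K] [CharZero K] :
    ∃ V : ValuationSubring K, ¬ IsUnit (2 : V) := by
  have hp : (Ideal.span {(2 : ℤ)}).IsPrime :=
    (Ideal.span_singleton_prime two_ne_zero).2 Int.prime_two
  let R := Localization.AtPrime (Ideal.span {(2 : ℤ)})
  have hu : ∀ y : (Ideal.span {(2 : ℤ)}).primeCompl, IsUnit (Int.castRingHom K y) := by
    intro y
    have hy : (y : ℤ) ≠ 0 := by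
      intro h
      apply y.2
      rw [h]
      exact Ideal.zero_mem _
    simpa using hy
  let f : R →+* K := IsLocalization.lift hu
  obtain ⟨V, h, hloc⟩ := IsLocalRing.exists_factor_valuationRing f
  refine ⟨V, fun h2 => ?_⟩
  have h3 : IsUnit ((f.codRestrict V.toSubring h) 2) := by
    have : (f.codRestrict V.toSubring h) 2 = (2 : V) := map_ofNat _ 2
    rw [this]; exact h2
  have h4 : IsUnit (2 : R) := isUnit_of_map_unit (f.codRestrict V.toSubring h) _ h3
  have h5 : (2 : R) = algebraMap ℤ R 2 := by simp
  rw [h5, IsLocalization.AtPrime.isUnit_to_map_iff R (Ideal.span {(2 : ℤ)})] at h4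
  exact h4 (Ideal.mem_span_singleton_self 2)

/-! ### The arrow matrix and its specialisation in characteristic two. -/

/-- An arrow matrix with exactly one vanishing diagonal entry beside the corner is nonsingular. -/
theorem det_arrow_ne_zero {ι R : Type*} [Fintype ι] [DecidableEq ι] [CommRing R] [IsDomain R]
    (N : Matrix ι ι R) (a b : ι) (hab : a ≠ b) (hbb : N b b = 0)
    (hx : N a b ≠ 0) (hy : N b a ≠ 0) (hz : ∀ g, g ≠ a → g ≠ b → N g g ≠ 0)
    (ho : ∀ g h, g ≠ a → h ≠ a → g ≠ h → N g h = 0) : N.det ≠ 0 := by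
  intro hdet
  obtain ⟨w, hw, h⟩ := Matrix.exists_mulVec_eq_zero_iff.2 hdet
  -- For a kernel vector w, row b gives w_a = 0, the rows other than a and b then give w_g = 0, and
  -- row a finally gives w_b = 0. The corner entry plays no part.
  have hrow : ∀ g, g ≠ a → N g a * w a + N g g * w g = 0 := by
    intro g hg
    have := congrFun h g
    rw [Matrix.mulVec, dotProduct, Finset.sum_eq_add_of_mem a g (by simp) (by simp) hg.symm] at this
    · exact this
    · intro c _ hc
      rw [ho g c hg hc.1 hc.2.symm, zero_mul]
  have hwa : w a = 0 := by
    have := hrow b hab.symm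
    rw [hbb, zero_mul, add_zero] at this
    exact (mul_eq_zero.1 this).resolve_left hy
  have hwg : ∀ g, g ≠ a → g ≠ b → w g = 0 := by
    intro g hg hgb
    have := hrow g hg
    rw [hwa, mul_zero, zero_add] at this
    exact (mul_eq_zero.1 this).resolve_left (hz g hg hgb)
  have hwb : w b = 0 := by
    have := congrFun h a
    rw [Matrix.mulVec, dotProduct, Finset.sum_eq_single b] at this
    · exact (mul_eq_zero.1 this).resolve_left hx
    · intro c _ hc
      by_cases hca : c = a
      · rw [hca, hwa, mul_zero]
      · rw [hwg c hca hc, mul_zero]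
    · simp
  apply hw
  funext g
  by_cases hga : g = a
  · rw [hga, hwa]; rfl
  by_cases hgb : g = b
  · rw [hgb, hwb]; rfl
  · exact hwg g hga hgb

/-- The linear form with the coefficients of a label. -/
def labelForm {m : ℕ} (Λ : Type*) [CommRing Λ] (d : Fin m → ℤ) : MvPolynomial (Fin m) Λ :=
  ∑ k, ((d k : ℤ) : MvPolynomial (Fin m) Λ) * MvPolynomial.X k

theorem labelForm_map {m : ℕ} {Λ Λ' : Type*} [CommRing Λ] [CommRing Λ'] (f : Λ →+* Λ')
    (d : Fin m → ℤ) : MvPolynomial.map f (labelForm Λ d) = labelForm Λ' d := by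
  simp [labelForm]

open Classical in
/-- The matrix `t - C` at the `a`-th diagonal entry `t`, with a factor `2` removed from the row and
from the column of `a`. -/
def arrowMatrix {m : ℕ} {ι : Type*} (Λ : Type*) [CommRing Λ] (δ : ι → Fin m → ℤ) (a : ι) :
    Matrix ι ι (MvPolynomial (Fin m) Λ) := fun g h =>
  if g = h then labelForm Λ (δ a) - labelForm Λ (δ g)
  else if Adjacent (δ g) (δ h) then
    (if g = a then 1 else if h = a then 1 else 2) *
    -(((1 + ∑ k, δ h k : ℤ) : MvPolynomial (Fin m) Λ) *
      ∏ k, MvPolynomial.X k ^ (δ g k - δ h k).toNat)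
  else 0

theorem arrowMatrix_map {m : ℕ} {ι Λ Λ' : Type*} [CommRing Λ] [CommRing Λ'] (f : Λ →+* Λ')
    (δ : ι → Fin m → ℤ) (a : ι) :
    (arrowMatrix Λ δ a).map (MvPolynomial.map f) = arrowMatrix Λ' δ a := by
  ext1 g h
  simp only [arrowMatrix, Matrix.map_apply]
  split_ifs <;> simp [labelForm_map]

/-- At this value of t the corner entry at a vanishes and the rest of row a and column a is even, so
one factor 2 comes out of each. -/
theorem eval_charpoly_labelMatrix {m : ℕ} {ι Λ : Type*} [CommRing Λ] [Fintype ι] [DecidableEq ι]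
    (δ : ι → Fin m → ℤ) (a : ι) :
    (labelMatrix Λ δ).charpoly.eval (labelForm Λ (δ a)) = 4 * (arrowMatrix Λ δ a).det := by
  classical
  rw [Matrix.eval_charpoly]
  have h : Matrix.scalar ι (labelForm Λ (δ a)) - labelMatrix Λ δ =
      Matrix.diagonal (fun g => if g = a then 2 else 1) * arrowMatrix Λ δ a *
        Matrix.diagonal (fun g => if g = a then 2 else 1) := by
    ext1 g h
    rw [Matrix.mul_diagonal, Matrix.diagonal_mul]
    simp only [Matrix.sub_apply, Matrix.scalar_apply, labelMatrix, arrowMatrix,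
      Matrix.diagonal_apply]
    by_cases hgh : g = h
    · subst hgh
      simp only [if_true]
      by_cases hga : g = a
      · subst hga; simp [labelForm]
      · simp [hga, labelForm]
    · simp only [hgh, if_false]
      split_ifs with h1 h2 h3 h4
      · exact absurd (h2.trans h3.symm) hgh
      all_goals ring
  rw [h, Matrix.det_mul, Matrix.det_mul, Matrix.det_diagonal, Finset.prod_ite_eq']
  simp; ring

open MvPolynomial in
theorem eval_labelForm_ne_zero {m : ℕ} {κ : Type*} [Field κ] [CharP κ 2] {d : Fin m → ℤ}
    {i j : Fin m} (hij : i ≠ j) (h : (∃ k, k ≠ i ∧ k ≠ j ∧ ¬ 2 ∣ d k) ∨ ¬ 2 ∣ d i + d j) :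
    aeval (fun k => if k = j then (X i : MvPolynomial (Fin m) κ) else X k) (labelForm κ d) ≠ 0 := by
  have key : ∀ n : ℤ, ¬ 2 ∣ n → (n : κ) ≠ 0 := fun n hn h0 =>
    hn ((CharP.intCast_eq_zero_iff κ 2 n).1 h0)
  have hev : ∀ x : Fin m → κ, eval x (aeval (fun k => if k = j then
      (X i : MvPolynomial (Fin m) κ) else X k) (labelForm κ d)) =
      ∑ k, (d k : κ) * (if k = j then x i else x k) := by
    intro x
    simp only [labelForm, map_sum, map_mul, map_intCast, aeval_X]
    refine Finset.sum_congr rfl fun k _ => ?_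
    split_ifs <;> simp
  intro h0
  rcases h with ⟨k, hki, hkj, hk⟩ | h
  · have := hev (Pi.single k 1)
    rw [h0, map_zero, Finset.sum_eq_single k] at this
    · rw [if_neg hkj, Pi.single_eq_same, mul_one] at this
      exact key _ hk this.symm
    · intro l _ hl
      split_ifs
      · rw [Pi.single_eq_of_ne hki.symm, mul_zero]
      · rw [Pi.single_eq_of_ne hl, mul_zero]
    · simp
  · have := hev (Pi.single i 1)
    rw [h0, map_zero, Finset.sum_eq_add_of_mem i j (by simp) (by simp) hij] at this
    · rw [if_neg hij, if_pos rfl, Pi.single_eq_same, mul_one, mul_one, ← Int.cast_add] at this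
      exact key _ h this.symm
    · intro l _ hl
      rw [if_neg hl.2, Pi.single_eq_of_ne hl.1, mul_zero]

open MvPolynomial in
/-- The specialisation `ξ_j = ξ_i` of the arrow matrix in characteristic two. -/
theorem det_arrowMatrix_ne_zero {m : ℕ} {ι κ : Type*} [Field κ] [CharP κ 2] [Fintype ι]
    [DecidableEq ι] (δ : ι → Fin m → ℤ) (hs : ∀ a, ¬ 2 ∣ 1 + ∑ k, δ a k)
    (hmod : ∀ a b, a ≠ b → ∃ k, ¬ 2 ∣ δ a k - δ b k) {a b : ι} {i j : Fin m}
    (hab : Marked i j (δ a) (δ b)) :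
    aeval (fun k => if k = j then (X i : MvPolynomial (Fin m) κ) else X k)
      (labelForm κ (δ a) - labelForm κ (δ b)) = 0 ∧
    aeval (fun k => if k = j then (X i : MvPolynomial (Fin m) κ) else X k)
      (arrowMatrix κ δ a).det ≠ 0 := by
  classical
  set φ := aeval (R := κ) (fun k => if k = j then (X i : MvPolynomial (Fin m) κ) else X k) with hφ
  have h2 : (2 : MvPolynomial (Fin m) κ) = 0 := by
    rw [← map_ofNat (C : κ →+* MvPolynomial (Fin m) κ) 2, CharTwo.two_eq_zero, map_zero]
  have hne : a ≠ b := by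
    rintro rfl
    obtain ⟨hij, ε, ε', h⟩ := hab
    have := congrFun h i
    simp [hij] at this
  have hsub : ∀ g, labelForm κ (δ a) - labelForm κ (δ g) = labelForm κ (δ a - δ g) := by
    intro g
    simp only [labelForm, Pi.sub_apply, Int.cast_sub, sub_mul, Finset.sum_sub_distrib]
  have hzero : φ (labelForm κ (δ a) - labelForm κ (δ b)) = 0 := by
    obtain ⟨hij, ε, ε', h⟩ := hab
    rw [hsub, h, labelForm, map_sum, Finset.sum_eq_add_of_mem i j (by simp) (by simp) hij]
    · have h3 : (2 : MvPolynomial (Fin m) κ) * X i = 0 := by rw [h2, zero_mul]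
      have h4 : (-X i : MvPolynomial (Fin m) κ) = X i := by
        rw [neg_eq_iff_add_eq_zero, ← two_mul, h3]
      rcases Int.units_eq_one_or ε with rfl | rfl <;> rcases Int.units_eq_one_or ε' with rfl | rfl <;>
        simp [hφ, hij, hij.symm, h4, ← two_mul, h3]
    · intro k _ hk
      simp [hk.1, hk.2]
  refine ⟨hzero, ?_⟩
  have hodd : ∀ g, ((1 + ∑ k, δ g k : ℤ) : MvPolynomial (Fin m) κ) ≠ 0 := by
    intro g h0
    have h1 : ((1 + ∑ k, δ g k : ℤ) : κ) = 0 := by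
      apply C_injective (Fin m) κ
      rw [map_intCast, h0, map_zero]
    exact hs g ((CharP.intCast_eq_zero_iff κ 2 _).1 h1)
  have hmon : ∀ e : Fin m → ℕ, φ (∏ k, X k ^ e k) ≠ 0 := by
    intro e
    rw [map_prod]
    refine Finset.prod_ne_zero_iff.2 fun k _ => ?_
    rw [map_pow, hφ, aeval_X]
    refine pow_ne_zero _ ?_
    split_ifs <;> exact X_ne_zero _
  rw [AlgHom.map_det]
  have hadj : Adjacent (δ a) (δ b) := ⟨i, j, hab⟩
  apply det_arrow_ne_zero _ a b hne
  · simp only [AlgHom.mapMatrix_apply, Matrix.map_apply, arrowMatrix, if_true]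
    exact hzero
  · simp only [AlgHom.mapMatrix_apply, Matrix.map_apply, arrowMatrix, if_neg hne, if_pos hadj,
      if_true, one_mul, map_neg, map_mul, map_intCast]
    refine neg_ne_zero.2 (mul_ne_zero (hodd _) (hmon _))
  · simp only [AlgHom.mapMatrix_apply, Matrix.map_apply, arrowMatrix, if_neg hne.symm,
      if_pos hadj.symm, if_true, one_mul, map_neg, map_mul, map_intCast]
    refine neg_ne_zero.2 (mul_ne_zero (hodd _) (hmon _))
  · intro g hga hgb
    simp only [AlgHom.mapMatrix_apply, Matrix.map_apply, arrowMatrix, if_true]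
    rw [hsub]
    obtain ⟨hij, ε, ε', h⟩ := hab
    apply eval_labelForm_ne_zero hij
    -- If the restricted form vanished, d_a - d_g would be even outside i, j and have an even sum on
    -- {i, j}. Then g would be congruent to a or, since b differs from a by odd amounts at i and j,
    -- to b.
    by_contra hcon
    push Not at hcon
    obtain ⟨h3, h4⟩ := hcon
    simp only [Pi.sub_apply] at h3 h4
    obtain ⟨k, hk⟩ := hmod a g hga.symm
    have hk' : k = i ∨ k = j := by
      by_contra hc
      push Not at hc
      exact hk (h3 k hc.1 hc.2)
    have hε : ∀ ε : ℤˣ, ¬ (2 : ℤ) ∣ (ε : ℤ) := by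
      intro ε
      rcases Int.units_eq_one_or ε with rfl | rfl <;> decide
    have e1 := hε ε
    have e2 := hε ε'
    obtain ⟨l, hl⟩ := hmod b g hgb.symm
    apply hl
    have hbi : δ b i = δ a i + ε := by rw [h]; simp [hij]
    have hbj : δ b j = δ a j + ε' := by rw [h]; simp [hij.symm]
    have hbl : ∀ l, l ≠ i → l ≠ j → δ b l = δ a l := by
      intro l hi hj; rw [h]; simp [hi, hj]
    by_cases hli : l = i
    · subst hli
      rw [hbi]
      rcases hk' with rfl | rfl <;> omega
    by_cases hlj : l = j
    · subst hlj
      rw [hbj]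
      rcases hk' with rfl | rfl <;> omega
    rw [hbl l hli hlj]
    exact h3 l hli hlj
  · intro g h hg hh hgh
    simp only [AlgHom.mapMatrix_apply, Matrix.map_apply, arrowMatrix, if_neg hgh, if_neg hg,
      if_neg hh, h2, zero_mul, ite_self, map_zero]

/-! ### Irreducibility for pairwise incongruent labels. -/

/-- The coefficients of a monic factor of a monic polynomial are integral over V[ξ]. Coefficient by
coefficient, integrality descends to V, which is integrally closed in ℂ. -/
theorem exists_monic_lift {m : ℕ} {V : ValuationSubring ℂ}
    {P : Polynomial (MvPolynomial (Fin m) V)} (hP : P.Monic)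
    {F : Polynomial (MvPolynomial (Fin m) ℂ)} (hF : F.Monic)
    (hd : F ∣ P.map (MvPolynomial.map (algebraMap V ℂ))) :
    ∃ F' : Polynomial (MvPolynomial (Fin m) V), F'.Monic ∧ F'.natDegree = F.natDegree ∧
      F'.map (MvPolynomial.map (algebraMap V ℂ)) = F := by
  let _ : Algebra (MvPolynomial (Fin m) V) (MvPolynomial (Fin m) ℂ) := MvPolynomial.algebraMvPolynomial
  have hc : ∀ i, IsIntegral (MvPolynomial (Fin m) V) (F.coeff i) :=
    Polynomial.isIntegral_coeff_of_dvd P F hP hF hd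
  have hl : F ∈ Polynomial.lifts (MvPolynomial.map (σ := Fin m) (algebraMap V ℂ)) := by
    rw [Polynomial.lifts_iff_coeff_lifts]
    intro i
    have h1 := MvPolynomial.isIntegral_iff_isIntegral_coeff.1 (hc i)
    have h2 : F.coeff i ∈ Set.range (MvPolynomial.map (σ := Fin m) (algebraMap V ℂ)) := by
      rw [MvPolynomial.mem_range_map_iff_coeffs_subset]
      intro c hc
      obtain ⟨n, _, rfl⟩ := MvPolynomial.mem_coeffs_iff.1 hc
      exact IsIntegrallyClosed.isIntegral_iff.1 (h1 n)
    exact h2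
  obtain ⟨F', h1, h2, h3⟩ := Polynomial.lifts_and_natDegree_eq_and_monic hl hF
  exact ⟨F', h3, h2, h1⟩

-- Modulo 2 the polynomial has distinct linear factors, one for each label; an edge between the
-- labels of F and those of G contradicts the factorisation already modulo 4. The hypothesis `hcut`
-- is connectedness, and `hs` says that the signs are odd, so that edges keep non-zero entries after
-- a factor 2 is removed.
open Polynomial in
theorem irreducible_charpoly_labelMatrix {m : ℕ} {ι : Type*} [Fintype ι] [DecidableEq ι]
    [Nonempty ι] (δ : ι → Fin m → ℤ) (hs : ∀ a, ¬ 2 ∣ 1 + ∑ k, δ a k)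
    (hmod : ∀ a b, a ≠ b → ∃ k, ¬ 2 ∣ δ a k - δ b k)
    (hcut : ∀ S : Finset ι, S.Nonempty → S ≠ Finset.univ →
      ∃ a ∈ S, ∃ b ∉ S, Adjacent (δ a) (δ b)) :
    Irreducible (labelMatrix ℂ δ).charpoly := by
  classical
  obtain ⟨V, hV⟩ := exists_valuationSubring_two_mem ℂ
  let κ := IsLocalRing.ResidueField V
  have h2κ : (2 : κ) = 0 := by
    have : IsLocalRing.residue V 2 = 0 := by
      rwa [IsLocalRing.residue_eq_zero_iff, IsLocalRing.mem_maximalIdeal, mem_nonunits_iff]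
    rwa [map_ofNat] at this
  have : CharP κ 2 := CharTwo.of_one_ne_zero_of_two_eq_zero one_ne_zero h2κ
  have hinj : Function.Injective (MvPolynomial.map (σ := Fin m) (algebraMap V ℂ)) :=
    MvPolynomial.map_injective _ (IsFractionRing.injective V ℂ)
  have hPV := Matrix.charpoly_monic (labelMatrix V δ)
  have hPmap := labelMatrix_charpoly_map (algebraMap V ℂ) δ
  rw [(Matrix.charpoly_monic _).irreducible_iff_natDegree]
  refine ⟨fun h1 => ?_, ?_⟩
  · have := congrArg natDegree h1
    rw [Matrix.charpoly_natDegree_eq_dim, natDegree_one] at this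
    exact Fintype.card_ne_zero this
  intro F G hF hG hFG
  obtain ⟨F', hF', hFd, hFm⟩ := exists_monic_lift hPV hF (by rw [hPmap, ← hFG]; exact dvd_mul_right _ _)
  obtain ⟨G', hG', hGd, hGm⟩ := exists_monic_lift hPV hG (by rw [hPmap, ← hFG]; exact dvd_mul_left _ _)
  have hFG' : F' * G' = (labelMatrix V δ).charpoly := by
    apply Polynomial.map_injective _ hinj
    rw [Polynomial.map_mul, hFm, hGm, hFG, hPmap]
  set ρ := MvPolynomial.map (σ := Fin m) (IsLocalRing.residue V) with hρ
  have h2 : (2 : MvPolynomial (Fin m) κ) = 0 := by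
    rw [← map_ofNat (MvPolynomial.C : κ →+* MvPolynomial (Fin m) κ) 2, h2κ, map_zero]
  have hdiag : labelMatrix κ δ = Matrix.diagonal (fun a => labelForm κ (δ a)) := by
    ext1 a b
    simp only [labelMatrix, Matrix.diagonal_apply, h2, zero_mul, ite_self]
    rfl
  have hred : F'.map ρ * G'.map ρ = 1 * ∏ a ∈ Finset.univ, (X - C (labelForm κ (δ a))) := by
    rw [← Polynomial.map_mul, hFG', labelMatrix_charpoly_map, hdiag, Matrix.charpoly_diagonal,
      one_mul]
  obtain ⟨s, t, b, c, hst, hdis, hbc, hFs, hGt⟩ := mul_eq_mul_prime_prod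
    (fun a _ => prime_X_sub_C (labelForm κ (δ a))) hred
  have hunit : ∀ {p : Polynomial (MvPolynomial (Fin m) κ)}, IsUnit p → p.natDegree = 0 :=
    fun h => natDegree_eq_zero_of_isUnit h
  have hb : IsUnit b := IsUnit.of_mul_eq_one c hbc.symm
  have hc : IsUnit c := IsUnit.of_mul_eq_one b (by rw [mul_comm]; exact hbc.symm)
  by_contra hcon
  push Not at hcon
  have hs0 : s.Nonempty := by
    rw [Finset.nonempty_iff_ne_empty]
    rintro rfl
    apply hcon.1
    rw [← hFd, ← hF'.natDegree_map ρ, hFs, Finset.prod_empty, mul_one]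
    exact hunit hb
  have hs1 : s ≠ Finset.univ := by
    rintro rfl
    have ht : t = ∅ := by
      rw [disjoint_comm, Finset.disjoint_left] at hdis
      exact Finset.eq_empty_of_forall_notMem fun a ha => hdis ha (Finset.mem_univ a)
    apply hcon.2
    rw [← hGd, ← hG'.natDegree_map ρ, hGt, ht, Finset.prod_empty, mul_one]
    exact hunit hc
  -- An edge from a label x of F to a label y of G.
  obtain ⟨x, hx, y, hy, i, j, hxy⟩ := hcut s hs0 hs1
  have hyt : y ∈ t := by
    have : y ∈ s ∪ t := by rw [hst]; simp
    exact (Finset.mem_union.1 this).resolve_left hy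
  obtain ⟨hz, hdet⟩ := det_arrowMatrix_ne_zero (κ := κ) δ hs hmod hxy
  have hev : F'.eval (labelForm V (δ x)) * G'.eval (labelForm V (δ x)) =
      MvPolynomial.C 4 * (arrowMatrix V δ x).det := by
    rw [← eval_mul, hFG', eval_charpoly_labelMatrix, map_ofNat]
  have hGev : ρ (G'.eval (labelForm V (δ x))) =
      (c * ∏ a ∈ t, (X - C (labelForm κ (δ a)))).eval (labelForm κ (δ x)) := by
    rw [← hGt, ← labelForm_map (IsLocalRing.residue V), eval_map_apply]
  have hGne : ρ (G'.eval (labelForm V (δ x))) ≠ 0 := by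
    rw [hGev, eval_mul, eval_prod]
    refine mul_ne_zero ?_ (Finset.prod_ne_zero_iff.2 fun a ha => ?_)
    · exact (hc.map (evalRingHom _)).ne_zero
    · intro h0
      simp only [eval_sub, eval_X, eval_C] at h0
      have hxa : x ≠ a := by
        rintro rfl
        exact Finset.disjoint_left.1 hdis hx ha
      obtain ⟨k, hk⟩ := hmod x a hxa
      have h3 := congrArg (MvPolynomial.eval (Pi.single k 1)) h0
      simp only [labelForm, map_sub, map_sum, map_mul, map_intCast, MvPolynomial.eval_X,
        Pi.single_apply, mul_ite, mul_one, mul_zero, Finset.sum_ite_eq',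
        Finset.mem_univ, if_true, map_zero, ← Int.cast_sub] at h3
      exact hk ((CharP.intCast_eq_zero_iff κ 2 _).1 h3)
  -- G has no root (d_x,ξ) modulo 2, so its value there is primitive and the factor 4 divides the
  -- value of F.
  obtain ⟨Z, hZ⟩ := C_dvd_of_primitive_mul hev hGne
  have h4 : (MvPolynomial.C 4 : MvPolynomial (Fin m) V) ≠ 0 := by
    rw [Ne, MvPolynomial.C_eq_zero]
    intro h
    have := congrArg (algebraMap V ℂ) h
    simp at this
  have hfin : Z * G'.eval (labelForm V (δ x)) = (arrowMatrix V δ x).det := by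
    apply mul_left_cancel₀ h4
    rw [← mul_assoc, ← hZ, hev]
  -- Modulo 2 the determinant has the factor (d_x,ξ) - (d_y,ξ) of the value of G, and this factor
  -- vanishes for ξ_j = ξ_i.
  apply hdet
  rw [← arrowMatrix_map (IsLocalRing.residue V), ← RingHom.mapMatrix_apply, ← RingHom.map_det,
    ← hfin, map_mul, hGev, eval_mul, eval_prod, map_mul, map_mul, map_prod,
    Finset.prod_eq_zero hyt, mul_zero, mul_zero]
  simpa using hz

/-! ### Labels as conservation laws for the root. -/

section Geometry

/-- The integral combination `∑ d_k φ_k`. -/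
def pairing {ι Λ : Type*} [Fintype ι] [CommRing Λ] (φ : ι → Λ) (d : ι → ℤ) : Λ :=
  ∑ k, (d k : Λ) * φ k

/-- The integral combination `∑ d_k v_k` of vectors. -/
def comb {ι Λ : Type*} [Fintype ι] [CommRing Λ] {n : ℕ} (v : ι → Fin n → Λ) (d : ι → ℤ) :
    Fin n → Λ := fun j => pairing (fun k => v k j) d

theorem pairing_add {ι Λ : Type*} [Fintype ι] [CommRing Λ] (φ : ι → Λ) (d e : ι → ℤ) :
    pairing φ (d + e) = pairing φ d + pairing φ e := by
  simp [pairing, add_mul, Finset.sum_add_distrib]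

theorem pairing_sub {ι Λ : Type*} [Fintype ι] [CommRing Λ] (φ : ι → Λ) (d e : ι → ℤ) :
    pairing φ (d - e) = pairing φ d - pairing φ e := by
  simp [pairing, sub_mul, Finset.sum_sub_distrib]

theorem pairing_smul {ι Λ : Type*} [Fintype ι] [CommRing Λ] (φ : ι → Λ) (c : ℤ) (d : ι → ℤ) :
    pairing φ (c • d) = c * pairing φ d := by
  simp [pairing, Finset.mul_sum, mul_assoc]

theorem pairing_single {ι Λ : Type*} [Fintype ι] [DecidableEq ι] [CommRing Λ] (φ : ι → Λ) (i : ι)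
    (c : ℤ) : pairing φ (Pi.single i c) = c * φ i := by
  rw [pairing, Finset.sum_eq_single i] <;> simp +contextual

theorem pairing_zero {ι Λ : Type*} [Fintype ι] [CommRing Λ] (φ : ι → Λ) :
    pairing φ (0 : ι → ℤ) = 0 := by
  simp [pairing]

theorem comb_add {ι Λ : Type*} [Fintype ι] [CommRing Λ] {n : ℕ} (v : ι → Fin n → Λ)
    (d e : ι → ℤ) : comb v (d + e) = comb v d + comb v e := by
  funext j; simp [comb, pairing_add]

theorem comb_sub {ι Λ : Type*} [Fintype ι] [CommRing Λ] {n : ℕ} (v : ι → Fin n → Λ)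
    (d e : ι → ℤ) : comb v (d - e) = comb v d - comb v e := by
  funext j; simp [comb, pairing_sub]

theorem comb_smul {ι : Type*} [Fintype ι] {n : ℕ} (v : ι → Fin n → ℤ) (c : ℤ)
    (d : ι → ℤ) : comb v (c • d) = c • comb v d := by
  funext j; exact (pairing_smul _ c d).trans (by simp [comb])

theorem comb_single {ι : Type*} [Fintype ι] [DecidableEq ι] {n : ℕ} (v : ι → Fin n → ℤ) (i : ι)
    (c : ℤ) : comb v (Pi.single i c) = c • v i := by
  funext j; simp [comb, pairing_single]

theorem comb_zero {ι Λ : Type*} [Fintype ι] [CommRing Λ] {n : ℕ} (v : ι → Fin n → Λ) :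
    comb v (0 : ι → ℤ) = 0 := by
  funext j; simp [comb, pairing_zero]

/-- The site reached from `r` by a path with signed label `d`. -/
def position {ι : Type*} [Fintype ι] {n : ℕ} (v : ι → Fin n → ℤ) (r : Fin n → ℤ) (d : ι → ℤ) :
    Fin n → ℤ := (1 + ∑ k, d k) • (r + comb v d)

/-- The signed label `d` fits the site `r`: the corresponding site is a normal site, and satisfies
the conservation law of the label. -/
structure Realizes {ι : Type*} [Fintype ι] {n : ℕ} (v : ι → Fin n → ℤ) (r : Fin n → ℤ)
    (d : ι → ℤ) : Prop where
  sum_eq : ∑ k, d k = 0 ∨ ∑ k, d k = -2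
  norm_eq : (r + comb v d) ⬝ᵥ (r + comb v d) =
    (1 + ∑ k, d k) * (r ⬝ᵥ r + pairing (fun k => v k ⬝ᵥ v k) d)
  site : ∀ k, position v r d ≠ v k

theorem Realizes.sign_mul_sign {ι : Type*} [Fintype ι] {n : ℕ} {v : ι → Fin n → ℤ}
    {r : Fin n → ℤ} {d : ι → ℤ} (h : Realizes v r d) :
    (1 + ∑ k, d k) * (1 + ∑ k, d k) = 1 := by
  rcases h.sum_eq with h | h <;> rw [h] <;> norm_num

theorem sum_smul_sub {ι : Type*} [Fintype ι] (c : ℤ) (d e : ι → ℤ) :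
    ∑ k, (c • (d - e)) k = c * (∑ k, d k - ∑ k, e k) := by
  simp [Finset.mul_sum, Finset.sum_sub_distrib, mul_sub]

section Reroot

variable {ι : Type*} [Fintype ι] {n : ℕ} {v : ι → Fin n → ℤ} {r : Fin n → ℤ} {d e : ι → ℤ}

theorem position_add_comb (v : ι → Fin n → ℤ) (r : Fin n → ℤ) (d e : ι → ℤ) :
    position v r d + comb v ((1 + ∑ k, d k) • (e - d)) = (1 + ∑ k, d k) • (r + comb v e) := by
  rw [position, comb_smul, comb_sub, ← smul_add]
  congr 1
  abel

/-- Seen from the site of d, the label e becomes σ(d)(e - d), and signs multiply because both are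
±1. -/
theorem sign_reroot (h : Realizes v r d) (h' : Realizes v r e) :
    1 + ∑ k, ((1 + ∑ k, d k) • (e - d)) k = (1 + ∑ k, d k) * (1 + ∑ k, e k) := by
  rw [sum_smul_sub]
  rcases h.sum_eq with h | h <;> rcases h'.sum_eq with h' | h' <;> rw [h, h'] <;> norm_num

theorem position_reroot (h : Realizes v r d) (h' : Realizes v r e) :
    position v (position v r d) ((1 + ∑ k, d k) • (e - d)) = position v r e := by
  rw [position, sign_reroot h h', position_add_comb, smul_smul, position]
  congr 1
  linear_combination (1 + ∑ k, e k) * h.sign_mul_sign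

/-- A realised set of labels may be taken relative to any of its members. -/
theorem Realizes.reroot (h : Realizes v r d) (h' : Realizes v r e) :
    Realizes v (position v r d) ((1 + ∑ k, d k) • (e - d)) where
  sum_eq := by
    rw [sum_smul_sub]
    rcases h.sum_eq with h | h <;> rcases h'.sum_eq with h' | h' <;> rw [h, h'] <;> norm_num
  norm_eq := by
    rw [sign_reroot h h', position_add_comb, position, pairing_smul, pairing_sub]
    simp only [smul_dotProduct, dotProduct_smul, smul_eq_mul]
    rw [h.norm_eq, h'.norm_eq]
    simp only [Int.cast_id]
    rcases h.sum_eq with h | h <;> rw [h] <;> ring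
  site := by
    intro k
    rw [position_reroot h h']
    exact h'.site k

end Reroot

theorem position_zero {ι : Type*} [Fintype ι] {n : ℕ} (v : ι → Fin n → ℤ) (r : Fin n → ℤ) :
    position v r 0 = r := by
  simp [position, comb_zero]

theorem realizes_zero {ι : Type*} [Fintype ι] {n : ℕ} {v : ι → Fin n → ℤ} {r : Fin n → ℤ}
    (h : ∀ k, r ≠ v k) : Realizes v r 0 where
  sum_eq := by simp
  norm_eq := by simp [comb_zero, pairing_zero]
  site := by rwa [position_zero]

theorem dotProduct_self_nonneg' {n : ℕ} (x : Fin n → ℤ) : 0 ≤ x ⬝ᵥ x :=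
  Finset.sum_nonneg fun i _ => mul_self_nonneg (x i)

/-! ### Labels supported on two indices. -/

section TwoIndices

variable {m n : ℕ} {v : Fin m → Fin n → ℤ} {r : Fin n → ℤ}

/-- For the label -2e_i the conservation law reads |r - v_i|² = 0. -/
theorem not_realizes_neg_two (hr : ∀ k, r ≠ v k) (i : Fin m) :
    ¬ Realizes v r (Pi.single i (-2)) := by
  intro h
  apply hr i
  have h1 := h.norm_eq
  rw [comb_single, pairing_single] at h1
  have h2 : ∑ k, (Pi.single i (-2) : Fin m → ℤ) k = -2 := by simp
  rw [h2] at h1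
  have h3 : (r - v i) ⬝ᵥ (r - v i) = 0 := by
    simp only [dotProduct_add, add_dotProduct, dotProduct_sub, sub_dotProduct, smul_dotProduct,
      dotProduct_smul, smul_eq_mul, dotProduct_comm (v i) r] at h1 ⊢
    push_cast at h1
    linarith
  exact sub_eq_zero.1 (dotProduct_self_eq_zero.1 h3)

theorem eq_single_add_single {m : ℕ} {i j : Fin m} (hij : i ≠ j) {d : Fin m → ℤ}
    (h : ∀ k, k ≠ i → k ≠ j → d k = 0) : d = Pi.single i (d i) + Pi.single j (d j) := by
  funext k
  by_cases hi : k = i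
  · subst hi; simp [hij]
  by_cases hj : k = j
  · subst hj; simp [hij.symm]
  · simp [hi, hj, h k hi hj]

/-- In the plane of two tangential sites, a normal site is joined to at most one other one. -/
theorem label_unique_of_two_indices (hr : ∀ k, r ≠ v k) {i j : Fin m} (hij : i ≠ j)
    (hv : v i ≠ v j) {d e : Fin m → ℤ} (hd : Realizes v r d) (he : Realizes v r e)
    (hd0 : d ≠ 0) (he0 : e ≠ 0) (hdij : ∀ k, k ≠ i → k ≠ j → d k = 0)
    (heij : ∀ k, k ≠ i → k ≠ j → e k = 0) : d = e := by
  by_contra hne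
  -- In terms of X, U, Y the label λ(e_j - e_i) is the equation X = -λU, and the red label -(1+μ)e_i
  -- - (1-μ)e_j is Y + 2μX + (2μ²-1)U = 0.
  obtain ⟨X, hX⟩ : ∃ X, X = ((2 : ℤ) • r - v i - v j) ⬝ᵥ (v j - v i) := ⟨_, rfl⟩
  obtain ⟨U, hU⟩ : ∃ U, U = (v j - v i) ⬝ᵥ (v j - v i) := ⟨_, rfl⟩
  obtain ⟨Y, hY⟩ : ∃ Y, Y = ((2 : ℤ) • r - v i - v j) ⬝ᵥ ((2 : ℤ) • r - v i - v j) := ⟨_, rfl⟩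
  have hUpos : 0 < U := by
    rcases (dotProduct_self_nonneg' (v j - v i)).lt_or_eq with h | h
    · rw [hU]; exact h
    · exact absurd (sub_eq_zero.1 (dotProduct_self_eq_zero.1 h.symm)).symm hv
  have key : ∀ N : ℤ, ((2 : ℤ) • r - v i - v j + N • (v j - v i)) ⬝ᵥ
      ((2 : ℤ) • r - v i - v j + N • (v j - v i)) = Y + 2 * N * X + N ^ 2 * U := by
    intro N
    rw [hX, hU, hY]
    simp only [dotProduct_add, add_dotProduct, dotProduct_sub, sub_dotProduct, smul_dotProduct,
      dotProduct_smul, smul_eq_mul, dotProduct_comm (v i) r, dotProduct_comm (v j) r,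
      dotProduct_comm (v j) (v i)]
    ring
  -- Both equations together make |2r - v_i - v_j + N(v_j - v_i)|² equal to (1 - (N-μ)² - μ²)U.
  -- Nonnegativity leaves, besides N = μ = 0, only N = ±1 with norm zero, that is r = v_i or r =
  -- v_j.
  have fin : ∀ N μ : ℤ, X = -N * U → Y + 2 * μ * X + (2 * μ ^ 2 - 1) * U = 0 → ¬ (N = 0 ∧ μ = 0) →
      False := by
    intro N μ h1 h2 h3
    have h4 := dotProduct_self_nonneg' ((2 : ℤ) • r - v i - v j + N • (v j - v i))
    have h5 : Y + 2 * N * X + N ^ 2 * U = (1 - (N - μ) ^ 2 - μ ^ 2) * U := by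
      rw [h1] at h2 ⊢
      linear_combination h2
    rw [key, h5] at h4
    have h6 : 0 ≤ 1 - (N - μ) ^ 2 - μ ^ 2 := nonneg_of_mul_nonneg_left h4 hUpos
    have h7 : -1 ≤ μ := by nlinarith [sq_nonneg (N - μ)]
    have h8 : μ ≤ 1 := by nlinarith [sq_nonneg (N - μ)]
    have h9 : -1 ≤ N - μ := by nlinarith [sq_nonneg μ]
    have h10 : N - μ ≤ 1 := by nlinarith [sq_nonneg μ]
    have h11 : (N = 1 ∨ N = -1) ∧ 1 - (N - μ) ^ 2 - μ ^ 2 = 0 := by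
      obtain ⟨K, hK⟩ : ∃ K, K = N - μ := ⟨_, rfl⟩
      rw [← hK] at h6 h9 h10 ⊢
      have hN : N = K + μ := by omega
      subst hN
      clear key h1 h2 h4 h5 hX hU hY
      interval_cases μ <;> interval_cases K <;> omega
    rw [h11.2, zero_mul] at h5
    have h12 := dotProduct_self_eq_zero.1 ((key N).trans h5)
    rcases h11.1 with rfl | rfl
    · apply hr i
      funext l
      have := congrFun h12 l
      simp at this
      omega
    · apply hr j
      funext l
      have := congrFun h12 l
      simp at this
      omega
  have hform : ∀ d : Fin m → ℤ, Realizes v r d → d ≠ 0 → (∀ k, k ≠ i → k ≠ j → d k = 0) →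
      (∃ lam : ℤ, lam ≠ 0 ∧ d = Pi.single i (-lam) + Pi.single j lam ∧ X = -lam * U) ∨
      (∃ μ : ℤ, d = Pi.single i (-1 - μ) + Pi.single j (-1 + μ) ∧
        Y + 2 * μ * X + (2 * μ ^ 2 - 1) * U = 0) := by
    intro d hd hd0 hdij
    have h1 := eq_single_add_single hij hdij
    have h2 : ∑ k, d k = d i + d j := by
      conv_lhs => rw [h1]
      simp [Finset.sum_add_distrib]
    have h3 := hd.norm_eq
    have h4 : comb v d = d i • v i + d j • v j := by
      conv_lhs => rw [h1]
      rw [comb_add, comb_single, comb_single]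
    have h5 : pairing (fun k => v k ⬝ᵥ v k) d = d i * (v i ⬝ᵥ v i) + d j * (v j ⬝ᵥ v j) := by
      conv_lhs => rw [h1]
      rw [pairing_add, pairing_single, pairing_single]
      simp
    rw [h4, h5] at h3
    rcases hd.sum_eq with h6 | h6
    · left
      have h7 : d i = -d j := by omega
      have h8 : d j ≠ 0 := by
        intro h
        apply hd0
        rw [h1, h7, h]
        simp
      refine ⟨d j, h8, by rw [← h7]; exact h1, ?_⟩
      rw [h6, h7] at h3
      apply mul_left_cancel₀ h8
      rw [hX, hU]
      simp only [dotProduct_add, add_dotProduct, dotProduct_sub, sub_dotProduct, smul_dotProduct,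
        dotProduct_smul, smul_eq_mul, dotProduct_comm (v i) r, dotProduct_comm (v j) r,
        dotProduct_comm (v j) (v i)] at h3 ⊢
      linear_combination h3
    · right
      have h7 : d i = -1 - (d j + 1) := by omega
      refine ⟨d j + 1, by rw [← h7]; convert h1 using 3; ring, ?_⟩
      rw [h6, h7] at h3
      rw [hX, hU, hY]
      simp only [dotProduct_add, add_dotProduct, dotProduct_sub, sub_dotProduct, smul_dotProduct,
        dotProduct_smul, smul_eq_mul, dotProduct_comm (v i) r, dotProduct_comm (v j) r,
        dotProduct_comm (v j) (v i)] at h3 ⊢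
      linear_combination 2 * h3
  rcases hform d hd hd0 hdij with ⟨a, ha, hda, hXa⟩ | ⟨a, hda, hXa⟩ <;>
    rcases hform e he he0 heij with ⟨b, hb, heb, hXb⟩ | ⟨b, heb, hXb⟩
  · have : a = b := by
      have : (a - b) * U = 0 := by linear_combination hXa - hXb
      rcases mul_eq_zero.1 this with h | h <;> omega
    subst this
    exact hne (hda.trans heb.symm)
  · exact fin a b hXa hXb fun h => ha h.1
  · exact fin b a hXb hXa fun h => hb h.1
  · have hab : a ≠ b := by
      rintro rfl
      exact hne (hda.trans heb.symm)
    -- The difference of two distinct sphere equations is the hyperplane equation with N = a + b.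
    have h1 : X = -(a + b) * U := by
      have : (a - b) * (2 * (X + (a + b) * U)) = 0 := by linear_combination hXa - hXb
      rcases mul_eq_zero.1 this with h | h
      · omega
      · linarith
    by_cases ha : a = 0
    · exact fin (a + b) a h1 hXa fun h => by omega
    · exact fin (a + b) a h1 hXa fun h => ha h.2

end TwoIndices

/-! ### Labels of paths satisfy the conservation laws. -/

section PathLabels

variable {m n : ℕ} {v : Fin m → Fin n → ℤ} {r a : NormalSite v} {s : ℤˣ} {L : Fin m → ℤ}

/-- Each edge adds its own mass, momentum and energy balance, with a change of overall sign at red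
edges. Thus the signed label determines both the sign and the end point. -/
theorem PathLabel.invariants (h : PathLabel v r a s L) :
    1 + (s : ℤ) * ∑ k, L k = s ∧ a.1 = (s : ℤ) • r.1 + comb v L ∧
      a.1 ⬝ᵥ a.1 = (s : ℤ) * (r.1 ⬝ᵥ r.1) + pairing (fun k => v k ⬝ᵥ v k) L := by
  induction h with
  | nil => simp [comb_zero, pairing_zero]
  | @black a b s L i j h hb ih =>
    obtain ⟨h1, h2, h3⟩ := ih
    obtain ⟨hij, h4, h5⟩ := hb
    refine ⟨?_, ?_, ?_⟩
    · simp only [Pi.add_apply, Pi.sub_apply, Finset.sum_add_distrib, Finset.sum_sub_distrib]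
      simpa using h1
    · rw [comb_add, comb_sub, comb_single, comb_single, one_smul, one_smul, ← h4, h2]
      abel
    · rw [pairing_add, pairing_sub, pairing_single, pairing_single]
      simp only [Int.cast_one, one_mul]
      linarith
  | @red a b s L i j h hb ih =>
    obtain ⟨h1, h2, h3⟩ := ih
    obtain ⟨hij, h4, h5⟩ := hb
    refine ⟨?_, ?_, ?_⟩
    · simp only [Pi.add_apply, Pi.sub_apply, Finset.sum_add_distrib, Finset.sum_sub_distrib]
      have hs := Int.units_coe_mul_self s
      simp only [Finset.sum_pi_single', Finset.mem_univ, if_true, Units.val_neg]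
      linear_combination h1
    · rw [comb_sub, comb_add, comb_single, comb_single, one_smul, one_smul, add_comm (v j), ← h4,
        h2, Units.val_neg, neg_smul]
      abel
    · rw [pairing_sub, pairing_add, pairing_single, pairing_single, Units.val_neg]
      simp only [Int.cast_one, one_mul]
      linarith

theorem PathLabel.one_add_sum (h : PathLabel v r a s L) : 1 + ∑ k, ((s : ℤ) • L) k = s := by
  simp only [Pi.smul_apply, smul_eq_mul, ← Finset.mul_sum]
  exact h.invariants.1

theorem PathLabel.position_eq (h : PathLabel v r a s L) : position v r.1 ((s : ℤ) • L) = a.1 := by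
  have hs := Int.units_coe_mul_self s
  rw [position, h.one_add_sum, comb_smul, smul_add, smul_smul, hs, one_smul, h.invariants.2.1]

theorem PathLabel.realizes (h : PathLabel v r a s L) : Realizes v r.1 ((s : ℤ) • L) where
  sum_eq := by
    have := h.one_add_sum
    rcases Int.units_eq_one_or s with rfl | rfl
    · left; push_cast at this ⊢; omega
    · right; push_cast at this ⊢; omega
  norm_eq := by
    obtain ⟨-, h2, h3⟩ := h.invariants
    have hs := Int.units_coe_mul_self s
    have h4 : r.1 + comb v ((s : ℤ) • L) = (s : ℤ) • a.1 := by
      rw [h2, smul_add, smul_smul, hs, one_smul, comb_smul]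
    rw [h4, h.one_add_sum, pairing_smul, smul_dotProduct, dotProduct_smul, h3]
    simp only [smul_eq_mul, Int.cast_id]
    linear_combination ((s : ℤ) * (r.1 ⬝ᵥ r.1)) * hs
  site := by
    intro k hk
    rw [h.position_eq] at hk
    exact a.2 ⟨k, hk.symm⟩

end PathLabels

end Geometry

/-! ### The quadratic form of a label. -/

section Quadratic

variable {κ Λ Λ' : Type*} [Fintype κ] [CommRing Λ] [CommRing Λ']

/-- The quadratic form with integer coefficients `M`. -/
def quad (M : κ → κ → ℤ) (φ : κ → Λ) : Λ := ∑ k, ∑ l, (M k l : Λ) * (φ k * φ l)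

theorem map_quad (f : Λ →+* Λ') (M : κ → κ → ℤ) (φ : κ → Λ) :
    f (quad M φ) = quad M fun k => f (φ k) := by
  simp [quad, map_sum]

theorem map_pairing (f : Λ →+* Λ') (φ : κ → Λ) (d : κ → ℤ) :
    f (pairing φ d) = pairing (fun k => f (φ k)) d := by
  simp [pairing, map_sum]

theorem quad_sub (M N : κ → κ → ℤ) (φ : κ → Λ) : quad (M - N) φ = quad M φ - quad N φ := by
  simp [quad, sub_mul, Finset.sum_sub_distrib]

theorem quad_sum_smul {τ : Type*} (s : Finset τ) (c : τ → ℤ) (M : τ → κ → κ → ℤ) (φ : κ → Λ) :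
    quad (∑ t ∈ s, c t • M t) φ = ∑ t ∈ s, (c t : Λ) * quad (M t) φ := by
  simp only [quad, Finset.sum_apply, Pi.smul_apply, smul_eq_mul, Int.cast_sum, Int.cast_mul,
    Finset.sum_mul, Finset.mul_sum, mul_assoc]
  symm
  rw [Finset.sum_comm]
  refine Finset.sum_congr rfl fun k _ => ?_
  rw [Finset.sum_comm]

theorem quad_mul (M : κ → κ → ℤ) (c : Λ) (φ : κ → Λ) :
    quad M (fun k => c * φ k) = c ^ 2 * quad M φ := by
  simp only [quad, Finset.mul_sum]
  refine Finset.sum_congr rfl fun k _ => Finset.sum_congr rfl fun l _ => ?_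
  ring

theorem pairing_mul (c : Λ) (φ : κ → Λ) (d : κ → ℤ) :
    pairing (fun k => c * φ k) d = c * pairing φ d := by
  simp only [pairing, Finset.mul_sum]
  refine Finset.sum_congr rfl fun k _ => ?_
  ring

variable [DecidableEq κ]

/-- The quadratic part of the conservation law of a label. -/
def labelQuad (d : κ → ℤ) : κ → κ → ℤ :=
  fun k l => d k * d l - if k = l then (1 + ∑ i, d i) * d k else 0

theorem quad_labelQuad (d : κ → ℤ) (φ : κ → Λ) :
    quad (labelQuad d) φ =
      pairing φ d ^ 2 - (1 + ∑ i, (d i : Λ)) * ∑ k, (d k : Λ) * φ k ^ 2 := by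
  rw [pairing, sq, Finset.sum_mul_sum]
  simp only [quad, labelQuad, Int.cast_sub, sub_mul, Finset.sum_sub_distrib, Int.cast_ite,
    Int.cast_zero, ite_mul, zero_mul, Finset.sum_ite_eq, Finset.mem_univ, if_true]
  rw [Finset.mul_sum]
  congr 1
  · refine Finset.sum_congr rfl fun k _ => Finset.sum_congr rfl fun l _ => ?_
    push_cast
    ring
  · refine Finset.sum_congr rfl fun k _ => ?_
    push_cast
    ring

/-- The norm condition expanded at r. It is affine in r exactly for black labels, and its constant
term is a sum over the coordinates of one quadratic form in the sites. -/
theorem Realizes.equation {n : ℕ} {v : κ → Fin n → ℤ} {r : Fin n → ℤ} {d : κ → ℤ}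
    (h : Realizes v r d) :
    -(∑ k, d k) * (r ⬝ᵥ r) + 2 * (r ⬝ᵥ comb v d) +
      ∑ j, quad (labelQuad d) (fun k => v k j) = 0 := by
  have h1 := h.norm_eq
  have h2 : ∑ j, quad (labelQuad d) (fun k => v k j) =
      comb v d ⬝ᵥ comb v d - (1 + ∑ k, d k) * pairing (fun k => v k ⬝ᵥ v k) d := by
    simp only [quad_labelQuad, Finset.sum_sub_distrib, ← Finset.mul_sum, Int.cast_id]
    congr 1
    · simp only [dotProduct, comb, sq]
    · congr 1
      rw [Finset.sum_comm]
      simp only [pairing, dotProduct, Finset.mul_sum, sq, Int.cast_id]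
  rw [h2]
  simp only [dotProduct_add, add_dotProduct] at h1
  rw [dotProduct_comm (comb v d) r] at h1
  linear_combination h1

end Quadratic

/-! ### Relations between labels that are realised on a dense set. -/

section Dense

variable {n : ℕ} {κ τ : Type*} [Fintype κ]

/-- No non-zero polynomial vanishes at all the families of sites that realise the labels `d`. -/
def Dense (n : ℕ) (d : τ → κ → ℤ) : Prop :=
  ∀ E : MvPolynomial (κ × Fin n) ℤ,
    (∀ (v : κ → Fin n → ℤ) (r : Fin n → ℤ), (∀ k, r ≠ v k) → (∀ t, Realizes v r (d t)) →
      MvPolynomial.eval (fun q => v q.1 q.2) E = 0) → E = 0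

theorem eval_quad_X (M : κ → κ → ℤ) (v : κ → Fin n → ℤ) (j : Fin n) :
    MvPolynomial.eval (fun q : κ × Fin n => v q.1 q.2)
      (quad M fun k => (MvPolynomial.X (k, j) : MvPolynomial (κ × Fin n) ℤ)) =
      quad M fun k => v k j := by
  rw [map_quad]
  simp

/-- Families concentrated in a single coordinate isolate the form itself; unit vectors and their
sums then give its entries by polarisation. -/
theorem eq_zero_of_quad_eq_zero [NeZero n] [DecidableEq κ] (N : κ → κ → ℤ)
    (hN : ∀ k l, N k l = N l k)
    (h : ∀ v : κ → Fin n → ℤ, ∑ j, quad N (fun k => v k j) = 0) (k l : κ) :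
    N k l = 0 := by
  have h1 : ∀ w : κ → ℤ, quad N w = 0 := by
    intro w
    have := h fun k j => if j = 0 then w k else 0
    rw [Finset.sum_eq_single 0] at this
    · simpa using this
    · intro j _ hj
      simp [quad, hj]
    · simp
  have h2 : ∀ k, N k k = 0 := by
    intro k
    simpa [quad, Pi.single_apply] using h1 (Pi.single k 1)
  have h3 := h1 (Pi.single k 1 + Pi.single l 1)
  simp only [quad, Pi.add_apply, mul_add, add_mul, Finset.sum_add_distrib] at h3
  simp [Pi.single_apply] at h3
  have h4 := h2 k
  have h5 := h2 l
  have h6 := hN k l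
  omega

/-- A linear relation between the labels of a dense family is also a relation between the
off-diagonal parts of their squares. -/
theorem Dense.sum_mul_eq_zero [NeZero n] [Fintype τ] {d : τ → κ → ℤ}
    (hD : Dense n d) (c : τ → ℤ) (hc : ∀ k, ∑ t, c t * d t k = 0) {k l : κ} (hkl : k ≠ l) :
    ∑ t, c t * (d t k * d t l) = 0 := by
  classical
  -- In the combination of the equations with weights c_t, all terms with r cancel, and what is left
  -- is a polynomial in the sites alone. It vanishes on the dense set, hence identically.
  have hE := hD (∑ j, quad (∑ t, c t • labelQuad (d t))
    (fun k => (MvPolynomial.X (k, j) : MvPolynomial (κ × Fin n) ℤ))) (by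
      intro v r hr hd
      simp only [quad_sum_smul, map_sum, map_mul, map_intCast, eval_quad_X, Int.cast_id]
      rw [Finset.sum_comm]
      simp only [← Finset.mul_sum]
      have h1 : ∑ t, c t * (-(∑ k, d t k) * (r ⬝ᵥ r) + 2 * (r ⬝ᵥ comb v (d t)) +
        ∑ j, quad (labelQuad (d t)) (fun k => v k j)) = 0 :=
        Finset.sum_eq_zero fun t _ => by rw [(hd t).equation, mul_zero]
      have h2 : ∑ t, c t * ∑ k, d t k = 0 := by
        simp only [Finset.mul_sum]
        rw [Finset.sum_comm]
        exact Finset.sum_eq_zero fun k _ => hc k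
      have h3 : ∑ t, c t * (r ⬝ᵥ comb v (d t)) = 0 := by
        simp only [dotProduct, comb, pairing, Finset.mul_sum]
        rw [Finset.sum_comm]
        refine Finset.sum_eq_zero fun j _ => ?_
        rw [Finset.sum_comm]
        refine Finset.sum_eq_zero fun k _ => ?_
        have h4 := congrArg (fun x => r j * v k j * x) (hc k)
        simp only [Finset.mul_sum, mul_zero] at h4
        rw [← h4]
        refine Finset.sum_congr rfl fun t _ => ?_
        simp only [Int.cast_id]
        ring
      simp only [mul_add, Finset.sum_add_distrib] at h1
      have h5 : ∑ t, c t * (-(∑ k, d t k) * (r ⬝ᵥ r)) =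
          -(r ⬝ᵥ r) * ∑ t, c t * ∑ k, d t k := by
        rw [Finset.mul_sum]
        exact Finset.sum_congr rfl fun t _ => by ring
      have h6 : ∑ t, c t * (2 * (r ⬝ᵥ comb v (d t))) = 2 * ∑ t, c t * (r ⬝ᵥ comb v (d t)) := by
        rw [Finset.mul_sum]
        exact Finset.sum_congr rfl fun t _ => by ring
      rw [h5, h6, h2, h3] at h1
      simpa using h1)
  have h := eq_zero_of_quad_eq_zero (n := n) (∑ t, c t • labelQuad (d t)) (by
      intro k l
      simp only [Finset.sum_apply, Pi.smul_apply, labelQuad, smul_eq_mul]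
      refine Finset.sum_congr rfl fun t _ => ?_
      by_cases h : k = l
      · subst h; rfl
      · rw [if_neg h, if_neg (Ne.symm h)]
        ring) (by
      intro v
      have := congrArg (MvPolynomial.eval fun q => v q.1 q.2) hE
      rw [map_sum] at this
      simpa only [eval_quad_X, map_zero] using this) k l
  simpa [labelQuad, hkl] using h

end Dense

/-! ### Elimination of the root by Cramer's rule. -/

section Elimination

variable {n : ℕ} {κ τ : Type*} [Fintype κ]

theorem exists_dual_of_linearIndependent {σ : Type*} {d : σ → κ → ℤ}
    (h : LinearIndependent ℤ d) (s : σ) :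
    ∃ ψ : κ → ℚ, pairing ψ (d s) ≠ 0 ∧ ∀ t, t ≠ s → pairing ψ (d t) = 0 := by
  classical
  obtain ⟨c, hc⟩ : ∃ c : (κ → ℤ) →+ (κ → ℚ), ∀ x k, c x k = x k :=
    ⟨(Int.castAddHom ℚ).compLeft κ, fun _ _ => rfl⟩
  have hLI : LinearIndependent ℚ fun t => c (d t) := by
    rw [← LinearIndependent.iff_fractionRing ℤ ℚ]
    refine h.map' c.toIntLinearMap ?_
    rw [LinearMap.ker_eq_bot]
    intro x y hxy
    funext k
    have := congrFun hxy k
    simpa [hc] using this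
  have hs := hLI.notMem_span_image (s := {t | t ≠ s}) (x := s) (by simp)
  obtain ⟨f, hf, hker⟩ := Submodule.exists_le_ker_of_notMem hs
  have key : ∀ t, pairing (fun k => f (Pi.single k 1)) (d t) = f (c (d t)) := by
    intro t
    have h1 : c (d t) = ∑ k, (d t k : ℚ) • (Pi.single k 1 : κ → ℚ) := by
      funext k
      simp [Finset.sum_apply, Pi.single_apply, hc]
    rw [h1, map_sum, pairing]
    exact Finset.sum_congr rfl fun k _ => by rw [map_smul, smul_eq_mul]
  refine ⟨fun k => f (Pi.single k 1), by rwa [key], fun t ht => ?_⟩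
  rw [key]
  exact hker (Submodule.subset_span ⟨t, ht, rfl⟩)

variable {Λ Λ' : Type*} [CommRing Λ] [CommRing Λ']

/-- The matrix of the linear parts of the conservation laws. -/
def combMatrix (ℓ : Fin n → κ → ℤ) (v : κ → Fin n → Λ) : Matrix (Fin n) (Fin n) Λ :=
  Matrix.of fun s => comb v (ℓ s)

theorem combMatrix_apply (ℓ : Fin n → κ → ℤ) (v : κ → Fin n → Λ) (s j : Fin n) :
    combMatrix ℓ v s j = pairing (fun k => v k j) (ℓ s) := rfl

theorem combMatrix_map (f : Λ →+* Λ') (ℓ : Fin n → κ → ℤ) (v : κ → Fin n → Λ) :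
    f.mapMatrix (combMatrix ℓ v) = combMatrix ℓ fun k j => f (v k j) := by
  ext s j
  exact map_pairing f _ _

/-- The sum over the coordinates of the values of a quadratic form. -/
def quadSum (M : κ → κ → ℤ) (v : κ → Fin n → Λ) : Λ := ∑ j, quad M fun k => v k j

theorem map_quadSum (f : Λ →+* Λ') (M : κ → κ → ℤ) (v : κ → Fin n → Λ) :
    f (quadSum M v) = quadSum M fun k j => f (v k j) := by
  simp [quadSum, map_sum, map_quad]

theorem map_comb (f : Λ →+* Λ') (v : κ → Fin n → Λ) (d : κ → ℤ) (j : Fin n) :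
    f (comb v d j) = comb (fun k j => f (v k j)) d j := map_pairing f _ _

/-- Twice the determinant times the solution of the linear equations. -/
def cramerVec (ℓ : Fin n → κ → ℤ) (M : Fin n → κ → κ → ℤ) (v : κ → Fin n → Λ) : Fin n → Λ :=
  (combMatrix ℓ v).adjugate *ᵥ fun s => -quadSum (M s) v

theorem map_cramerVec (f : Λ →+* Λ') (ℓ : Fin n → κ → ℤ) (M : Fin n → κ → κ → ℤ)
    (v : κ → Fin n → Λ) (j : Fin n) :
    f (cramerVec ℓ M v j) = cramerVec ℓ M (fun k j => f (v k j)) j := by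
  rw [cramerVec, RingHom.map_mulVec, ← RingHom.mapMatrix_apply, RingHom.map_adjugate,
    combMatrix_map]
  congr 2
  funext s
  simp [map_quadSum]

theorem combMatrix_mulVec_cramerVec (ℓ : Fin n → κ → ℤ) (M : Fin n → κ → κ → ℤ)
    (v : κ → Fin n → Λ) :
    combMatrix ℓ v *ᵥ cramerVec ℓ M v = fun s => -((combMatrix ℓ v).det * quadSum (M s) v) := by
  rw [cramerVec, Matrix.mulVec_mulVec, Matrix.mul_adjugate, Matrix.smul_mulVec, Matrix.one_mulVec]
  funext s
  simp

/-- The result of eliminating the root from the linear equations and a further equation. -/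
def eliminant (ℓ : Fin n → κ → ℤ) (M : Fin n → κ → κ → ℤ) (g : ℤ) (e : κ → ℤ) (N : κ → κ → ℤ)
    (v : κ → Fin n → Λ) : Λ :=
  g * (cramerVec ℓ M v ⬝ᵥ cramerVec ℓ M v) +
    4 * (combMatrix ℓ v).det * (cramerVec ℓ M v ⬝ᵥ comb v e) +
    4 * (combMatrix ℓ v).det ^ 2 * quadSum N v

theorem map_eliminant (f : Λ →+* Λ') (ℓ : Fin n → κ → ℤ) (M : Fin n → κ → κ → ℤ) (g : ℤ)
    (e : κ → ℤ) (N : κ → κ → ℤ) (v : κ → Fin n → Λ) :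
    f (eliminant ℓ M g e N v) = eliminant ℓ M g e N fun k j => f (v k j) := by
  simp only [eliminant, map_add, map_mul, map_pow, map_intCast, map_ofNat, dotProduct, map_sum,
    map_cramerVec, map_comb, RingHom.map_det, combMatrix_map, map_quadSum]

/-- The family of the coordinates as variables. -/
def genericSites (n : ℕ) (κ : Type*) : κ → Fin n → MvPolynomial (κ × Fin n) ℤ :=
  fun k j => MvPolynomial.X (k, j)

theorem eval_genericSites {κ : Type*} (v : κ → Fin n → ℤ) :
    (fun k j => MvPolynomial.eval (fun q : κ × Fin n => v q.1 q.2) (genericSites n κ k j)) = v := by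
  simp [genericSites]

/-- The Cramer vector is 2 det · r, so the eliminant is 4 det² times the further equation. -/
theorem eliminant_eq_zero {ℓ : Fin n → κ → ℤ} {M : Fin n → κ → κ → ℤ} {g : ℤ} {e : κ → ℤ}
    {N : κ → κ → ℤ} {v : κ → Fin n → ℤ} {r : Fin n → ℤ}
    (h1 : ∀ s, 2 * (r ⬝ᵥ comb v (ℓ s)) + quadSum (M s) v = 0)
    (h2 : g * (r ⬝ᵥ r) + 2 * (r ⬝ᵥ comb v e) + quadSum N v = 0) :
    eliminant ℓ M g e N v = 0 := by
  have h3 : cramerVec ℓ M v = (2 * (combMatrix ℓ v).det) • r := by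
    have h4 : (fun s => -quadSum (M s) v) = combMatrix ℓ v *ᵥ ((2 : ℤ) • r) := by
      funext s
      have : (combMatrix ℓ v *ᵥ ((2 : ℤ) • r)) s = 2 * (r ⬝ᵥ comb v (ℓ s)) := by
        rw [Matrix.mulVec_smul, Pi.smul_apply, dotProduct_comm]
        rfl
      rw [this]
      linarith [h1 s]
    rw [cramerVec, h4, Matrix.mulVec_mulVec, Matrix.adjugate_mul, Matrix.smul_mulVec,
      Matrix.one_mulVec, smul_smul, mul_comm]
  rw [eliminant, h3]
  simp only [smul_dotProduct, dotProduct_smul, smul_eq_mul, Int.cast_id]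
  linear_combination (4 * (combMatrix ℓ v).det ^ 2) * h2

/-- In a dense family the equations have a rational solution for almost all sites. -/
theorem Dense.exists_solution {d : τ → κ → ℤ} (hD : Dense n d) {ℓ : Fin n → κ → ℤ}
    {M : Fin n → κ → κ → ℤ} {g : ℤ} {e : κ → ℤ} {N : κ → κ → ℤ}
    (hrow : ∀ (v : κ → Fin n → ℤ) (r : Fin n → ℤ), (∀ t, Realizes v r (d t)) →
      (∀ s, 2 * (r ⬝ᵥ comb v (ℓ s)) + quadSum (M s) v = 0) ∧
        g * (r ⬝ᵥ r) + 2 * (r ⬝ᵥ comb v e) + quadSum N v = 0)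
    (v : κ → Fin n → ℚ) (hv : (combMatrix ℓ v).det ≠ 0) :
    ∃ r : Fin n → ℚ, (∀ s, 2 * (r ⬝ᵥ comb v (ℓ s)) + quadSum (M s) v = 0) ∧
      g * (r ⬝ᵥ r) + 2 * (r ⬝ᵥ comb v e) + quadSum N v = 0 := by
  -- Density makes the eliminant vanish identically over ℤ, so it vanishes at all rational families,
  -- realised or not.
  have h0 : eliminant ℓ M g e N (genericSites n κ) = 0 := by
    apply hD
    intro w r _ hd
    rw [map_eliminant, eval_genericSites]
    exact eliminant_eq_zero (hrow w r hd).1 (hrow w r hd).2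
  have h1 : eliminant ℓ M g e N v = 0 := by
    have := congrArg (MvPolynomial.eval₂Hom (Int.castRingHom ℚ) fun q => v q.1 q.2) h0
    rw [map_eliminant, map_zero] at this
    simpa [genericSites] using this
  refine ⟨(2 * (combMatrix ℓ v).det)⁻¹ • cramerVec ℓ M v, ?_, ?_⟩
  · intro s
    have h2 := congrFun (combMatrix_mulVec_cramerVec ℓ M v) s
    have h3 : cramerVec ℓ M v ⬝ᵥ comb v (ℓ s) = -((combMatrix ℓ v).det * quadSum (M s) v) := by
      rw [dotProduct_comm]
      exact h2
    rw [smul_dotProduct, h3, smul_eq_mul]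
    field_simp
    ring
  · rw [eliminant] at h1
    simp only [smul_dotProduct, dotProduct_smul, smul_eq_mul]
    field_simp
    linear_combination h1

/-- Functionals dual to the labels, used as the coordinates of the sites, make the matrix diagonal.
-/
theorem exists_det_combMatrix_ne_zero {ℓ : Fin n → κ → ℤ} (hℓ : LinearIndependent ℤ ℓ) :
    ∃ v : κ → Fin n → ℚ, (combMatrix ℓ v).det ≠ 0 := by
  choose ψ h1 h2 using exists_dual_of_linearIndependent hℓ
  refine ⟨fun k j => ψ j k, ?_⟩
  have : combMatrix ℓ (fun k j => ψ j k) = Matrix.diagonal fun s => pairing (ψ s) (ℓ s) := by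
    ext s j
    rw [combMatrix_apply, Matrix.diagonal_apply]
    split_ifs with h
    · rw [h]
    · exact h2 j s h
  rw [this, Matrix.det_diagonal]
  exact Finset.prod_ne_zero_iff.2 fun s _ => h1 s

end Elimination

/-! ### The leading part of the elimination identity in one coordinate. -/

section Leading

variable {n : ℕ} {κ : Type*} [Fintype κ]

/-- If the equations can be solved for almost all sites, then the solution of the linear equations
with the constant terms of one coordinate is parallel to this coordinate. -/
theorem exists_quad_eq_mul_comb (j₀ : Fin n) {ℓ : Fin n → κ → ℤ} {M : Fin n → κ → κ → ℤ}
    {g : ℤ} {e : κ → ℤ} {N : κ → κ → ℤ}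
    (hsol : ∀ v : κ → Fin n → ℚ, (combMatrix ℓ v).det ≠ 0 →
      ∃ r : Fin n → ℚ, (∀ s, 2 * (r ⬝ᵥ comb v (ℓ s)) + quadSum (M s) v = 0) ∧
        g * (r ⬝ᵥ r) + 2 * (r ⬝ᵥ comb v e) + quadSum N v = 0)
    (hcase : g ≠ 0 ∨ g = 0 ∧ ∃ η : κ → ℚ, pairing η e ≠ 0 ∧ ∀ s, pairing η (ℓ s) = 0)
    (v : κ → Fin n → ℚ) (hv : (combMatrix ℓ v).det ≠ 0) :
    ∃ c : ℚ, ∀ s, quad (M s) (fun k => v k j₀) = c * comb v (ℓ s) j₀ := by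
  have hinj : ∀ a b : Fin n → ℚ, (∀ s, a ⬝ᵥ comb v (ℓ s) = b ⬝ᵥ comb v (ℓ s)) → a = b := by
    intro a b h
    apply Matrix.mulVec_injective_of_isUnit
      ((Matrix.isUnit_iff_isUnit_det _).2 (isUnit_iff_ne_zero.2 hv))
    funext s
    have := h s
    rw [dotProduct_comm a, dotProduct_comm b] at this
    exact this
  have hsurj : ∀ h : Fin n → ℚ, ∃ a : Fin n → ℚ, ∀ s, 2 * (a ⬝ᵥ comb v (ℓ s)) + h s = 0 := by
    intro h
    refine ⟨(combMatrix ℓ v)⁻¹ *ᵥ fun s => -(h s / 2), fun s => ?_⟩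
    have h1 : combMatrix ℓ v *ᵥ ((combMatrix ℓ v)⁻¹ *ᵥ fun s => -(h s / 2)) =
        fun s => -(h s / 2) := by
      rw [Matrix.mulVec_mulVec, Matrix.mul_nonsing_inv _ (isUnit_iff_ne_zero.2 hv),
        Matrix.one_mulVec]
    have h2 := congrFun h1 s
    rw [dotProduct_comm]
    change comb v (ℓ s) ⬝ᵥ _ = _ at h2
    rw [h2]
    ring
  -- The constant terms are split into the part of the coordinate j₀ and the rest. Scaling the other
  -- coordinates by ε turns the solution, in rescaled coordinates, into a + ε²b. The aim is that a
  -- has only the component j₀.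
  obtain ⟨a, ha⟩ := hsurj fun s => quad (M s) fun k => v k j₀
  obtain ⟨b, hb⟩ := hsurj fun s => quadSum (M s) v - quad (M s) fun k => v k j₀
  -- the equations for the sites with all but one coordinate scaled by `ε`
  have hscale : ∀ w : κ → Fin n → ℚ, (∀ k, w k j₀ = v k j₀) →
      (∀ s, comb w (ℓ s) = comb v (ℓ s)) → ∀ ε : ℚ, ε ≠ 0 → ∀ b : Fin n → ℚ,
      (∀ s, 2 * (b ⬝ᵥ comb v (ℓ s)) + (quadSum (M s) w - quad (M s) fun k => v k j₀) = 0) →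
      g * (∑ j, (if j = j₀ then ε ^ 2 else 1) * (a j + ε ^ 2 * b j) ^ 2) +
        ε ^ 2 * (2 * ((a + ε ^ 2 • b) ⬝ᵥ comb w e) +
        ((quad N fun k => v k j₀) + ε ^ 2 * (quadSum N w - quad N fun k => v k j₀))) = 0 := by
    intro w hw hwℓ ε hε b hb
    obtain ⟨δ, hδ⟩ : ∃ δ : Fin n → ℚ, δ = fun j => if j = j₀ then 1 else ε := ⟨_, rfl⟩
    have hδ0 : ∀ j, δ j ≠ 0 := by
      intro j
      rw [hδ]
      dsimp only
      split_ifs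
      · exact one_ne_zero
      · exact hε
    have hc : ∀ f : κ → ℤ, comb (fun k j => δ j * w k j) f = fun j => δ j * comb w f j :=
      fun f => funext fun j => pairing_mul _ _ _
    have hdot : ∀ (x : Fin n → ℚ) (f : κ → ℤ), x ⬝ᵥ comb (fun k j => δ j * w k j) f =
        (fun j => δ j * x j) ⬝ᵥ comb w f := by
      intro x f
      rw [hc]
      exact Finset.sum_congr rfl fun j _ => by ring
    have hq : ∀ K : κ → κ → ℤ, quadSum K (fun k j => δ j * w k j) =
        (quad K fun k => v k j₀) + ε ^ 2 * (quadSum K w - quad K fun k => v k j₀) := by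
      intro K
      have h1 : (quad K fun k => v k j₀) = quad K fun k => w k j₀ := by simp only [hw]
      rw [h1, quadSum, quadSum, ← Finset.add_sum_erase _ _ (Finset.mem_univ j₀),
        ← Finset.add_sum_erase _ (fun j => quad K fun k => w k j) (Finset.mem_univ j₀),
        add_sub_cancel_left, Finset.mul_sum]
      congr 1
      · simp [hδ]
      · refine Finset.sum_congr rfl fun j hj => ?_
        rw [quad_mul, hδ]
        simp [Finset.ne_of_mem_erase hj]
    have hdet : (combMatrix ℓ fun k j => δ j * w k j).det ≠ 0 := by
      have : (combMatrix ℓ fun k j => δ j * w k j) = combMatrix ℓ v * Matrix.diagonal δ := by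
        ext s j
        rw [Matrix.mul_diagonal, combMatrix, Matrix.of_apply, hc, hwℓ, mul_comm]
        rfl
      rw [this, Matrix.det_mul, Matrix.det_diagonal]
      exact mul_ne_zero hv (Finset.prod_ne_zero_iff.2 fun j _ => hδ0 j)
    obtain ⟨r, hr1, hr2⟩ := hsol _ hdet
    have hr : (fun j => δ j * r j) = a + ε ^ 2 • b := by
      apply hinj
      intro s
      have h1 := hr1 s
      rw [hdot, hq, hwℓ] at h1
      rw [add_dotProduct, smul_dotProduct, smul_eq_mul]
      linear_combination (1 / 2) * h1 - (1 / 2) * ha s - (ε ^ 2 / 2) * hb s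
    rw [hdot, hq, hr] at hr2
    have h3 : ∑ j, (if j = j₀ then ε ^ 2 else 1) * (a j + ε ^ 2 * b j) ^ 2 =
        ε ^ 2 * (r ⬝ᵥ r) := by
      rw [dotProduct, Finset.mul_sum]
      refine Finset.sum_congr rfl fun j _ => ?_
      have h4 : δ j * r j = a j + ε ^ 2 * b j := congrFun hr j
      rw [← h4, hδ]
      dsimp only
      split_ifs <;> ring
    rw [h3]
    linear_combination ε ^ 2 * hr2
  have hzero : ∀ j, j ≠ j₀ → a j = 0 := by
    rcases hcase with hg | ⟨hg, η, hη, hηℓ⟩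
    · have h1 := hscale v (fun _ => rfl) (fun _ => rfl) 1 (by norm_num) b hb
      have h2 := hscale v (fun _ => rfl) (fun _ => rfl) 2 (by norm_num) b hb
      have h3 := hscale v (fun _ => rfl) (fun _ => rfl) 3 (by norm_num) b hb
      have h4 := hscale v (fun _ => rfl) (fun _ => rfl) 4 (by norm_num) b hb
      have h5 : (g : ℚ) * ∑ j, (if j = j₀ then 0 else 1) * a j ^ 2 = 0 := by
        -- Lagrange extrapolation to ε² = 0 from ε² = 1, 4, 9, 16 of a polynomial of degree at most
        -- 3 in ε². The factor ε² in the component j₀ and in the lower order terms makes these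
        -- disappear at 0, leaving a sum of squares.
        have h6 : ∑ j, (if j = j₀ then 0 else 1) * a j ^ 2 =
            8 / 5 * (∑ j, (if j = j₀ then (1 : ℚ) ^ 2 else 1) * (a j + 1 ^ 2 * b j) ^ 2) -
            4 / 5 * (∑ j, (if j = j₀ then (2 : ℚ) ^ 2 else 1) * (a j + 2 ^ 2 * b j) ^ 2) +
            8 / 35 * (∑ j, (if j = j₀ then (3 : ℚ) ^ 2 else 1) * (a j + 3 ^ 2 * b j) ^ 2) -
            1 / 35 * (∑ j, (if j = j₀ then (4 : ℚ) ^ 2 else 1) * (a j + 4 ^ 2 * b j) ^ 2) := by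
          simp only [Finset.mul_sum, ← Finset.sum_add_distrib, ← Finset.sum_sub_distrib]
          refine Finset.sum_congr rfl fun j _ => ?_
          split_ifs <;> ring
        rw [h6]
        simp only [add_dotProduct, smul_dotProduct, smul_eq_mul] at h1 h2 h3 h4
        linear_combination 8 / 5 * h1 - 4 / 5 * h2 + 8 / 35 * h3 - 1 / 35 * h4
      have h6 : ∑ j, (if j = j₀ then 0 else 1) * a j ^ 2 = 0 :=
        (mul_eq_zero.1 h5).resolve_left (by exact_mod_cast hg)
      intro j hj
      have h7 := (Finset.sum_eq_zero_iff_of_nonneg (fun j _ => by split_ifs <;> positivity)).1 h6 j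
        (Finset.mem_univ j)
      simpa [hj] using h7
    · have hlin : ∀ w : κ → Fin n → ℚ, (∀ k, w k j₀ = v k j₀) →
          (∀ s, comb w (ℓ s) = comb v (ℓ s)) →
          2 * (a ⬝ᵥ comb w e) + (quad N fun k => v k j₀) = 0 := by
        intro w hw hwℓ
        obtain ⟨b, hb⟩ := hsurj fun s => quadSum (M s) w - quad (M s) fun k => v k j₀
        have h1 := hscale w hw hwℓ 1 (by norm_num) b hb
        have h2 := hscale w hw hwℓ 2 (by norm_num) b hb
        simp only [hg, Int.cast_zero, zero_mul, add_dotProduct, smul_dotProduct, smul_eq_mul]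
          at h1 h2
        -- The relation is ε²(P + ε²Q) = 0, and ε = 1, 2 are combined to remove Q.
        linear_combination 4 / 3 * h1 - 1 / 12 * h2
      intro j hj
      have h1 := hlin v (fun _ => rfl) fun _ => rfl
      have hcw : ∀ f : κ → ℤ, comb (fun k i => v k i + (if i = j then 1 else 0) * η k) f =
          fun i => comb v f i + (if i = j then 1 else 0) * pairing η f := by
        intro f
        funext i
        rw [← pairing_mul]
        simp only [comb, pairing, ← Finset.sum_add_distrib, mul_add]
      -- Moving the j-th coordinate along η changes the pairing with e but leaves all ℓ_s fixed, so
      -- the relation isolates a_j.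
      have h2 := hlin (fun k i => v k i + (if i = j then 1 else 0) * η k)
        (fun k => by simp [hj.symm]) (fun s => by rw [hcw]; simp [hηℓ])
      rw [hcw] at h2
      have h3 : (a ⬝ᵥ fun i => comb v e i + (if i = j then 1 else 0) * pairing η e) =
          a ⬝ᵥ comb v e + a j * pairing η e := by
        simp [dotProduct, mul_add, Finset.sum_add_distrib]
      rw [h3] at h2
      have h4 : a j * pairing η e = 0 := by linear_combination (1 / 2) * h2 - (1 / 2) * h1
      exact (mul_eq_zero.1 h4).resolve_right hη
  refine ⟨-2 * a j₀, fun s => ?_⟩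
  have h1 := ha s
  rw [dotProduct, Finset.sum_eq_single j₀ (fun j _ hj => by rw [hzero j hj, zero_mul])
    (by simp)] at h1
  linear_combination h1

end Leading

/-! ### Black labels with proportional quadratic and linear forms. -/

section Cubic

variable {κ : Type*} [Fintype κ] [DecidableEq κ]

/-- The vector d_l e_k - d_k e_l is orthogonal to d and gives d_k d_l (d_k + d_l) = 0. Any two
non-zero entries are therefore opposite, which rules out a third. -/
theorem eq_single_sub_single_of_sq_sum {d : κ → ℤ} (hsum : ∑ k, d k = 0) (hd : d ≠ 0)
    (h : ∀ φ : κ → ℚ, pairing φ d = 0 → ∑ k, (d k : ℚ) * φ k ^ 2 = 0) :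
    ∃ (k l : κ) (c : ℤ), k ≠ l ∧ c ≠ 0 ∧ d = Pi.single l c - Pi.single k c := by
  have hopp : ∀ k l, k ≠ l → d k ≠ 0 → d l ≠ 0 → d k = -d l := by
    intro k l hkl hk hl
    have h1 := h (Pi.single k (d l : ℚ) - Pi.single l (d k : ℚ)) (by
      simp only [pairing, Pi.sub_apply, mul_sub, Finset.sum_sub_distrib, Pi.single_apply]
      simp
      ring)
    have h2 : ∀ i, (d i : ℚ) * (Pi.single k (d l : ℚ) - Pi.single l (d k : ℚ) : κ → ℚ) i ^ 2 =
        (Pi.single k ((d k : ℚ) * d l ^ 2) + Pi.single l ((d l : ℚ) * d k ^ 2) : κ → ℚ) i := by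
      intro i
      by_cases hi : i = k
      · subst hi; simp [hkl]
      · by_cases hi' : i = l
        · subst hi'; simp [hi]
        · simp [hi, hi']
    simp only [h2, Pi.add_apply, Finset.sum_add_distrib] at h1
    simp at h1
    have h3 : d k * d l * (d k + d l) = 0 := by
      have : ((d k * d l * (d k + d l) : ℤ) : ℚ) = 0 := by
        push_cast
        linear_combination h1
      exact_mod_cast this
    have h4 := (mul_eq_zero.1 h3).resolve_left (mul_ne_zero hk hl)
    omega
  obtain ⟨k, hk⟩ := Function.ne_iff.1 hd
  simp only [Pi.zero_apply] at hk
  obtain ⟨l, hlk, hl⟩ : ∃ l, l ≠ k ∧ d l ≠ 0 := by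
    by_contra! hcon
    rw [Finset.sum_eq_single k (fun l _ hl => hcon l hl) (by simp)] at hsum
    exact hk hsum
  refine ⟨k, l, d l, hlk.symm, hl, ?_⟩
  have h1 := hopp k l hlk.symm hk hl
  funext i
  by_cases hi : i = k
  · subst hi; simp [hlk.symm, h1]
  · by_cases hi' : i = l
    · subst hi'; simp [hi]
    · simp only [Pi.sub_apply, Pi.single_eq_of_ne hi', Pi.single_eq_of_ne hi, sub_zero]
      by_contra h0
      have h2 := hopp i k hi h0 hk
      have h3 := hopp i l hi' h0 hl
      omega

/-- On the hyperplane orthogonal to d the cubic identity leaves -(∑ d_k φ_k²)(φ,e) = 0, which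
settles the points with (φ,e) ≠ 0. The others follow from the parallelogram identity with φ + ψ and
φ - ψ. -/
theorem sq_sum_eq_zero_of_cubic {d e : κ → ℤ} (hd : ∑ k, d k = 0)
    (h : ∀ φ : κ → ℚ, quad (labelQuad d) φ * pairing φ e = quad (labelQuad e) φ * pairing φ d)
    {ψ : κ → ℚ} (hψ : pairing ψ d = 0) (hψ' : pairing ψ e ≠ 0) (φ : κ → ℚ)
    (hφ : pairing φ d = 0) : ∑ k, (d k : ℚ) * φ k ^ 2 = 0 := by
  have hd' : ∑ k, (d k : ℚ) = 0 := by exact_mod_cast hd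
  have key : ∀ φ : κ → ℚ, pairing φ d = 0 → pairing φ e ≠ 0 →
      ∑ k, (d k : ℚ) * φ k ^ 2 = 0 := by
    intro φ h1 h2
    have h3 := h φ
    rw [quad_labelQuad, h1, hd', mul_zero] at h3
    have h4 := (mul_eq_zero.1 h3).resolve_right h2
    linear_combination -h4
  by_cases hφe : pairing φ e = 0
  · have hadd : ∀ (c : ℚ) (f : κ → ℤ), pairing (fun k => φ k + c * ψ k) f =
        pairing φ f + c * pairing ψ f := by
      intro c f
      rw [← pairing_mul]
      simp only [pairing, ← Finset.sum_add_distrib, mul_add]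
    have h1 := key ψ hψ hψ'
    have h2 := key (fun k => φ k + 1 * ψ k) (by rw [hadd, hφ, hψ]; simp)
      (by rw [hadd, hφe]; simpa using hψ')
    have h3 := key (fun k => φ k + (-1) * ψ k) (by rw [hadd, hφ, hψ]; simp)
      (by rw [hadd, hφe]; simpa using hψ')
    have h4 : ∑ k, (d k : ℚ) * φ k ^ 2 =
        1 / 2 * (∑ k, (d k : ℚ) * (φ k + 1 * ψ k) ^ 2) +
        1 / 2 * (∑ k, (d k : ℚ) * (φ k + (-1) * ψ k) ^ 2) - ∑ k, (d k : ℚ) * ψ k ^ 2 := by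
      simp only [Finset.mul_sum, ← Finset.sum_add_distrib, ← Finset.sum_sub_distrib]
      exact Finset.sum_congr rfl fun k _ => by ring
    rw [h4, h1, h2, h3]
    ring
  · exact key φ hφ hφe

theorem pairing_single_sub_single {Λ : Type*} [CommRing Λ] (φ : κ → Λ) (k l : κ) (c : ℤ) :
    pairing φ (Pi.single l c - Pi.single k c) = c * (φ l - φ k) := by
  rw [pairing_sub, pairing_single, pairing_single]
  ring

theorem quad_labelQuad_single_sub_single {Λ : Type*} [CommRing Λ] (φ : κ → Λ) (k l : κ) (c : ℤ) :
    quad (labelQuad (Pi.single l c - Pi.single k c)) φ =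
      c * (φ l - φ k) * (c * (φ l - φ k) - (φ l + φ k)) := by
  rw [quad_labelQuad, pairing_single_sub_single]
  have h1 : ∑ i, (((Pi.single l c - Pi.single k c : κ → ℤ) i : ℤ) : Λ) = 0 := by
    rw [← Int.cast_sum]
    simp
  have h2 : ∑ i, (((Pi.single l c - Pi.single k c : κ → ℤ) i : ℤ) : Λ) * φ i ^ 2 =
      c * (φ l ^ 2 - φ k ^ 2) := pairing_single_sub_single (fun i => φ i ^ 2) k l c
  rw [h1, h2]
  ring

omit [Fintype κ] in
-- After cancellation of the two linear forms the variable φ_l occurs on one side only, with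
-- coefficient c - 1. The auxiliary y covers the possible coincidence k = p.
theorem eq_one_of_cubic {k l p q : κ} {c c' : ℤ} (hkl : k ≠ l) (hpq : p ≠ q) (hc : c ≠ 0)
    (hc' : c' ≠ 0) (hlp : l ≠ p) (hlq : l ≠ q)
    (h : ∀ φ : κ → ℚ, c * (φ l - φ k) * (c * (φ l - φ k) - (φ l + φ k)) * (c' * (φ q - φ p)) =
      c' * (φ q - φ p) * (c' * (φ q - φ p) - (φ q + φ p)) * (c * (φ l - φ k))) : c = 1 := by
  obtain ⟨y, hy⟩ : ∃ y : ℚ, y = if k = p then 1 else 0 := ⟨_, rfl⟩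
  have hy01 : y = 0 ∨ y = 1 := by rw [hy]; split_ifs <;> simp
  have key : ∀ x : ℚ, x ≠ 0 → x ≠ 1 →
      c * (x - y) - (x + y) = c' * (0 - 1) - (0 + 1) := by
    intro x hx hx1
    have h1 := h fun i => if i = l then x else if i = p then 1 else 0
    simp only [if_true, if_neg hkl, if_neg hlp.symm, if_neg hlq.symm, if_neg hpq.symm,
      ← hy] at h1
    have hxy : x - y ≠ 0 := by
      rcases hy01 with h | h <;> rw [h]
      · simpa using hx
      · exact sub_ne_zero.2 hx1
    have hcq : (c : ℚ) ≠ 0 := by exact_mod_cast hc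
    have hcq' : (c' : ℚ) ≠ 0 := by exact_mod_cast hc'
    apply mul_left_cancel₀ (mul_ne_zero (mul_ne_zero hcq hxy) hcq')
    linear_combination -h1
  have h2 := key 2 (by norm_num) (by norm_num)
  have h3 := key 3 (by norm_num) (by norm_num)
  have : (c : ℚ) = 1 := by linear_combination h3 - h2
  exact_mod_cast this

/-- Both labels are multiples of differences of two unit vectors. If an index of d is missing from
e, the comparison of coefficients makes the multiple ±1; otherwise the labels have the same two
indices and are proportional, against the independence expressed by ψ. -/
theorem eq_single_sub_single_of_cubic {d e : κ → ℤ} (hd : ∑ k, d k = 0) (he : ∑ k, e k = 0)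
    (h : ∀ φ : κ → ℚ, quad (labelQuad d) φ * pairing φ e = quad (labelQuad e) φ * pairing φ d)
    {ψ ψ' : κ → ℚ} (hψ : pairing ψ d = 0) (hψe : pairing ψ e ≠ 0) (hψ' : pairing ψ' e = 0)
    (hψd : pairing ψ' d ≠ 0) : ∃ k l : κ, k ≠ l ∧ d = Pi.single l 1 - Pi.single k 1 := by
  obtain ⟨k, l, c, hkl, hc, rfl⟩ := eq_single_sub_single_of_sq_sum hd
    (by rintro rfl; exact hψd (pairing_zero _)) (sq_sum_eq_zero_of_cubic hd h hψ hψe)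
  obtain ⟨p, q, c', hpq, hc', rfl⟩ := eq_single_sub_single_of_sq_sum he
    (by rintro rfl; exact hψe (pairing_zero _))
    (sq_sum_eq_zero_of_cubic he (fun φ => (h φ).symm) hψ' hψd)
  simp only [pairing_single_sub_single, quad_labelQuad_single_sub_single] at h hψ hψe
  have hcq : (c : ℚ) ≠ 0 := by exact_mod_cast hc
  by_cases hl : l ≠ p ∧ l ≠ q
  · obtain rfl := eq_one_of_cubic hkl hpq hc hc' hl.1 hl.2 h
    exact ⟨k, l, hkl, rfl⟩
  by_cases hk : k ≠ p ∧ k ≠ q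
  · have h1 := eq_one_of_cubic (c := -c) hkl.symm hpq (neg_ne_zero.2 hc) hc' hk.1 hk.2 (by
      intro φ
      have := h φ
      push_cast
      linear_combination this)
    obtain rfl : c = -1 := by omega
    refine ⟨l, k, hkl.symm, ?_⟩
    rw [Pi.single_neg, Pi.single_neg]
    abel
  · exfalso
    have h0 : ψ l = ψ k :=
      sub_eq_zero.1 ((mul_eq_zero.1 hψ).resolve_left hcq)
    apply hψe
    have hl' : l = p ∨ l = q := by tauto
    have hk' : k = p ∨ k = q := by tauto
    rcases hl' with rfl | rfl <;> rcases hk' with rfl | rfl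
    · exact absurd rfl hkl
    · rw [h0, sub_self, mul_zero]
    · rw [h0, sub_self, mul_zero]
    · exact absurd rfl hkl

end Cubic

/-! ### No n + 1 independent labels for generic sites. -/

section Independence

variable {n : ℕ} {κ : Type*} [Fintype κ]

theorem map_genericSites {κ K : Type*} [CommRing K] (v : κ → Fin n → K) :
    (fun k j => MvPolynomial.eval₂Hom (Int.castRingHom K) (fun q : κ × Fin n => v q.1 q.2)
      (genericSites n κ k j)) = v := by
  simp [genericSites]

theorem mvPolynomial_eq_zero_of_eval_rat {σ : Type*} {E : MvPolynomial σ ℤ}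
    (h : ∀ x : σ → ℚ, MvPolynomial.eval₂Hom (Int.castRingHom ℚ) x E = 0) : E = 0 := by
  apply MvPolynomial.funext
  intro x
  have h1 := h fun i => (x i : ℚ)
  have h2 : MvPolynomial.eval₂Hom (Int.castRingHom ℚ) (fun i => (x i : ℚ)) E =
      Int.castRingHom ℚ (MvPolynomial.eval x E) :=
    (MvPolynomial.eval₂_comp_left (Int.castRingHom ℚ) (RingHom.id ℤ) x E).symm
  rw [h2, eq_intCast] at h1
  rw [map_zero]
  exact_mod_cast h1

theorem genericDet_ne_zero {ℓ : Fin n → κ → ℤ} (hℓ : LinearIndependent ℤ ℓ) :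
    (combMatrix ℓ (genericSites n κ)).det ≠ 0 := by
  intro h
  obtain ⟨v, hv⟩ := exists_det_combMatrix_ne_zero hℓ
  apply hv
  have := congrArg (MvPolynomial.eval₂Hom (Int.castRingHom ℚ) fun q => v q.1 q.2) h
  rwa [RingHom.map_det, combMatrix_map, map_genericSites, map_zero] at this

/-- Parallel vectors have vanishing 2 × 2 minors. Multiplied by the determinant, the minors vanish
at all rational families, so they vanish as polynomials and hence over every commutative ring. -/
theorem quad_mul_pairing_comm (j₀ : Fin n) {ℓ : Fin n → κ → ℤ} {M : Fin n → κ → κ → ℤ}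
    (hℓ : LinearIndependent ℤ ℓ)
    (h : ∀ v : κ → Fin n → ℚ, (combMatrix ℓ v).det ≠ 0 →
      ∃ c : ℚ, ∀ s, quad (M s) (fun k => v k j₀) = c * comb v (ℓ s) j₀)
    {K : Type*} [CommRing K] (s t : Fin n) (φ : κ → K) :
    quad (M s) φ * pairing φ (ℓ t) = quad (M t) φ * pairing φ (ℓ s) := by
  have h0 : (combMatrix ℓ (genericSites n κ)).det *
      ((quad (M s) fun k => genericSites n κ k j₀) *
        pairing (fun k => genericSites n κ k j₀) (ℓ t) -
      (quad (M t) fun k => genericSites n κ k j₀) *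
        pairing (fun k => genericSites n κ k j₀) (ℓ s)) = 0 := by
    apply mvPolynomial_eq_zero_of_eval_rat
    intro x
    obtain ⟨v, rfl⟩ : ∃ v : κ → Fin n → ℚ, x = fun q => v q.1 q.2 := ⟨fun k j => x (k, j), rfl⟩
    have hX : ∀ k j, MvPolynomial.eval₂Hom (Int.castRingHom ℚ) (fun q : κ × Fin n => v q.1 q.2)
        (genericSites n κ k j) = v k j := fun k j => congrFun (congrFun (map_genericSites v) k) j
    simp only [map_mul, map_sub, map_quad, map_pairing, RingHom.map_det, combMatrix_map, hX]
    by_cases hv : (combMatrix ℓ v).det = 0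
    · rw [hv, zero_mul]
    · obtain ⟨c, hc⟩ := h v hv
      rw [hc s, hc t]
      simp only [comb]
      ring
  have h1 := (mul_eq_zero.1 h0).resolve_left (genericDet_ne_zero hℓ)
  have h2 := congrArg (MvPolynomial.eval₂Hom (Int.castRingHom K) fun q => φ q.1) h1
  simp only [map_mul, map_sub, map_quad, map_pairing, map_zero, genericSites] at h2
  simp only [MvPolynomial.coe_eval₂Hom, MvPolynomial.eval₂_X] at h2
  exact sub_eq_zero.1 h2

/-- More than `n` linearly independent labels, two of them black, are never realised by generic
sites. -/
theorem Dense.not_linearIndependent [DecidableEq κ] (hn : 2 ≤ n) {d : Fin (n + 1) → κ → ℤ}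
    (hD : Dense n d) (hs : ∀ t, ∑ k, d t k = 0 ∨ ∑ k, d t k = -2) {t₀ t₁ : Fin (n + 1)}
    (ht : t₀ ≠ t₁) (h₀ : ∑ k, d t₀ k = 0) (h₁ : ∑ k, d t₁ k = 0) :
    ¬ LinearIndependent ℤ d := by
  intro hLI
  -- the label to be eliminated
  obtain ⟨u, hu₀, hu₁, hu⟩ : ∃ u, u ≠ t₀ ∧ u ≠ t₁ ∧ ((∀ t, ∑ k, d t k = 0) ∨ ∑ k, d u k = -2) := by
    by_cases hall : ∀ t, ∑ k, d t k = 0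
    · obtain ⟨u, hu⟩ : ∃ u, u ∉ ({t₀, t₁} : Finset (Fin (n + 1))) := by
        by_contra! hcon
        have h1 : (Finset.univ : Finset (Fin (n + 1))).card ≤ ({t₀, t₁} : Finset _).card :=
          Finset.card_le_card fun t _ => hcon t
        have h2 := Finset.card_le_two (a := t₀) (b := t₁)
        rw [Finset.card_univ, Fintype.card_fin] at h1
        omega
      simp only [Finset.mem_insert, Finset.mem_singleton, not_or] at hu
      exact ⟨u, hu.1, hu.2, Or.inl hall⟩
    · push Not at hall
      obtain ⟨u, hu⟩ := hall
      refine ⟨u, ?_, ?_, Or.inr ((hs u).resolve_left hu)⟩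
      · rintro rfl; exact hu h₀
      · rintro rfl; exact hu h₁
  -- Subtracting τ_s d_u from the other labels makes all of them black, so that n equations are
  -- linear in r. If all labels are black, τ = 0.
  obtain ⟨τ, hτ⟩ : ∃ τ : Fin n → ℤ, ∀ s, -2 * τ s = ∑ k, d (u.succAbove s) k ∧
      ((∀ t, ∑ k, d t k = 0) → τ s = 0) := by
    refine ⟨fun s => if ∑ k, d (u.succAbove s) k = 0 then 0 else 1, fun s => ⟨?_, ?_⟩⟩
    · dsimp only
      rcases hs (u.succAbove s) with h | h <;> rw [h] <;> norm_num
    · intro h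
      simp [h]
  have hτu : ∀ s, τ s * ∑ k, d u k = ∑ k, d (u.succAbove s) k := by
    intro s
    rcases hu with hu | hu
    · rw [hu, hu, mul_zero]
    · rw [hu, ← (hτ s).1]
      ring
  obtain ⟨ℓ, hℓ⟩ : ∃ ℓ : Fin n → κ → ℤ, ∀ s, ℓ s = d (u.succAbove s) - τ s • d u :=
    ⟨_, fun _ => rfl⟩
  obtain ⟨M, hM⟩ : ∃ M : Fin n → κ → κ → ℤ, ∀ s,
      M s = labelQuad (d (u.succAbove s)) - τ s • labelQuad (d u) := ⟨_, fun _ => rfl⟩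
  have hℓLI : LinearIndependent ℤ ℓ := by
    rw [Fintype.linearIndependent_iff] at hLI ⊢
    intro c hc s
    have h1 := hLI (u.insertNth (-∑ s, c s * τ s) c) (by
      rw [Fin.sum_univ_succAbove _ u]
      simp only [Fin.insertNth_apply_same, Fin.insertNth_apply_succAbove]
      rw [← hc]
      simp only [hℓ, smul_sub, Finset.sum_sub_distrib, smul_smul, ← Finset.sum_smul, neg_smul]
      abel) (u.succAbove s)
    rwa [Fin.insertNth_apply_succAbove] at h1
  have hquad : ∀ {K : Type} [CommRing K] (s : Fin n) (φ : κ → K), quad (M s) φ =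
      quad (labelQuad (d (u.succAbove s))) φ - τ s * quad (labelQuad (d u)) φ := by
    intro K _ s φ
    rw [hM, quad_sub]
    congr 1
    have := quad_sum_smul {u} (fun _ => τ s) (fun t => labelQuad (d t)) φ
    simpa using this
  have hrow : ∀ (v : κ → Fin n → ℤ) (r : Fin n → ℤ), (∀ t, Realizes v r (d t)) →
      (∀ s, 2 * (r ⬝ᵥ comb v (ℓ s)) + quadSum (M s) v = 0) ∧
        (-∑ k, d u k) * (r ⬝ᵥ r) + 2 * (r ⬝ᵥ comb v (d u)) + quadSum (labelQuad (d u)) v = 0 := by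
    intro v r hr
    refine ⟨fun s => ?_, (hr u).equation⟩
    have h1 := (hr u).equation
    have h2 := (hr (u.succAbove s)).equation
    have h3 := hτu s
    rw [hℓ, comb_sub, comb_smul, dotProduct_sub, dotProduct_smul, quadSum]
    simp only [hquad, Finset.sum_sub_distrib, ← Finset.mul_sum, smul_eq_mul, Int.cast_id]
    linear_combination h2 - τ s * h1 - (r ⬝ᵥ r) * h3
  have hcase : (-∑ k, d u k) ≠ 0 ∨ (-∑ k, d u k) = 0 ∧
      ∃ η : κ → ℚ, pairing η (d u) ≠ 0 ∧ ∀ s, pairing η (ℓ s) = 0 := by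
    rcases hu with hu | hu
    · right
      refine ⟨by rw [hu, neg_zero], ?_⟩
      obtain ⟨η, h1, h2⟩ := exists_dual_of_linearIndependent hLI u
      refine ⟨η, h1, fun s => ?_⟩
      rw [hℓ, (hτ s).2 hu, zero_smul, sub_zero]
      exact h2 _ (Fin.succAbove_ne u s)
    · left
      rw [hu]
      norm_num
  obtain ⟨s₀, rfl⟩ := Fin.exists_succAbove_eq hu₀.symm
  obtain ⟨s₁, rfl⟩ := Fin.exists_succAbove_eq hu₁.symm
  have hs01 : s₀ ≠ s₁ := fun h => ht (by rw [h])
  obtain ⟨j₀⟩ : Nonempty (Fin n) := ⟨s₀⟩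
  have hpar : ∀ {K : Type} [CommRing K] (s t : Fin n) (φ : κ → K),
      quad (M s) φ * pairing φ (ℓ t) = quad (M t) φ * pairing φ (ℓ s) := fun s t φ =>
    quad_mul_pairing_comm j₀ hℓLI
      (exists_quad_eq_mul_comb j₀ (hD.exists_solution hrow) hcase) s t φ
  have hblack : ∀ s, ∑ k, d (u.succAbove s) k = 0 →
      ℓ s = d (u.succAbove s) ∧ M s = labelQuad (d (u.succAbove s)) := by
    intro s h
    have h1 : τ s = 0 := by
      have := (hτ s).1
      omega
    rw [hℓ, hM, h1]
    simp
  obtain ⟨ψ, hψ1, hψ2⟩ := exists_dual_of_linearIndependent hℓLI s₁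
  obtain ⟨ψ', hψ'1, hψ'2⟩ := exists_dual_of_linearIndependent hℓLI s₀
  have hpar0 := fun φ : κ → ℚ => hpar s₀ s₁ φ
  obtain ⟨k, l, hkl, hd⟩ := eq_single_sub_single_of_cubic (d := ℓ s₀) (e := ℓ s₁)
    (by rw [(hblack s₀ h₀).1]; exact h₀) (by rw [(hblack s₁ h₁).1]; exact h₁)
    (by
      rw [(hblack s₀ h₀).2, (hblack s₁ h₁).2] at hpar0
      rwa [(hblack s₀ h₀).1, (hblack s₁ h₁).1] at hpar0 ⊢)
    (hψ2 s₀ hs01) hψ1 (hψ'2 s₁ hs01.symm) hψ'1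
  have hMs₀ : M s₀ = labelQuad (Pi.single l 1 - Pi.single k 1) := by
    rw [(hblack s₀ h₀).2, ← (hblack s₀ h₀).1, hd]
  -- With ℓ_{s₀} = e_l - e_k the quadratic forms become -2φ_k(φ,ℓ_s), and the linear equations say
  -- that r - v_k is orthogonal to n independent vectors. So r = v_k wherever this non-zero
  -- polynomial does not vanish; as r is never v_k, the polynomial vanishes at all realised
  -- families, against density.
  have hne : (combMatrix ℓ (genericSites n κ)).det *
      ∏ j, (genericSites n κ l j - genericSites n κ k j) ≠ 0 := by
    refine mul_ne_zero (genericDet_ne_zero hℓLI) (Finset.prod_ne_zero_iff.2 fun j _ => ?_)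
    rw [sub_ne_zero]
    intro h
    have := MvPolynomial.X_injective h
    exact hkl (congrArg Prod.fst this).symm
  apply hne
  apply hD
  intro v r hrk hr
  by_contra hE
  have hX : ∀ k j, MvPolynomial.eval (fun q : κ × Fin n => v q.1 q.2)
      (genericSites n κ k j) = v k j := fun k j => congrFun (congrFun (eval_genericSites v) k) j
  simp only [map_mul, map_prod, map_sub, RingHom.map_det, combMatrix_map, hX] at hE
  have hdet := left_ne_zero_of_mul hE
  have hprod := Finset.prod_ne_zero_iff.1 (right_ne_zero_of_mul hE)
  apply hrk k
  apply sub_eq_zero.1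
  apply Matrix.eq_zero_of_mulVec_eq_zero hdet
  funext s
  have h1 := (hrow v r hr).1 s
  have h2 : quadSum (M s) v = -2 * (v k ⬝ᵥ comb v (ℓ s)) := by
    rw [quadSum, dotProduct, Finset.mul_sum]
    refine Finset.sum_congr rfl fun j _ => ?_
    have h3 := hpar s s₀ fun k => v k j
    rw [hMs₀, hd, pairing_single_sub_single, quad_labelQuad_single_sub_single] at h3
    apply mul_right_cancel₀ (hprod j (Finset.mem_univ j))
    rw [comb]
    push_cast at h3
    linear_combination h3
  rw [h2] at h1
  change comb v (ℓ s) ⬝ᵥ (r - v k) = 0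
  rw [dotProduct_comm, sub_dotProduct]
  linarith

end Independence

/-! ### The finite list of resonances and its consequences. -/

section Resonances

/-- A non-zero polynomial that vanishes whenever `Q` holds, if there is one. -/
def vanisher {σ : Type*} (Q : (σ → ℤ) → Prop) : MvPolynomial σ ℤ :=
  open Classical in
  if h : ∃ E : MvPolynomial σ ℤ, E ≠ 0 ∧ ∀ x, Q x → MvPolynomial.eval x E = 0 then h.choose else 1

theorem vanisher_ne_zero {σ : Type*} (Q : (σ → ℤ) → Prop) : vanisher Q ≠ 0 := by
  unfold vanisher
  split_ifs with h
  · exact h.choose_spec.1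
  · exact one_ne_zero

theorem eq_zero_of_eval_vanisher_ne_zero {σ : Type*} {Q : (σ → ℤ) → Prop} {x : σ → ℤ} (hx : Q x)
    (h : MvPolynomial.eval x (vanisher Q) ≠ 0) {E : MvPolynomial σ ℤ}
    (hE : ∀ x, Q x → MvPolynomial.eval x E = 0) : E = 0 := by
  by_contra hne
  have hex : ∃ E : MvPolynomial σ ℤ, E ≠ 0 ∧ ∀ x, Q x → MvPolynomial.eval x E = 0 := ⟨E, hne, hE⟩
  apply h
  rw [vanisher, dif_pos hex]
  exact hex.choose_spec.2 x hx

/-- The conditions on sites `v` and labels `d` that generic sites only satisfy if they hold on a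
dense set: the labels are realised by some root, or they are labels of closed paths with an even
or with an odd number of red edges. -/
def Condition {κ τ : Type*} [Fintype κ] {n : ℕ} (c : Fin 3) (d : τ → κ → ℤ)
    (v : κ → Fin n → ℤ) : Prop :=
  if c = 0 then ∃ r : Fin n → ℤ, (∀ k, r ≠ v k) ∧ ∀ t, Realizes v r (d t)
  else if c = 1 then ∀ t, comb v (d t) = 0
  else ∀ t, comb v (d t) ⬝ᵥ comb v (d t) + 2 * pairing (fun k => v k ⬝ᵥ v k) (d t) = 0

/-- A label with coefficients in `[-8, 8]`. -/
def decodeLabel {κ : Type*} (x : κ → Fin 17) : κ → ℤ := fun k => ((x k : ℕ) : ℤ) - 8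

/-- The resonance in `k` vectors of a family of labels and one of the conditions. -/
def resonance (n k N : ℕ) (q : (Fin N → Fin k → Fin 17) × Fin 3) :
    MvPolynomial (Fin k × Fin n) ℤ :=
  vanisher fun x => Condition q.2 (fun t => decodeLabel (q.1 t)) fun k j => x (k, j)

/-- The resonances. -/
def resonances (n : ℕ) : Finset (Σ k : ℕ, MvPolynomial (Fin k × Fin n) ℤ) :=
  open Classical in
  -- A cluster of at most five labels involves at most 2 · 5 - 2 = 8 sites with entries at most 4 in
  -- absolute value, so differences of labels are at most 8. These bounds determine the list.
  (Finset.range 9).biUnion fun k => (Finset.range 6).biUnion fun N =>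
    Finset.univ.image fun q => ⟨k, resonance n k N q⟩

theorem mem_resonances (n : ℕ) (p : Σ k : ℕ, MvPolynomial (Fin k × Fin n) ℤ) :
    p ∈ resonances n ↔ ∃ k < 9, ∃ N < 6, ∃ q, ⟨k, resonance n k N q⟩ = p := by
  classical
  simp [resonances]

attribute [irreducible] resonances

theorem ne_zero_of_mem_resonances {n : ℕ} {p : Σ k : ℕ, MvPolynomial (Fin k × Fin n) ℤ}
    (hp : p ∈ resonances n) : p.2 ≠ 0 := by
  obtain ⟨k, -, N, -, q, rfl⟩ := (mem_resonances n p).1 hp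
  exact vanisher_ne_zero _

variable {n m N : ℕ} {v : Fin m → Fin n → ℤ}

theorem IsGeneric.eval_resonance_ne_zero (hv : IsGeneric (resonances n) v) {k : ℕ} (hk : k < 9)
    (hN : N < 6) (q : (Fin N → Fin k → Fin 17) × Fin 3) (f : Fin k ↪ Fin m) :
    MvPolynomial.eval (fun p => v (f p.1) p.2) (resonance n k N q) ≠ 0 :=
  hv ⟨k, resonance n k N q⟩ ((mem_resonances n _).2 ⟨k, hk, N, hN, q, rfl⟩) f

/-- The embedding enumerates T. As the resonance of the restricted labels does not vanish at v
although the condition holds there, no non-zero polynomial vanishes wherever the condition holds. -/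
theorem IsGeneric.eq_zero (hv : IsGeneric (resonances n) v) (hN : N ≤ 5) {d : Fin N → Fin m → ℤ}
    {T : Finset (Fin m)} (hT : T.card ≤ 8) (hdT : ∀ t, ∀ i ∉ T, d t i = 0)
    (hd8 : ∀ t i, |d t i| ≤ 8) :
    ∃ (k : ℕ) (f : Fin k ↪ Fin m), (∀ t, ∀ i ∉ Set.range f, d t i = 0) ∧
      ∀ c : Fin 3, Condition c (fun t i => d t (f i)) (fun i => v (f i)) →
        ∀ E : MvPolynomial (Fin k × Fin n) ℤ, (∀ w : Fin k → Fin n → ℤ,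
          Condition c (fun t i => d t (f i)) w → MvPolynomial.eval (fun q => w q.1 q.2) E = 0) →
            E = 0 := by
  classical
  refine ⟨T.card, (T.orderEmbOfFin rfl).toEmbedding, fun t i hi => hdT t i fun h => hi ?_, ?_⟩
  · have := T.range_orderEmbOfFin rfl
    change i ∈ Set.range (T.orderEmbOfFin rfl)
    rw [this]
    exact h
  intro c hc E hE
  obtain ⟨f, hf⟩ : ∃ f : Fin T.card ↪ Fin m, f = (T.orderEmbOfFin rfl).toEmbedding := ⟨_, rfl⟩
  rw [← hf] at hc hE
  obtain ⟨x, hx⟩ : ∃ x : Fin N → Fin T.card → Fin 17, ∀ t, decodeLabel (x t) =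
      fun i => d t (f i) := by
    refine ⟨fun t i => ⟨(d t (f i) + 8).toNat, ?_⟩, fun t => funext fun i => ?_⟩
    · have := abs_le.1 (hd8 t (f i))
      omega
    · have := abs_le.1 (hd8 t (f i))
      simp only [decodeLabel]
      omega
  have hfun : (fun t => decodeLabel (x t)) = fun t i => d t (f i) := funext hx
  have hgen := hv.eval_resonance_ne_zero (k := T.card) (by omega) (by omega) (x, c) f
  rw [resonance] at hgen
  rw [← hfun] at hc hE
  refine eq_zero_of_eval_vanisher_ne_zero ?_ hgen ?_
  · exact hc
  · intro y hy
    exact hE (fun k j => y (k, j)) hy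

theorem sum_comp_embedding {κ κ' Λ : Type*} [Fintype κ] [Fintype κ'] [AddCommMonoid Λ]
    (f : κ ↪ κ') {g : κ' → Λ} (h : ∀ i ∉ Set.range f, g i = 0) : ∑ i, g (f i) = ∑ i, g i :=
  Fintype.sum_of_injective f f.injective _ _ h fun _ => rfl

theorem pairing_comp_embedding {κ κ' Λ : Type*} [Fintype κ] [Fintype κ'] [CommRing Λ]
    (f : κ ↪ κ') (φ : κ' → Λ) {d : κ' → ℤ} (h : ∀ i ∉ Set.range f, d i = 0) :
    pairing (fun i => φ (f i)) (fun i => d (f i)) = pairing φ d :=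
  sum_comp_embedding f (g := fun i => (d i : Λ) * φ i) fun i hi => by simp [h i hi]

theorem comb_comp_embedding {κ κ' : Type*} [Fintype κ] [Fintype κ'] (f : κ ↪ κ')
    (v : κ' → Fin n → ℤ) {d : κ' → ℤ} (h : ∀ i ∉ Set.range f, d i = 0) :
    comb (fun i => v (f i)) (fun i => d (f i)) = comb v d :=
  funext fun j => pairing_comp_embedding f (fun k => v k j) h

theorem Realizes.comp_embedding {κ κ' : Type*} [Fintype κ] [Fintype κ'] (f : κ ↪ κ')
    {v : κ' → Fin n → ℤ} {r : Fin n → ℤ} {d : κ' → ℤ} (h : Realizes v r d)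
    (hd : ∀ i ∉ Set.range f, d i = 0) : Realizes (fun i => v (f i)) r fun i => d (f i) where
  sum_eq := by rw [sum_comp_embedding f hd]; exact h.sum_eq
  norm_eq := by
    rw [comb_comp_embedding f v hd, sum_comp_embedding f hd, h.norm_eq,
      ← pairing_comp_embedding f _ hd]
  site := by
    intro k
    rw [position, comb_comp_embedding f v hd, sum_comp_embedding f hd]
    exact h.site (f k)

theorem IsGeneric.dense (hv : IsGeneric (resonances n) v) (hN : N ≤ 5) {d : Fin N → Fin m → ℤ}
    {T : Finset (Fin m)} (hT : T.card ≤ 8) (hdT : ∀ t, ∀ i ∉ T, d t i = 0)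
    (hd8 : ∀ t i, |d t i| ≤ 8) {r : Fin n → ℤ} (hr : ∀ k, r ≠ v k) (h : ∀ t, Realizes v r (d t)) :
    ∃ (k : ℕ) (f : Fin k ↪ Fin m), (∀ t, ∀ i ∉ Set.range f, d t i = 0) ∧
      Dense n fun t i => d t (f i) := by
  obtain ⟨k, f, hf, hE⟩ := hv.eq_zero hN hT hdT hd8
  refine ⟨k, f, hf, fun E h0 => hE 0 ?_ E ?_⟩
  · exact ⟨r, fun i => hr (f i), fun t => (h t).comp_embedding f (hf t)⟩
  · rintro w ⟨r', hr', h'⟩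
    exact h0 w r' hr' h'

theorem IsGeneric.sum_mul_eq_zero [NeZero n] (hv : IsGeneric (resonances n) v) (hN : N ≤ 5)
    {d : Fin N → Fin m → ℤ} {T : Finset (Fin m)} (hT : T.card ≤ 8)
    (hdT : ∀ t, ∀ i ∉ T, d t i = 0) (hd8 : ∀ t i, |d t i| ≤ 8) {r : Fin n → ℤ}
    (hr : ∀ k, r ≠ v k) (h : ∀ t, Realizes v r (d t)) (c : Fin N → ℤ)
    (hc : ∑ t, c t • d t = 0) {i j : Fin m} (hij : i ≠ j) :
    ∑ t, c t * (d t i * d t j) = 0 := by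
  obtain ⟨k, f, hf, hD⟩ := hv.dense hN hT hdT hd8 hr h
  by_cases hi : i ∈ Set.range f
  · by_cases hj : j ∈ Set.range f
    · obtain ⟨i, rfl⟩ := hi
      obtain ⟨j, rfl⟩ := hj
      refine hD.sum_mul_eq_zero c (fun k => ?_) fun h => hij (by rw [h])
      simpa using congrFun hc (f k)
    · exact Finset.sum_eq_zero fun t _ => by rw [hf t j hj]; ring
  · exact Finset.sum_eq_zero fun t _ => by rw [hf t i hi]; ring

theorem IsGeneric.not_linearIndependent (hv : IsGeneric (resonances n) v) (hn : 2 ≤ n)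
    (hn' : n ≤ 4) {d : Fin (n + 1) → Fin m → ℤ} {T : Finset (Fin m)} (hT : T.card ≤ 8)
    (hdT : ∀ t, ∀ i ∉ T, d t i = 0) (hd8 : ∀ t i, |d t i| ≤ 8) {r : Fin n → ℤ}
    (hr : ∀ k, r ≠ v k) (h : ∀ t, Realizes v r (d t)) {t₀ t₁ : Fin (n + 1)} (ht : t₀ ≠ t₁)
    (h₀ : ∑ k, d t₀ k = 0) (h₁ : ∑ k, d t₁ k = 0) : ¬ LinearIndependent ℤ d := by
  intro hLI
  obtain ⟨k, f, hf, hD⟩ := hv.dense (N := n + 1) (by omega) hT hdT hd8 hr h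
  have hsum : ∀ t, ∑ i, d t (f i) = ∑ i, d t i := fun t => sum_comp_embedding f (hf t)
  refine hD.not_linearIndependent hn (fun t => ?_) ht ?_ ?_ ?_
  · rw [hsum]
    exact (h t).sum_eq
  · rw [hsum, h₀]
  · rw [hsum, h₁]
  · rw [Fintype.linearIndependent_iff] at hLI ⊢
    intro c hc
    apply hLI c
    funext i
    by_cases hi : i ∈ Set.range f
    · obtain ⟨i, rfl⟩ := hi
      simpa using congrFun hc i
    · simp [hf _ i hi]

/-- This is the case of closed paths with an even number of red edges: a linear relation between
generic sites holds identically, so its coefficients are zero. -/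
theorem IsGeneric.eq_zero_of_comb_eq_zero [NeZero n] (hv : IsGeneric (resonances n) v)
    {d : Fin m → ℤ} {T : Finset (Fin m)} (hT : T.card ≤ 8) (hdT : ∀ i ∉ T, d i = 0)
    (hd8 : ∀ i, |d i| ≤ 8) (h : comb v d = 0) : d = 0 := by
  obtain ⟨k, f, hf, hE⟩ := hv.eq_zero (N := 1) (by norm_num) (d := fun _ => d) hT
    (fun _ => hdT) fun _ => hd8
  have hf := hf 0
  have h0 := hE 1 (by
    intro t
    rw [comb_comp_embedding f v hf, h]) (pairing (fun i => genericSites n (Fin k) i 0)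
      fun i => d (f i)) (by
    intro w hw
    rw [map_pairing]
    have := congrFun (hw 0) 0
    simpa [genericSites, comb] using this)
  funext i
  by_cases hi : i ∈ Set.range f
  · obtain ⟨i, rfl⟩ := hi
    have h1 := congrArg (MvPolynomial.eval fun q : Fin k × Fin n => if q.1 = i then (1 : ℤ) else 0) h0
    rw [map_pairing] at h1
    simpa [genericSites, pairing] using h1
  · exact hf i hi

/-- The relation holds identically, and in one coordinate it is (φ,d)² + 2∑ d_k φ_k² = 0. Its
coefficients give d_i(d_i + 2) = 0 and d_i d_j = 0 for i ≠ j. -/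
theorem IsGeneric.eq_zero_or_of_odd_closed_path [NeZero n] (hv : IsGeneric (resonances n) v)
    {d : Fin m → ℤ} {T : Finset (Fin m)} (hT : T.card ≤ 8) (hdT : ∀ i ∉ T, d i = 0)
    (hd8 : ∀ i, |d i| ≤ 8)
    (h : comb v d ⬝ᵥ comb v d + 2 * pairing (fun k => v k ⬝ᵥ v k) d = 0) :
    d = 0 ∨ ∃ i, d = Pi.single i (-2) := by
  obtain ⟨k, f, hf, hE⟩ := hv.eq_zero (N := 1) (by norm_num) (d := fun _ => d) hT
    (fun _ => hdT) fun _ => hd8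
  have hf := hf 0
  have h0 := hE 2 (by
    intro t
    rw [comb_comp_embedding f v hf, pairing_comp_embedding f (fun k => v k ⬝ᵥ v k) hf, h])
      (comb (genericSites n (Fin k)) (fun i => d (f i)) ⬝ᵥ
        comb (genericSites n (Fin k)) (fun i => d (f i)) +
        2 * pairing (fun i => genericSites n (Fin k) i ⬝ᵥ genericSites n (Fin k) i)
          fun i => d (f i)) (by
    intro w hw
    have := hw 0
    simpa [genericSites, dotProduct, map_comb, map_pairing] using this)
  have h1 : ∀ φ : Fin k → ℤ, pairing φ (fun i => d (f i)) ^ 2 +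
      2 * pairing (fun i => φ i ^ 2) (fun i => d (f i)) = 0 := by
    intro φ
    have h1 := congrArg (MvPolynomial.eval fun q : Fin k × Fin n =>
      if q.2 = 0 then φ q.1 else 0) h0
    simp only [genericSites, dotProduct, map_comb, map_pairing, map_add, map_mul, map_ofNat,
      map_sum, MvPolynomial.eval_X, map_zero] at h1
    rw [← h1]
    congr 2
    · rw [sq, Finset.sum_eq_single 0]
      · simp [comb]
      · intro j _ hj
        simp [comb, hj, pairing]
      · simp
    · congr 1
      funext i
      simp [sq]
  have h2 : ∀ i, d (f i) * (d (f i) + 2) = 0 := by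
    intro i
    have := h1 (Pi.single i 1)
    simp only [pairing, Pi.single_apply] at this
    simp at this
    linear_combination this
  have h3 : ∀ i j, i ≠ j → d (f i) * d (f j) = 0 := by
    intro i j hij
    have h4 := h1 (Pi.single i 1 + Pi.single j 1)
    have h5 : (fun l => (Pi.single i 1 + Pi.single j 1 : Fin k → ℤ) l ^ 2) =
        Pi.single i 1 + Pi.single j 1 := by
      funext l
      by_cases hi : l = i
      · subst hi; simp [hij]
      · by_cases hj : l = j
        · subst hj; simp [hi]
        · simp [hi, hj]
    have h6 : pairing (Pi.single i 1 + Pi.single j 1) (fun i => d (f i)) = d (f i) + d (f j) := by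
      simp [pairing, mul_add, Finset.sum_add_distrib, Pi.single_apply]
    rw [h5, h6] at h4
    have := h2 i
    have := h2 j
    nlinarith
  by_cases hall : ∀ i, d (f i) = 0
  · left
    funext i
    by_cases hi : i ∈ Set.range f
    · obtain ⟨i, rfl⟩ := hi
      exact hall i
    · exact hf i hi
  · right
    push Not at hall
    obtain ⟨i, hi⟩ := hall
    refine ⟨f i, ?_⟩
    funext l
    by_cases hl : l ∈ Set.range f
    · obtain ⟨l, rfl⟩ := hl
      by_cases hli : l = i
      · subst hli
        have := (mul_eq_zero.1 (h2 l)).resolve_left hi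
        simp
        omega
      · rw [Pi.single_eq_of_ne fun h => hli (f.injective h)]
        exact (mul_eq_zero.1 (h3 l i hli)).resolve_right hi
    · rw [hf l hl, Pi.single_eq_of_ne]
      rintro rfl
      exact hl ⟨i, rfl⟩

end Resonances

/-! ### Affine independence from parity. -/

section Parity

theorem zmod_two_eq_one {x : ZMod 2} (h : x ≠ 0) : x = 1 := by
  revert x
  decide

theorem intCast_zmod_two_eq_zero_iff (x : ℤ) : (x : ZMod 2) = 0 ↔ 2 ∣ x :=
  ZMod.intCast_zmod_eq_zero_iff_dvd x 2

/-- At most three distinct non-zero even vectors over the field with two elements have linearly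
independent off-diagonal squares. -/
theorem eq_zero_of_sum_mul_mul_eq_zero {σ κ : Type*} [Fintype κ] {T : Finset σ} (hT : T.card ≤ 3)
    {y : σ → κ → ZMod 2} {c : σ → ZMod 2} (heven : ∀ g ∈ T, ∑ k, y g k = 0)
    (hne : ∀ g ∈ T, y g ≠ 0) (hinj : ∀ g ∈ T, ∀ h ∈ T, g ≠ h → y g ≠ y h)
    (hsum : ∀ k l, k ≠ l → ∑ g ∈ T, c g * (y g k * y g l) = 0) : ∀ g ∈ T, c g = 0 := by
  classical
  intro g hg
  by_contra hcg
  obtain ⟨k, hk⟩ := Function.ne_iff.1 (hne g hg)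
  -- Fixing one index k turns the quadratic relations into linear ones: the vectors of U sum to zero
  -- outside k.
  obtain ⟨U, hU⟩ : ∃ U, U = T.filter fun g => c g * y g k ≠ 0 := ⟨_, rfl⟩
  have hgU : g ∈ U := by
    rw [hU, Finset.mem_filter]
    exact ⟨hg, mul_ne_zero hcg hk⟩
  have h1 : ∀ l, l ≠ k → ∑ g ∈ U, y g l = 0 := by
    intro l hl
    rw [← hsum k l hl.symm, hU, Finset.sum_filter]
    refine Finset.sum_congr rfl fun g _ => ?_
    split_ifs with h
    · rw [← mul_assoc, zmod_two_eq_one h, one_mul]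
    · rw [not_not] at h
      rw [← mul_assoc, h, zero_mul]
  have hyk : ∀ g ∈ U, y g k = 1 := by
    intro g hg
    rw [hU, Finset.mem_filter] at hg
    exact zmod_two_eq_one (right_ne_zero_of_mul hg.2)
  have hUT : U ⊆ T := by rw [hU]; exact Finset.filter_subset _ _
  -- Each vector of U has entry 1 at k and an even sum, so its entries outside k sum to 1. Hence U
  -- has an even number of elements, which must be two, and these two vectors coincide.
  have h2 : (U.card : ZMod 2) = 0 := by
    have h3 : ∑ g ∈ U, ∑ l ∈ Finset.univ.erase k, y g l = 0 := by
      rw [Finset.sum_comm]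
      exact Finset.sum_eq_zero fun l hl => h1 l (Finset.ne_of_mem_erase hl)
    have h4 : ∀ g ∈ U, ∑ l ∈ Finset.univ.erase k, y g l = -1 := by
      intro g hg
      have h5 := Finset.add_sum_erase Finset.univ (y g) (Finset.mem_univ k)
      rw [heven g (hUT hg), hyk g hg] at h5
      linear_combination h5
    rw [Finset.sum_congr rfl h4] at h3
    simpa using h3
  have h3 : U.card = 2 := by
    have h4 : U.card ≤ 3 := (Finset.card_le_card hUT).trans hT
    have h5 : 0 < U.card := Finset.card_pos.2 ⟨g, hgU⟩
    have h6 : 2 ∣ U.card := (ZMod.natCast_eq_zero_iff _ _).1 h2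
    omega
  obtain ⟨s, t, hst, hU2⟩ := Finset.card_eq_two.1 h3
  have hs : s ∈ U := by rw [hU2]; simp
  have ht : t ∈ U := by rw [hU2]; simp
  apply hinj s (hUT hs) t (hUT ht) hst
  funext l
  by_cases hl : l = k
  · rw [hl, hyk s hs, hyk t ht]
  · have h4 := h1 l hl
    rw [hU2, Finset.sum_pair hst] at h4
    rw [← sub_eq_zero, sub_eq_add_neg, ZMod.neg_eq_self_mod_two]
    exact h4

/-- Second moments do not depend on the origin when the weights and the first moments sum to zero.
-/
theorem sum_mul_sub_mul_sub {σ κ Λ : Type*} [CommRing Λ] (T : Finset σ) (c : σ → Λ)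
    (x : σ → κ → Λ) (hc : ∑ g ∈ T, c g = 0) (hx : ∀ k, ∑ g ∈ T, c g * x g k = 0) (y : κ → Λ)
    (k l : κ) : ∑ g ∈ T, c g * ((x g k - y k) * (x g l - y l)) =
      ∑ g ∈ T, c g * (x g k * x g l) := by
  have h1 : ∀ g ∈ T, c g * ((x g k - y k) * (x g l - y l)) = c g * (x g k * x g l) -
      y l * (c g * x g k) - y k * (c g * x g l) + y k * y l * c g := fun g _ => by ring
  rw [Finset.sum_congr rfl h1, Finset.sum_add_distrib, Finset.sum_sub_distrib,
    Finset.sum_sub_distrib, ← Finset.mul_sum, ← Finset.mul_sum, ← Finset.mul_sum, hc, hx, hx]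
  ring

/-- Congruence of labels modulo two. -/
def Congruent {κ : Type*} (a b : κ → ℤ) : Prop := ∀ k, 2 ∣ a k - b k

theorem Congruent.symm {κ : Type*} {a b : κ → ℤ} (h : Congruent a b) : Congruent b a :=
  fun k => by have := h k; omega

theorem Congruent.trans {κ : Type*} {a b c : κ → ℤ} (h : Congruent a b) (h' : Congruent b c) :
    Congruent a c := fun k => by have := h k; have := h' k; omega

theorem congruent_iff_cast_eq {κ : Type*} {a b : κ → ℤ} :
    Congruent a b ↔ (fun k => (a k : ZMod 2)) = fun k => (b k : ZMod 2) := by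
  rw [funext_iff]
  refine forall_congr' fun k => ?_
  rw [← sub_eq_zero, ← Int.cast_sub, intCast_zmod_two_eq_zero_iff]

variable {κ : Type*} [Fintype κ]

/-- Five labels, four of which are pairwise incongruent modulo two, whose affine relations are
relations between the off-diagonal parts of their squares as well, are affinely independent. -/
theorem two_dvd_of_affine_relation {x : Fin 5 → κ → ℤ} (hx : Function.Injective x)
    (heven : ∀ t, 2 ∣ ∑ k, x t k) {q : Fin 5}
    (hq : ∀ s t, s ≠ q → t ≠ q → s ≠ t → ¬ Congruent (x s) (x t)) {c : Fin 5 → ℤ}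
    (hc : ∑ t, c t = 0) (hcx : ∀ k, ∑ t, c t * x t k = 0)
    (hcxx : ∀ k l, k ≠ l → ∑ t, c t * (x t k * x t l) = 0) (t : Fin 5) : 2 ∣ c t := by
  classical
  obtain ⟨C, hC⟩ : ∃ C : Fin 5 → ZMod 2, ∀ t, C t = (c t : ZMod 2) := ⟨_, fun _ => rfl⟩
  obtain ⟨Y, hY⟩ : ∃ Y : Fin 5 → κ → ZMod 2, ∀ t, Y t = fun k => (x t k : ZMod 2) :=
    ⟨_, fun _ => rfl⟩
  have hYeven : ∀ t, ∑ k, Y t k = 0 := by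
    intro t
    rw [hY, ← Int.cast_sum, intCast_zmod_two_eq_zero_iff]
    exact heven t
  have hYq : ∀ s t, s ≠ q → t ≠ q → s ≠ t → Y s ≠ Y t := by
    intro s t hs ht hst h
    rw [hY, hY, ← congruent_iff_cast_eq] at h
    exact hq s t hs ht hst h
  have hCs : ∑ t, C t = 0 := by
    simp only [hC, ← Int.cast_sum, hc, Int.cast_zero]
  have hCY : ∀ k, ∑ t, C t * Y t k = 0 := by
    intro k
    simp only [hC, hY, ← Int.cast_mul, ← Int.cast_sum, hcx, Int.cast_zero]
  have hCYY : ∀ k l, k ≠ l → ∑ t, C t * (Y t k * Y t l) = 0 := by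
    intro k l hkl
    simp only [hC, hY, ← Int.cast_mul, ← Int.cast_sum, hcxx k l hkl, Int.cast_zero]
  rw [← intCast_zmod_two_eq_zero_iff, ← hC]
  by_contra hCt
  -- The delicate case is an exceptional label congruent to another one with both coefficients odd.
  -- The two cancel modulo 2, and a descent through higher powers of 2 is needed.
  by_cases hpair : ∃ a, a ≠ q ∧ C a ≠ 0 ∧ C q ≠ 0 ∧ Y a = Y q
  · obtain ⟨a, haq, hCa, hCq, hYa⟩ := hpair
    obtain ⟨G, hG⟩ : ∃ G, G = (Finset.univ.erase a).erase q := ⟨_, rfl⟩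
    have hqa : q ∈ Finset.univ.erase a := Finset.mem_erase.2 ⟨haq.symm, Finset.mem_univ _⟩
    have hGcard : G.card = 3 := by
      rw [hG, Finset.card_erase_of_mem hqa, Finset.card_erase_of_mem (Finset.mem_univ _)]
      simp
    have hGmem : ∀ g ∈ G, g ≠ a ∧ g ≠ q := by
      intro g hg
      rw [hG, Finset.mem_erase, Finset.mem_erase] at hg
      exact ⟨hg.2.1, hg.1⟩
    have hsplit : ∀ {Λ : Type} [CommRing Λ] (f : Fin 5 → Λ), ∑ t, f t = f a + f q + ∑ g ∈ G, f g := by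
      intro Λ _ f
      rw [hG, add_assoc, Finset.add_sum_erase _ _ hqa, Finset.add_sum_erase _ _ (Finset.mem_univ _)]
    have htwo : ∀ z : ZMod 2, z + z = 0 := by decide
    have hCG : ∀ g ∈ G, C g = 0 := by
      by_contra! hcon
      obtain ⟨g₀, hg₀, hCg₀⟩ := hcon
      have h1 := eq_zero_of_sum_mul_mul_eq_zero (T := G.erase g₀)
        (y := fun g k => Y g k - Y g₀ k) (c := C)
        ((Finset.card_le_card (Finset.erase_subset _ _)).trans hGcard.le)
        (fun g _ => by
          rw [Finset.sum_sub_distrib, hYeven, hYeven, sub_zero])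
        (fun g hg h => by
          have hg' := Finset.mem_erase.1 hg
          refine hYq g g₀ (hGmem g hg'.2).2 (hGmem g₀ hg₀).2 hg'.1 (funext fun k => ?_)
          exact sub_eq_zero.1 (congrFun h k))
        (fun g hg h hh hgh heq => by
          have hg' := Finset.mem_erase.1 hg
          have hh' := Finset.mem_erase.1 hh
          refine hYq g h (hGmem g hg'.2).2 (hGmem h hh'.2).2 hgh (funext fun k => ?_)
          exact sub_left_inj.1 (congrFun heq k))
        (fun k l hkl => by
          have h2 := sum_mul_sub_mul_sub Finset.univ C Y hCs hCY (Y g₀) k l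
          rw [hCYY k l hkl, hsplit, ← Finset.add_sum_erase G _ hg₀, hYa, zmod_two_eq_one hCa,
            zmod_two_eq_one hCq, htwo, zero_add, sub_self, zero_mul, mul_zero, zero_add] at h2
          exact h2)
      have h2 := hsplit C
      rw [hCs, zmod_two_eq_one hCa, zmod_two_eq_one hCq, htwo, zero_add,
        ← Finset.add_sum_erase G _ hg₀, Finset.sum_eq_zero h1, add_zero] at h2
      exact hCg₀ h2.symm
    have hqodd : ¬ 2 ∣ c q := by
      rw [hC, Ne, intCast_zmod_two_eq_zero_iff] at hCq
      exact hCq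
    -- the congruence improves indefinitely
    have key : ∀ e : ℕ, (∀ k, (2 : ℤ) ^ (e + 1) ∣ x q k - x a k) ∧
        ∀ g ∈ G, (2 : ℤ) ^ (e + 1) ∣ c g := by
      intro e
      induction e with
      | zero =>
        refine ⟨fun k => ?_, fun g hg => ?_⟩
        · rw [hY, hY, ← congruent_iff_cast_eq] at hYa
          have := hYa.symm k
          simpa using this
        · have := hCG g hg
          rw [hC, intCast_zmod_two_eq_zero_iff] at this
          simpa using this
      | succ e ih =>
        obtain ⟨ih1, ih2⟩ := ih
        choose w hw using ih1
        have ih2' : ∃ c' : Fin 5 → ℤ, ∀ g ∈ G, c g = 2 ^ (e + 1) * c' g := by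
          choose! c' hc' using ih2
          exact ⟨c', hc'⟩
        obtain ⟨c', hc'⟩ := ih2'
        have hpow : (2 : ℤ) ^ (e + 1) ≠ 0 := pow_ne_zero _ two_ne_zero
        -- With origin x_a and after division by 2^(e+1), the contribution of q still carries the
        -- factor 2^(e+1), since x_q - x_a enters twice. The reduction modulo 2 therefore involves
        -- only the three labels of G, whose coefficients must be even; the linear relation then
        -- improves the congruence, as c_q is odd.
        have hquad : ∀ k l, k ≠ l → ∑ g ∈ G, c' g * ((x g k - x a k) * (x g l - x a l)) =
            -(c q * 2 ^ (e + 1) * (w k * w l)) := by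
          intro k l hkl
          have h2 := sum_mul_sub_mul_sub Finset.univ c x hc hcx (x a) k l
          rw [hcxx k l hkl, hsplit, sub_self, zero_mul, mul_zero, zero_add, hw, hw] at h2
          have h3 : ∑ g ∈ G, c g * ((x g k - x a k) * (x g l - x a l)) =
              2 ^ (e + 1) * ∑ g ∈ G, c' g * ((x g k - x a k) * (x g l - x a l)) := by
            rw [Finset.mul_sum]
            exact Finset.sum_congr rfl fun g hg => by rw [hc' g hg]; ring
          rw [h3] at h2
          apply mul_left_cancel₀ hpow
          linear_combination h2
        have hlin : ∀ k, c q * w k = -∑ g ∈ G, c' g * (x g k - x a k) := by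
          intro k
          have h2 : ∑ t, c t * (x t k - x a k) = 0 := by
            simp only [mul_sub, Finset.sum_sub_distrib, ← Finset.sum_mul, hcx, hc, zero_mul,
              sub_zero]
          rw [hsplit, sub_self, mul_zero, zero_add, hw] at h2
          have h3 : ∑ g ∈ G, c g * (x g k - x a k) =
              2 ^ (e + 1) * ∑ g ∈ G, c' g * (x g k - x a k) := by
            rw [Finset.mul_sum]
            exact Finset.sum_congr rfl fun g hg => by rw [hc' g hg]; ring
          rw [h3] at h2
          apply mul_left_cancel₀ hpow
          linear_combination h2
        have hc'even : ∀ g ∈ G, 2 ∣ c' g := by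
          intro g hg
          have h1 := eq_zero_of_sum_mul_mul_eq_zero (T := G)
            (y := fun g k => Y g k - Y a k) (c := fun g => (c' g : ZMod 2)) hGcard.le
            (fun g _ => by
              rw [Finset.sum_sub_distrib, hYeven, hYeven, sub_zero])
            (fun g hg h => hYq g a (hGmem g hg).2 haq (hGmem g hg).1 (funext fun k =>
              sub_eq_zero.1 (congrFun h k)))
            (fun g hg h hh hgh heq => hYq g h (hGmem g hg).2 (hGmem h hh).2 hgh (funext fun k =>
              sub_left_inj.1 (congrFun heq k)))
            (fun k l hkl => by
              have h2 := congrArg (Int.cast : ℤ → ZMod 2) (hquad k l hkl)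
              simp only [Int.cast_sum, Int.cast_mul, Int.cast_sub, Int.cast_neg, Int.cast_pow,
                Int.cast_ofNat] at h2
              simp only [hY]
              rw [h2, show (2 : ZMod 2) = 0 from rfl]
              simp) g hg
          rw [intCast_zmod_two_eq_zero_iff] at h1
          exact h1
        refine ⟨fun k => ?_, fun g hg => ?_⟩
        · rw [hw, pow_succ _ (e + 1)]
          apply mul_dvd_mul_left
          have h1 : 2 ∣ c q * w k := by
            rw [hlin]
            exact (Finset.dvd_sum fun g hg => (hc'even g hg).mul_right _).neg_right
          exact (Int.prime_two.dvd_or_dvd h1).resolve_left hqodd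
        · rw [hc' g hg, pow_succ _ (e + 1)]
          exact mul_dvd_mul_left _ (hc'even g hg)
    apply haq
    apply hx
    funext k
    -- An integer z that is divisible by 2^(|z|+1) is zero.
    have h1 : x q k - x a k = 0 := by
      apply Int.eq_zero_of_abs_lt_dvd ((key (x q k - x a k).natAbs).1 k)
      rw [Int.abs_eq_natAbs]
      exact_mod_cast Nat.lt_two_pow_self.trans (Nat.pow_lt_pow_right one_lt_two (Nat.lt_succ_self _))
    omega
  · push Not at hpair
    obtain ⟨S, hS⟩ : ∃ S, S = Finset.univ.filter fun t => C t ≠ 0 := ⟨_, rfl⟩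
    have hSmem : ∀ s, s ∈ S ↔ C s ≠ 0 := by simp [hS]
    have hSinj : ∀ s ∈ S, ∀ t ∈ S, s ≠ t → Y s ≠ Y t := by
      intro s hs t ht hst h
      rw [hSmem] at hs ht
      by_cases hsq : s = q
      · subst hsq
        exact hpair t hst.symm ht hs h.symm
      · by_cases htq : t = q
        · subst htq
          exact hpair s hst hs ht h
        · exact hYq s t hsq htq hst h
    have hsumS : ∀ f : Fin 5 → ZMod 2, ∑ t, C t * f t = ∑ t ∈ S, C t * f t := by
      intro f
      rw [hS, Finset.sum_filter]
      refine Finset.sum_congr rfl fun s _ => ?_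
      split_ifs with h
      · rfl
      · rw [not_not] at h
        rw [h, zero_mul]
    have hScard : (S.card : ZMod 2) = 0 := by
      have h1 := hsumS fun _ => 1
      simp only [mul_one, hCs] at h1
      rw [Finset.sum_congr rfl fun s hs => zmod_two_eq_one ((hSmem s).1 hs)] at h1
      simpa using h1.symm
    have htS : t ∈ S := (hSmem t).2 hCt
    -- The labels with odd coefficient are now pairwise incongruent and even in number, at most
    -- four. With one as origin, at most three remain.
    have hcard : (S.erase t).card ≤ 3 := by
      rw [Finset.card_erase_of_mem htS]
      have h1 : S.card ≤ 5 := by simpa using Finset.card_le_univ S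
      have h2 : 2 ∣ S.card := (ZMod.natCast_eq_zero_iff _ _).1 hScard
      omega
    have h1 := eq_zero_of_sum_mul_mul_eq_zero (T := S.erase t)
      (y := fun g k => Y g k - Y t k) (c := C) hcard
      (fun g _ => by
        rw [Finset.sum_sub_distrib, hYeven, hYeven, sub_zero])
      (fun g hg h => by
        have hg' := Finset.mem_erase.1 hg
        refine hSinj g hg'.2 t htS hg'.1 (funext fun k => ?_)
        exact sub_eq_zero.1 (congrFun h k))
      (fun g hg h hh hgh heq => by
        refine hSinj g (Finset.mem_erase.1 hg).2 h (Finset.mem_erase.1 hh).2 hgh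
          (funext fun k => ?_)
        exact sub_left_inj.1 (congrFun heq k))
      (fun k l hkl => by
        have h2 := sum_mul_sub_mul_sub Finset.univ C Y hCs hCY (Y t) k l
        rw [hCYY k l hkl, hsumS, ← Finset.add_sum_erase S _ htS, sub_self, zero_mul, mul_zero,
          zero_add] at h2
        exact h2)
    have h2 := hsumS fun _ => 1
    simp only [mul_one, hCs] at h2
    rw [← Finset.add_sum_erase S _ htS, Finset.sum_eq_zero h1, add_zero] at h2
    exact hCt h2.symm

end Parity

/-! ### Connected sets of labels, and congruent pairs among five labels. -/

section Clusters

variable {n m : ℕ} {v : Fin m → Fin n → ℤ} {r : Fin n → ℤ}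

/-- A finite set of realised labels containing `0` that is connected by the marked edges. -/
inductive Cluster (v : Fin m → Fin n → ℤ) (r : Fin n → ℤ) : Finset (Fin m → ℤ) → Prop
  | root : Cluster v r {0}
  | grow {F : Finset (Fin m → ℤ)} {a b : Fin m → ℤ} : Cluster v r F → a ∈ F → Adjacent a b →
      b ∉ F → Realizes v r b → Cluster v r (insert b F)

theorem Cluster.zero_mem {F : Finset (Fin m → ℤ)} (h : Cluster v r F) : 0 ∈ F := by
  induction h with
  | root => exact Finset.mem_singleton_self _
  | grow _ _ _ _ _ ih => exact Finset.mem_insert_of_mem ih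

theorem Cluster.realizes {F : Finset (Fin m → ℤ)} (h : Cluster v r F) (hr : ∀ k, r ≠ v k) :
    ∀ d ∈ F, Realizes v r d := by
  induction h with
  | root =>
    intro d hd
    rw [Finset.mem_singleton.1 hd]
    exact realizes_zero hr
  | grow _ _ _ _ hb ih =>
    intro d hd
    rcases Finset.mem_insert.1 hd with rfl | hd
    · exact hb
    · exact ih d hd

theorem Marked.eq_of_ne {i j : Fin m} {a b : Fin m → ℤ} (h : Marked i j a b) {k : Fin m}
    (hi : k ≠ i) (hj : k ≠ j) : b k = a k := by
  obtain ⟨-, ε, ε', rfl⟩ := h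
  simp [hi, hj]

theorem Marked.abs_sub_le {i j : Fin m} {a b : Fin m → ℤ} (h : Marked i j a b) (k : Fin m) :
    |b k| ≤ |a k| + 1 := by
  obtain ⟨hij, ε, ε', rfl⟩ := h
  have h1 : ∀ ε : ℤˣ, |((a k : ℤ) + ε)| ≤ |a k| + 1 := by
    intro ε
    refine (abs_add_le _ _).trans ?_
    rcases Int.units_eq_one_or ε with rfl | rfl <;> simp
  by_cases hi : k = i
  · subst hi
    simpa [hij] using h1 ε
  · by_cases hj : k = j
    · subst hj
      simpa [hi] using h1 ε'
    · simp [hi, hj]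

theorem Cluster.abs_add_one_le {F : Finset (Fin m → ℤ)} (h : Cluster v r F) :
    ∀ d ∈ F, ∀ k, |d k| + 1 ≤ F.card := by
  induction h with
  | root => simp
  | @grow F a b hF ha hab hb _ ih =>
    intro d hd k
    rw [Finset.card_insert_of_notMem hb]
    rcases Finset.mem_insert.1 hd with rfl | hd
    · obtain ⟨i, j, hij⟩ := hab
      have h1 := ih a ha k
      have h2 := hij.abs_sub_le k
      push_cast
      omega
    · have := ih d hd k
      push_cast
      omega

theorem Cluster.exists_support {F : Finset (Fin m → ℤ)} (h : Cluster v r F) :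
    ∃ T : Finset (Fin m), T.card + 2 ≤ 2 * F.card ∧ ∀ d ∈ F, ∀ i ∉ T, d i = 0 := by
  classical
  induction h with
  | root => exact ⟨∅, by simp, by simp⟩
  | @grow F a b hF ha hab hb _ ih =>
    obtain ⟨T, hT, hF⟩ := ih
    obtain ⟨i, j, hij⟩ := hab
    refine ⟨insert i (insert j T), ?_, ?_⟩
    · rw [Finset.card_insert_of_notMem hb]
      have h1 := Finset.card_insert_le i (insert j T)
      have h2 := Finset.card_insert_le j T
      omega
    · intro d hd k hk
      simp only [Finset.mem_insert, not_or] at hk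
      rcases Finset.mem_insert.1 hd with rfl | hd
      · rw [hij.eq_of_ne hk.1 hk.2.1]
        exact hF a ha k hk.2.2
      · exact hF d hd k hk.2.2

/-- This is connectedness of a cluster. In the induction the last label is either the only
difference or can be removed from the subset, and its own attaching edge covers the remaining cases.
-/
theorem Cluster.exists_adjacent {F : Finset (Fin m → ℤ)} (h : Cluster v r F) :
    ∀ S ⊆ F, S.Nonempty → S ≠ F → ∃ a ∈ S, ∃ b ∈ F, b ∉ S ∧ Adjacent a b := by
  classical
  induction h with
  | root =>
    intro S hS hne hne'
    exact absurd (Finset.Nonempty.subset_singleton_iff hne |>.1 hS) hne'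
  | @grow F a b hF ha hab hb _ ih =>
    intro S hS hne hne'
    have hab' : a ≠ b := by rintro rfl; exact hb ha
    by_cases hbS : b ∈ S
    · obtain ⟨U, hU⟩ : ∃ U, U = S.erase b := ⟨_, rfl⟩
      have hSU : S = insert b U := by rw [hU, Finset.insert_erase hbS]
      have hbU : b ∉ U := by rw [hU]; exact Finset.notMem_erase _ _
      have hUF : U ⊆ F := by
        intro x hx
        have h1 := hS (Finset.mem_of_mem_erase (hU ▸ hx))
        exact (Finset.mem_insert.1 h1).resolve_left fun h => hbU (h ▸ hx)
      by_cases haU : a ∈ U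
      · obtain ⟨x, hx, y, hy, hyU, hxy⟩ := ih U hUF ⟨a, haU⟩ (by
          rintro rfl
          exact hne' hSU)
        refine ⟨x, hSU ▸ Finset.mem_insert_of_mem hx, y, Finset.mem_insert_of_mem hy, ?_, hxy⟩
        rw [hSU, Finset.mem_insert]
        rintro (rfl | h)
        · exact hb hy
        · exact hyU h
      · refine ⟨b, hbS, a, Finset.mem_insert_of_mem ha, ?_, hab.symm⟩
        rw [hSU, Finset.mem_insert]
        rintro (h | h)
        · exact hab' h
        · exact haU h
    · have hSF : S ⊆ F := by
        intro x hx
        exact (Finset.mem_insert.1 (hS hx)).resolve_left fun h => hbS (h ▸ hx)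
      by_cases hSF' : S = F
      · subst hSF'
        exact ⟨a, ha, b, Finset.mem_insert_self _ _, hb, hab⟩
      · obtain ⟨x, hx, y, hy, hyS, hxy⟩ := ih S hSF hne hSF'
        exact ⟨x, hx, y, Finset.mem_insert_of_mem hy, hyS, hxy⟩

/-- A linear relation between labels of a cluster is also a relation between the off-diagonal parts
of their squares. -/
theorem Cluster.sum_mul_eq_zero [NeZero n] (hv : IsGeneric (resonances n) v) (hr : ∀ k, r ≠ v k)
    {F : Finset (Fin m → ℤ)} (h : Cluster v r F) (hF : F.card ≤ 5) {N : ℕ} (hN : N ≤ 5)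
    {x : Fin N → Fin m → ℤ} (hx : ∀ t, x t ∈ F) (c : Fin N → ℤ) (hc : ∑ t, c t • x t = 0)
    {i j : Fin m} (hij : i ≠ j) : ∑ t, c t * (x t i * x t j) = 0 := by
  obtain ⟨T, hT, hTF⟩ := h.exists_support
  refine hv.sum_mul_eq_zero hN (T := T) (by omega) (fun t => hTF _ (hx t)) (fun t i => ?_) hr
    (fun t => h.realizes hr _ (hx t)) c hc hij
  have := h.abs_add_one_le _ (hx t) i
  omega

theorem exists_three_of_two_values {f : Fin 5 → ℤ} (hf : ∀ t, f t = 0 ∨ f t = -2) :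
    ∃ t₀ t₁ t₂, t₀ ≠ t₁ ∧ t₀ ≠ t₂ ∧ t₁ ≠ t₂ ∧ f t₁ = f t₀ ∧ f t₂ = f t₀ := by
  classical
  have h1 : ∃ y ∈ ({0, -2} : Finset ℤ), 2 < (Finset.univ.filter fun t => f t = y).card := by
    apply Finset.exists_lt_card_fiber_of_mul_lt_card_of_maps_to
    · intro t _
      rcases hf t with h | h <;> rw [h] <;> simp
    · simp
  obtain ⟨y, -, hy⟩ := h1
  obtain ⟨a, b, c, ha, hb, hc, hab, hac, hbc⟩ := Finset.two_lt_card_iff.1 hy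
  simp only [Finset.mem_filter, Finset.mem_univ, true_and] at ha hb hc
  exact ⟨a, b, c, hab, hac, hbc, by rw [hb, ha], by rw [hc, ha]⟩

/-- Of the four labels other than the new root, n + 1 are kept, including the two of the same sign.
For n = 2 one label is dropped, for n = 3 none. -/
theorem exists_injection_of_three (hn : n = 2 ∨ n = 3) {t₀ t₁ t₂ : Fin 5} (h01 : t₀ ≠ t₁)
    (h02 : t₀ ≠ t₂) (h12 : t₁ ≠ t₂) : ∃ (g : Fin (n + 1) → Fin 5) (s₁ s₂ : Fin (n + 1)),
    Function.Injective g ∧ (∀ s, g s ≠ t₀) ∧ g s₁ = t₁ ∧ g s₂ = t₂ ∧ s₁ ≠ s₂ := by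
  obtain ⟨u₁, rfl⟩ := Fin.exists_succAbove_eq h01.symm
  obtain ⟨u₂, rfl⟩ := Fin.exists_succAbove_eq h02.symm
  have hu : u₁ ≠ u₂ := fun h => h12 (by rw [h])
  rcases hn with rfl | rfl
  · obtain ⟨w, hw1, hw2⟩ : ∃ w : Fin 4, u₁ ≠ w ∧ u₂ ≠ w := by
      clear h01 h02 h12
      revert u₁ u₂
      decide
    obtain ⟨s₁, rfl⟩ := Fin.exists_succAbove_eq hw1
    obtain ⟨s₂, rfl⟩ := Fin.exists_succAbove_eq hw2
    exact ⟨fun s => t₀.succAbove (w.succAbove s), s₁, s₂,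
      Fin.succAbove_right_injective.comp Fin.succAbove_right_injective,
      fun s => Fin.succAbove_ne _ _, rfl, rfl, fun h => hu (by rw [h])⟩
  · exact ⟨t₀.succAbove, u₁, u₂, Fin.succAbove_right_injective,
      fun s => Fin.succAbove_ne _ _, rfl, rfl, hu⟩

/-- Infinite descent: solutions are even and may be halved, so all powers of 2 divide them. -/
theorem eq_zero_of_forall_two_dvd {N : ℕ} {P : (Fin N → ℤ) → Prop} (hP : ∀ c, P c → ∀ t, 2 ∣ c t)
    (hhalf : ∀ c c' : Fin N → ℤ, P c → (∀ t, c t = 2 * c' t) → P c') {c : Fin N → ℤ} (hc : P c) :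
    c = 0 := by
  have key : ∀ e : ℕ, ∀ c, P c → ∀ t, (2 : ℤ) ^ e ∣ c t := by
    intro e
    induction e with
    | zero => simp
    | succ e ih =>
      intro c hc t
      choose c' hc' using hP c hc
      rw [hc', pow_succ']
      exact mul_dvd_mul_left _ (ih c' (hhalf c c' hc hc') t)
  funext t
  apply Int.eq_zero_of_abs_lt_dvd (key (c t).natAbs c hc t)
  rw [Int.abs_eq_natAbs]
  exact_mod_cast Nat.lt_two_pow_self

/-- Five labels of a cluster, four of them pairwise incongruent modulo two, do not exist. -/
theorem Cluster.exists_congruent_of_injective (hn : n = 2 ∨ n = 3)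
    (hv : IsGeneric (resonances n) v) (hr : ∀ k, r ≠ v k) {F : Finset (Fin m → ℤ)}
    (h : Cluster v r F) (hF : F.card ≤ 5) {x : Fin 5 → Fin m → ℤ} (hx : Function.Injective x)
    (hxF : ∀ t, x t ∈ F) (q : Fin 5) :
    ∃ s t, s ≠ q ∧ t ≠ q ∧ s ≠ t ∧ Congruent (x s) (x t) := by
  have : NeZero n := ⟨by omega⟩
  by_contra! hcon
  have hreal := fun t => h.realizes hr _ (hxF t)
  -- Under the contrary assumption the five labels are affinely independent, by parity and descent.
  have hind : ∀ c : Fin 5 → ℤ, ∑ t, c t = 0 → (∀ k, ∑ t, c t * x t k = 0) → c = 0 := by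
    intro c hc hcx
    refine eq_zero_of_forall_two_dvd (P := fun c => ∑ t, c t = 0 ∧ ∀ k, ∑ t, c t * x t k = 0)
      ?_ ?_ ⟨hc, hcx⟩
    · rintro c ⟨hc, hcx⟩ t
      refine two_dvd_of_affine_relation hx (fun t => ?_) hcon hc hcx (fun k l hkl => ?_) t
      · rcases (hreal t).sum_eq with h | h <;> rw [h] <;> norm_num
      · refine h.sum_mul_eq_zero hv hr hF le_rfl hxF c ?_ hkl
        funext k
        simpa using hcx k
    · rintro c c' ⟨hc, hcx⟩ hcc
      constructor
      · simp only [hcc, ← Finset.mul_sum] at hc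
        omega
      · intro k
        have := hcx k
        simp only [hcc, mul_assoc, ← Finset.mul_sum] at this
        omega
  -- Two signs for five labels leave three labels of the same sign. Relative to one of them, the
  -- other two are black.
  obtain ⟨t₀, t₁, t₂, h01, h02, h12, hs1, hs2⟩ :=
    exists_three_of_two_values fun t => (hreal t).sum_eq
  obtain ⟨g, s₁, s₂, hg, hgt, rfl, rfl, hs12⟩ := exists_injection_of_three hn h01 h02 h12
  obtain ⟨σ, hσ⟩ : ∃ σ, σ = 1 + ∑ k, x t₀ k := ⟨_, rfl⟩
  have hσσ : σ * σ = 1 := by rw [hσ]; exact (hreal t₀).sign_mul_sign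
  have hσabs : ∀ z : ℤ, |σ * z| = |z| := by
    intro z
    have : |σ| = 1 := by
      rw [hσ]
      rcases (hreal t₀).sum_eq with h | h <;> rw [h] <;> norm_num
    rw [abs_mul, this, one_mul]
  obtain ⟨T, hT, hTF⟩ := h.exists_support
  refine hv.not_linearIndependent (by omega) (by omega) (d := fun s => σ • (x (g s) - x t₀))
    (T := T) (by omega) ?_ ?_ (r := position v r (x t₀)) (hreal t₀).site ?_ hs12 ?_ ?_ ?_
  · intro s i hi
    simp [hTF _ (hxF (g s)) i hi, hTF _ (hxF t₀) i hi]
  · intro s i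
    simp only [Pi.smul_apply, Pi.sub_apply, smul_eq_mul, hσabs]
    have h1 := h.abs_add_one_le _ (hxF (g s)) i
    have h2 := h.abs_add_one_le _ (hxF t₀) i
    have h3 := abs_sub (x (g s) i) (x t₀ i)
    omega
  · intro s
    rw [hσ]
    exact (hreal t₀).reroot (hreal (g s))
  · rw [sum_smul_sub, hs1, sub_self, mul_zero]
  · rw [sum_smul_sub, hs2, sub_self, mul_zero]
  · rw [Fintype.linearIndependent_iff]
    intro c hc s
    classical
    -- A linear relation between the differences x_{g(s)} - x_{t₀} is rewritten as an affine
    -- relation between the five labels, with total weight zero.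
    obtain ⟨C, hC⟩ : ∃ C : Fin 5 → ℤ, C = fun t => ∑ s, c s * ((if g s = t then 1 else 0) -
        if t₀ = t then 1 else 0) := ⟨_, rfl⟩
    have hCf : ∀ f : Fin 5 → ℤ, ∑ t, C t * f t = ∑ s, c s * (f (g s) - f t₀) := by
      intro f
      simp only [hC, Finset.sum_mul]
      rw [Finset.sum_comm]
      refine Finset.sum_congr rfl fun s _ => ?_
      simp [mul_assoc, ← Finset.mul_sum, sub_mul, Finset.sum_sub_distrib]
    have hC0 : C = 0 := by
      apply hind
      · have := hCf fun _ => 1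
        simpa using this
      · intro k
        rw [hCf fun t => x t k]
        have h1 := congrFun hc k
        simp only [Finset.sum_apply, Pi.smul_apply, Pi.sub_apply, smul_eq_mul, Pi.zero_apply] at h1
        have h2 : σ * ∑ s, c s * (x (g s) k - x t₀ k) = 0 := by
          rw [← h1, Finset.mul_sum]
          exact Finset.sum_congr rfl fun s _ => by ring
        exact (mul_eq_zero.1 h2).resolve_left (by rintro rfl; simp at hσσ)
    have h1 := congrFun hC0 (g s)
    rw [hC] at h1
    simpa [hg.eq_iff, (hgt s).symm] using h1

end Clusters

/-! ### Paths forced in small connected graphs with congruent pairs. -/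

section AbstractPaths

variable {α : Type*} {Adj Cong : α → α → Prop}

/-- Neither b nor d is adjacent to e, so the edges leaving {a, c, e} can only be c–b or a–d. If one
of them were missing, b and d would be joined, which gives one of the two pairs a common neighbour.
-/
theorem exists_path_five_of_two_adjacent (hsymm : ∀ x y, Adj x y → Adj y x) {a b c d e : α}
    (hcut : ∀ S : α → Prop, S e → ∀ y ∈ ({a, b, c, d, e} : Set α), ¬ S y →
      ∃ x y, x ∈ ({a, b, c, d, e} : Set α) ∧ y ∈ ({a, b, c, d, e} : Set α) ∧ S x ∧ ¬ S y ∧ Adj x y)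
    (hab : ¬ Adj a b) (hcd : ¬ Adj c d)
    (hab' : ∀ x, x ∈ ({a, b, c, d, e} : Set α) → ¬ (Adj x a ∧ Adj x b))
    (hcd' : ∀ x, x ∈ ({a, b, c, d, e} : Set α) → ¬ (Adj x c ∧ Adj x d)) (hne : [a, b, c, d, e].Nodup)
    (hea : Adj e a)     (hec : Adj e c) : Adj c b ∧ Adj a d := by
  have h1 := hcut (fun x => x = a ∨ x = c ∨ x = e) (by simp) b (by simp) (by simp at hne ⊢; grind)
  have h2 := hcut (fun x => x ≠ b) (by simp at hne ⊢; grind) b (by simp) (by simp)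
  have h3 := hcut (fun x => x ≠ d) (by simp at hne ⊢; grind) d (by simp) (by simp)
  simp only [Set.mem_insert_iff, Set.mem_singleton_iff] at h1 h2 h3 hab' hcd'
  simp at hne
  grind

theorem exists_path_five_of_adjacent (hsymm : ∀ x y, Adj x y → Adj y x) {a b c d e : α}
    (hcut : ∀ S : α → Prop, S e → ∀ y ∈ ({a, b, c, d, e} : Set α), ¬ S y →
      ∃ x y, x ∈ ({a, b, c, d, e} : Set α) ∧ y ∈ ({a, b, c, d, e} : Set α) ∧ S x ∧ ¬ S y ∧ Adj x y)
    (hab : ¬ Adj a b) (hab' : ∀ x, x ∈ ({a, b, c, d, e} : Set α) → ¬ (Adj x a ∧ Adj x b))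
    (hcd' : ∀ x, x ∈ ({a, b, c, d, e} : Set α) → ¬ (Adj x c ∧ Adj x d)) (hcd : ¬ Adj c d) (hne : [a, b, c, d, e].Nodup)
    (hea : Adj e a) : Adj e c ∨ Adj e d := by
  have h1 := hcut (fun x => x = a ∨ x = c ∨ x = e) (by simp) b (by simp) (by simp at hne ⊢; grind)
  have h2 := hcut (fun x => x = a ∨ x = d ∨ x = e) (by simp) b (by simp) (by simp at hne ⊢; grind)
  have h3 := hcut (fun x => x = a ∨ x = e) (by simp) b (by simp) (by simp at hne ⊢; grind)
  simp only [Set.mem_insert_iff, Set.mem_singleton_iff] at h1 h2 h3 hab' hcd'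
  simp at hne
  grind

/-- Congruent vertices are at distance at least three. With two disjoint congruent pairs and a fifth
vertex e, connectedness leaves the path y, z, e, x, w in which the pairs are three steps apart and
overlap. -/
theorem exists_path_five (hsymm : ∀ x y, Adj x y → Adj y x) {a b c d e : α}
    (hcut : ∀ S : α → Prop, S e → ∀ y ∈ ({a, b, c, d, e} : Set α), ¬ S y →
      ∃ x y, x ∈ ({a, b, c, d, e} : Set α) ∧ y ∈ ({a, b, c, d, e} : Set α) ∧ S x ∧ ¬ S y ∧ Adj x y)
    (hCsymm : ∀ x y, Cong x y → Cong y x) (hCab : Cong a b) (hCcd : Cong c d)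
    (hadj : ∀ x y, Cong x y → ¬ Adj x y)
    (hcommon : ∀ x y z, x ∈ ({a, b, c, d} : Set α) → y ∈ ({a, b, c, d} : Set α) →
      z ∈ ({a, b, c, d, e} : Set α) → x ≠ y → Cong x y → ¬ (Adj z x ∧ Adj z y))
    (hne : [a, b, c, d, e].Nodup) :
    ∃ x ∈ ({a, b, c, d} : Set α), ∃ y ∈ ({a, b, c, d} : Set α), ∃ z ∈ ({a, b, c, d} : Set α),
      ∃ w ∈ ({a, b, c, d} : Set α), Cong x y ∧ Cong z w ∧ x ≠ y ∧ z ≠ w ∧ Adj y z ∧ Adj z e ∧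
        Adj e x ∧ Adj x w := by
  have key : ∀ a' b' c' d', ({a', b', c', d', e} : Set α) = {a, b, c, d, e} →
      ({a', b', c', d'} : Set α) = {a, b, c, d} → Cong a' b' → Cong c' d' →
      [a', b', c', d', e].Nodup → Adj e a' →
      ∃ x ∈ ({a, b, c, d} : Set α), ∃ y ∈ ({a, b, c, d} : Set α), ∃ z ∈ ({a, b, c, d} : Set α),
      ∃ w ∈ ({a, b, c, d} : Set α), Cong x y ∧ Cong z w ∧ x ≠ y ∧ z ≠ w ∧ Adj y z ∧ Adj z e ∧
        Adj e x ∧ Adj x w := by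
    intro a' b' c' d' h5 h4 hab hcd hne hea
    have hab' : a' ≠ b' := by simp at hne; grind
    have hcd' : c' ≠ d' := by simp at hne; grind
    rw [← h5, ← h4] at hcommon
    rw [← h5] at hcut
    rw [← h4]
    have hcab : ∀ x, x ∈ ({a', b', c', d', e} : Set α) → ¬ (Adj x a' ∧ Adj x b') := fun x hx =>
      hcommon a' b' x (by simp) (by simp) hx hab' hab
    have hccd : ∀ x, x ∈ ({a', b', c', d', e} : Set α) → ¬ (Adj x c' ∧ Adj x d') := fun x hx =>
      hcommon c' d' x (by simp) (by simp) hx hcd' hcd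
    rcases exists_path_five_of_adjacent hsymm hcut (hadj _ _ hab) hcab hccd (hadj _ _ hcd) hne
      hea with hec | hed
    · obtain ⟨h1, h2⟩ := exists_path_five_of_two_adjacent hsymm hcut (hadj _ _ hab) (hadj _ _ hcd)
        hcab hccd hne hea hec
      exact ⟨a', by simp, b', by simp, c', by simp, d', by simp, hab, hcd, hab', hcd',
        hsymm _ _ h1, hsymm _ _ hec, hea, h2⟩
    · have hset : ({a', b', c', d', e} : Set α) = {a', b', d', c', e} := by
        ext x; simp; tauto
      rw [hset] at hcut hcab hccd
      obtain ⟨h1, h2⟩ := exists_path_five_of_two_adjacent hsymm hcut (hadj _ _ hab)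
        (hadj _ _ (hCsymm _ _ hcd)) hcab (fun x hx h => hccd x hx h.symm) (by simp at hne ⊢; grind)
        hea hed
      exact ⟨a', by simp, b', by simp, d', by simp, c', by simp, hab, hCsymm _ _ hcd, hab',
        hcd'.symm, hsymm _ _ h1, hsymm _ _ hed, hea, h2⟩
  have h1 := hcut (fun x => x = e) rfl a (by simp) (by simp at hne ⊢; grind)
  obtain ⟨x, y, -, hy, rfl, hye, hxy⟩ := h1
  simp only [Set.mem_insert_iff, Set.mem_singleton_iff] at hy
  rcases hy with rfl | rfl | rfl | rfl | rfl
  · exact key y b c d rfl rfl hCab hCcd hne hxy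
  · exact key y a c d (by ext x; simp; tauto) (by ext x; simp; tauto) (hCsymm _ _ hCab) hCcd
      (by simp at hne ⊢; grind) hxy
  · exact key y d a b (by ext x; simp; tauto) (by ext x; simp; tauto) hCcd hCab
      (by simp at hne ⊢; grind) hxy
  · exact key y c a b (by ext x; simp; tauto) (by ext x; simp; tauto) (hCsymm _ _ hCcd) hCab
      (by simp at hne ⊢; grind) hxy
  · exact absurd rfl hye

theorem exists_path_four (hsymm : ∀ x y, Adj x y → Adj y x) {a b c d : α}
    (hcut : ∀ S : α → Prop, S a → ¬ S b →
      ∃ x y, x ∈ ({a, b, c, d} : Set α) ∧ y ∈ ({a, b, c, d} : Set α) ∧ S x ∧ ¬ S y ∧ Adj x y)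
    (hab : ¬ Adj a b) (hab' : ∀ x, x ∈ ({a, b, c, d} : Set α) → ¬ (Adj x a ∧ Adj x b))
    (hne : [a, b, c, d].Nodup) :
    Adj a c ∧ Adj c d ∧ Adj d b ∨ Adj a d ∧ Adj d c ∧ Adj c b := by
  have h1 := hcut (fun x => x = a) rfl (by simp at hne ⊢; grind)
  have h2 := hcut (fun x => x = a ∨ x = c) (by simp) (by simp at hne ⊢; grind)
  have h3 := hcut (fun x => x = a ∨ x = d) (by simp) (by simp at hne ⊢; grind)
  have h4 := hcut (fun x => x ≠ b) (by simp at hne ⊢; grind) (by simp)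
  simp only [Set.mem_insert_iff, Set.mem_singleton_iff] at h1 h2 h3 h4 hab'
  simp at hne
  grind

end AbstractPaths

/-! ### Congruent labels and monotone paths. -/

section CongruentLabels

variable {n m : ℕ} {v : Fin m → Fin n → ℤ} {r : Fin n → ℤ}

theorem Marked.swap {i j : Fin m} {a b : Fin m → ℤ} (h : Marked i j a b) : Marked j i a b := by
  obtain ⟨hij, ε, ε', rfl⟩ := h
  exact ⟨hij.symm, ε', ε, by abel⟩

theorem Marked.two_dvd_iff {i j : Fin m} {a b : Fin m → ℤ} (h : Marked i j a b) (k : Fin m) :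
    2 ∣ b k - a k ↔ k ≠ i ∧ k ≠ j := by
  obtain ⟨hij, ε, ε', rfl⟩ := h
  have hodd : ∀ ε : ℤˣ, ¬ (2 : ℤ) ∣ ε := by
    intro ε
    rcases Int.units_eq_one_or ε with rfl | rfl <;> norm_num
  by_cases hi : k = i
  · subst hi
    simp [hij, hodd]
  · by_cases hj : k = j
    · subst hj
      simp [hi, hodd]
    · simp [hi, hj]

theorem Adjacent.not_congruent {a b : Fin m → ℤ} (h : Congruent a b) : ¬ Adjacent a b := by
  rintro ⟨i, j, hij⟩
  exact ((hij.two_dvd_iff i).1 (h.symm i)).1 rfl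

theorem Realizes.eq_of_two_indices (hv : Function.Injective v) {x a b : Fin m → ℤ}
    (hx : Realizes v r x) (ha : Realizes v r a) (hb : Realizes v r b) (hax : a ≠ x) (hbx : b ≠ x)
    {i j : Fin m} (hij : i ≠ j) (hai : ∀ k, k ≠ i → k ≠ j → a k = x k)
    (hbi : ∀ k, k ≠ i → k ≠ j → b k = x k) : a = b := by
  obtain ⟨σ, hσ⟩ : ∃ σ, σ = 1 + ∑ k, x k := ⟨_, rfl⟩
  have hσ0 : σ ≠ 0 := by
    rintro rfl
    have := hx.sign_mul_sign
    rw [← hσ] at this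
    simp at this
  have h1 := label_unique_of_two_indices (d := σ • (a - x)) (e := σ • (b - x)) hx.site hij
    (hv.ne hij) (by rw [hσ]; exact hx.reroot ha) (by rw [hσ]; exact hx.reroot hb)
    (smul_ne_zero hσ0 (sub_ne_zero.2 hax)) (smul_ne_zero hσ0 (sub_ne_zero.2 hbx))
    (fun k hi hj => by simp [hai k hi hj]) (fun k hi hj => by simp [hbi k hi hj])
  exact sub_left_inj.1 (smul_right_injective _ hσ0 h1)

/-- The odd entries of the two steps from x agree, so both edges carry the same pair of indices. In
the plane of these two sites x has at most one neighbour. -/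
theorem Realizes.not_congruent_of_common (hv : Function.Injective v) {x a b : Fin m → ℤ}
    (hx : Realizes v r x) (ha : Realizes v r a) (hb : Realizes v r b) (hab : a ≠ b)
    (hcong : Congruent a b) : ¬ (Adjacent x a ∧ Adjacent x b) := by
  rintro ⟨⟨i, j, hxa⟩, ⟨k, l, hxb⟩⟩
  have hpar : ∀ z, (z ≠ i ∧ z ≠ j) ↔ (z ≠ k ∧ z ≠ l) := by
    intro z
    rw [← hxa.two_dvd_iff, ← hxb.two_dvd_iff]
    have := hcong z
    omega
  have hne : ∀ {i j} {a : Fin m → ℤ}, Marked i j x a → a ≠ x := by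
    rintro i j a h rfl
    simpa using (h.two_dvd_iff i).1 (by simp)
  refine hab (hx.eq_of_two_indices hv ha hb (hne hxa) (hne hxb) hxa.1
    (fun z hi hj => hxa.eq_of_ne hi hj) fun z hi hj => ?_)
  exact hxb.eq_of_ne ((hpar z).1 ⟨hi, hj⟩).1 ((hpar z).1 ⟨hi, hj⟩).2

/-- Relative to a, such a label would be ±2e_i. Its sum must be 0 or -2, so it is -2e_i, which no
normal site admits. -/
theorem Realizes.ne_add_single {a b : Fin m → ℤ} (ha : Realizes v r a)
    (hb : Realizes v r b) (i : Fin m) (ε : ℤˣ) : b ≠ a + Pi.single i (2 * (ε : ℤ)) := by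
  rintro rfl
  have h1 := ha.reroot hb
  have h2 : (1 + ∑ k, a k) • (a + Pi.single i (2 * (ε : ℤ)) - a) =
      Pi.single i ((1 + ∑ k, a k) * (2 * (ε : ℤ))) := by
    rw [add_sub_cancel_left, ← Pi.single_smul, smul_eq_mul]
  rw [h2] at h1
  have h3 := h1.sum_eq
  rw [Finset.sum_pi_single' i _ Finset.univ, if_pos (Finset.mem_univ _)] at h3
  rcases h3 with h3 | h3
  · rcases ha.sum_eq with h4 | h4 <;> rw [h4] at h3 <;>
      rcases Int.units_eq_one_or ε with rfl | rfl <;> norm_num at h3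
  · rw [h3] at h1
    exact not_realizes_neg_two ha.site i h1

/-- Four labels on a path whose three edges are marked by the sides of a triangle, with signs
depending on the index only. -/
def MonotonePath (i j k : Fin m) (α β γ : ℤˣ) (a b c d : Fin m → ℤ) : Prop :=
  i ≠ j ∧ j ≠ k ∧ i ≠ k ∧ b = a + Pi.single i (α : ℤ) + Pi.single j (β : ℤ) ∧
    c = b + Pi.single j (β : ℤ) + Pi.single k (γ : ℤ) ∧
    d = c + Pi.single k (γ : ℤ) + Pi.single i (α : ℤ)

/-- Modulo 2 the three index pairs sum to zero. The first two differ because a and c are not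
congruent, so the pairs are the sides of a triangle. -/
theorem exists_triangle_marks (hv : Function.Injective v) {a b c d : Fin m → ℤ}
    (ha : Realizes v r a) (hb : Realizes v r b) (hc : Realizes v r c)
    (hac : a ≠ c) (had : Congruent a d) (hab : Adjacent a b) (hbc : Adjacent b c)
    (hcd : Adjacent c d) : ∃ i j k, i ≠ k ∧ Marked i j a b ∧ Marked j k b c ∧ Marked k i c d := by
  obtain ⟨i, j, h1⟩ := hab
  obtain ⟨k, l, h2⟩ := id hbc
  obtain ⟨p, q, h3⟩ := id hcd
  have hij := h1.1
  have hkl := h2.1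
  have hpq := h3.1
  have hpar : ∀ z, ((z ≠ i ∧ z ≠ j) ↔ (z ≠ k ∧ z ≠ l)) ↔ (z ≠ p ∧ z ≠ q) := by
    intro z
    rw [← h1.two_dvd_iff, ← h2.two_dvd_iff, ← h3.two_dvd_iff]
    have := had z
    omega
  have hnac : ¬ Congruent a c := fun h =>
    hb.not_congruent_of_common hv ha hc hac h ⟨⟨i, j, h1.symm⟩, hbc⟩
  have hkl_ij : ¬ ((k = i ∨ k = j) ∧ (l = i ∨ l = j)) := by
    rintro ⟨hk, hl⟩
    apply hnac
    intro z
    have e1 := h1.two_dvd_iff z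
    have e2 := h2.two_dvd_iff z
    have : (z ≠ i ∧ z ≠ j) ↔ (z ≠ k ∧ z ≠ l) := by grind
    omega
  have hpq_ij : ¬ ((p = i ∨ p = j) ∧ (q = i ∨ q = j)) := by
    rintro ⟨hp, hq⟩
    have := hpar k
    grind
  have hi := hpar i
  have hj := hpar j
  have hk := hpar k
  have hl := hpar l
  have hp := hpar p
  have hq := hpar q
  have key : ∃ x y z, x ≠ z ∧ ((x = i ∧ y = j) ∨ (x = j ∧ y = i)) ∧
      ((y = k ∧ z = l) ∨ (y = l ∧ z = k)) ∧ ((z = p ∧ x = q) ∨ (z = q ∧ x = p)) := by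
    by_cases hik : i = k ∨ i = l
    · by_cases hik' : i = k
      · exact ⟨j, i, l, by grind⟩
      · exact ⟨j, i, k, by grind⟩
    · by_cases hik' : j = k
      · exact ⟨i, j, l, by grind⟩
      · exact ⟨i, j, k, by grind⟩
  obtain ⟨x, y, z, hxz, hx, hy, hz⟩ := key
  refine ⟨x, y, z, hxz, ?_, ?_, ?_⟩
  · rcases hx with ⟨rfl, rfl⟩ | ⟨rfl, rfl⟩
    · exact h1
    · exact h1.swap
  · rcases hy with ⟨rfl, rfl⟩ | ⟨rfl, rfl⟩
    · exact h2
    · exact h2.swap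
  · rcases hz with ⟨rfl, rfl⟩ | ⟨rfl, rfl⟩
    · exact h3
    · exact h3.swap

/-- Two congruent labels at the ends of a path of length three in a generic cluster are joined by a
monotone path. -/
theorem Cluster.exists_monotonePath [NeZero n] (hv : Function.Injective v)
    (hgen : IsGeneric (resonances n) v) (hr : ∀ k, r ≠ v k) {F : Finset (Fin m → ℤ)}
    (h : Cluster v r F) (hF : F.card ≤ 5) {a b c d : Fin m → ℤ} (ha : a ∈ F) (hb : b ∈ F)
    (hc : c ∈ F) (hd : d ∈ F) (hab : Adjacent a b) (hbc : Adjacent b c) (hcd : Adjacent c d)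
    (hne : a ≠ d) (had : Congruent a d) :
    ∃ i j k α β γ, MonotonePath i j k α β γ a b c d := by
  have hra := h.realizes hr a ha
  have hrb := h.realizes hr b hb
  have hrc := h.realizes hr c hc
  have hrd := h.realizes hr d hd
  have hac : a ≠ c := by
    rintro rfl
    exact Adjacent.not_congruent had hcd
  have hbd : b ≠ d := by
    rintro rfl
    exact Adjacent.not_congruent had hab
  obtain ⟨i, j, k, hik, h1, h2, h3⟩ := exists_triangle_marks hv hra hrb hrc hac had hab hbc hcd
  have hba : b ≠ a := by
    rintro rfl
    exact Adjacent.not_congruent (fun k => by simp) hab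
  have hcd' : c ≠ d := by
    rintro rfl
    exact Adjacent.not_congruent (fun k => by simp) hcd
  obtain ⟨hij, α, β, hb'⟩ := id h1
  obtain ⟨hjk, β', γ, hc'⟩ := id h2
  obtain ⟨-, γ', α', hd'⟩ := id h3
  have huni : ∀ x y : ℤˣ, x = y ∨ x = -y := by decide
  have hd'' : d = a + Pi.single i ((α : ℤ) + α') + Pi.single j ((β : ℤ) + β') +
      Pi.single k ((γ : ℤ) + γ') := by
    rw [hd', hc', hb', Pi.single_add, Pi.single_add, Pi.single_add]
    abel
  -- Each index is passed twice, with equal or opposite signs. If one pair of signs cancels, the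
  -- ends lie in a plane of two indices together with a neighbour, or else the square relation
  -- applies; if two cancel, the ends differ by ±2e; if all cancel, the ends coincide.
  rcases huni α' α with rfl | rfl <;> rcases huni β' β with rfl | rfl <;>
    rcases huni γ' γ with rfl | rfl
  · exact ⟨i, j, k, α', β', γ', hij, hjk, hik, hb', hc', hd'⟩
  · exfalso
    refine hbd (hra.eq_of_two_indices hv hrb hrd hba hne.symm hij
      (fun z hi hj => h1.eq_of_ne hi hj) fun z hi hj => ?_)
    rw [hd'']
    simp [hi, hj]
  · exfalso
    refine hac ((hrd.eq_of_two_indices hv hrc hra hcd' hne hik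
      (fun z hi hk => (h3.eq_of_ne hk hi).symm) fun z hi hk => ?_)).symm
    rw [hd'']
    simp [hi, hk]
  · exfalso
    refine hra.ne_add_single hrd i α' ?_
    rw [hd'']
    simp [two_mul]
  · exfalso
    -- With opposite signs at i only, a - 2b + 2c - d = 0, and the corresponding relation between
    -- squares fails at the entry (i,j).
    have h4 := h.sum_mul_eq_zero hgen hr hF (x := ![a, b, c, d]) (by norm_num)
      (by intro t; fin_cases t <;> assumption) ![1, -2, 2, -1] (by
        simp only [Fin.sum_univ_four, Matrix.cons_val]
        rw [hd'', hc', hb']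
        funext z
        simp [Pi.single_add]
        ring) hij
    simp only [Fin.sum_univ_four, Matrix.cons_val, hd'', hc', hb'] at h4
    simp [hij, hij.symm, hik, hjk] at h4
    have h5 : (2 * α * β' : ℤ) = 0 := by linear_combination h4
    simp at h5
  · exfalso
    refine hra.ne_add_single hrd j β' ?_
    rw [hd'']
    simp [two_mul]
  · exfalso
    refine hra.ne_add_single hrd k γ' ?_
    rw [hd'']
    simp [two_mul]
  · exfalso
    apply hne
    rw [hd'']
    simp

end CongruentLabels

/-! ### Generic clusters have at most four labels. -/

section Components

variable {n m : ℕ} {v : Fin m → Fin n → ℤ} {r : Fin n → ℤ}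

theorem Cluster.exists_adjacent_of_mem {F : Finset (Fin m → ℤ)} (h : Cluster v r F)
    (hF : 1 < F.card) {a : Fin m → ℤ} (ha : a ∈ F) : ∃ b ∈ F, Adjacent a b := by
  obtain ⟨x, hx, b, hb, -, hab⟩ := h.exists_adjacent {a} (by simpa using ha)
    (Finset.singleton_nonempty a) (by rintro rfl; simp at hF)
  rw [Finset.mem_singleton.1 hx] at hab
  exact ⟨b, hb, hab⟩

theorem Cluster.exists_adjacent_of_predicate {F : Finset (Fin m → ℤ)} (h : Cluster v r F)
    (S : (Fin m → ℤ) → Prop) {x y : Fin m → ℤ} (hx : x ∈ F) (hxS : S x) (hy : y ∈ F)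
    (hyS : ¬ S y) : ∃ a b, a ∈ F ∧ b ∈ F ∧ S a ∧ ¬ S b ∧ Adjacent a b := by
  classical
  obtain ⟨a, ha, b, hb, hbS, hab⟩ := h.exists_adjacent (F.filter S) (Finset.filter_subset _ _)
    ⟨x, Finset.mem_filter.2 ⟨hx, hxS⟩⟩ (by
      intro hFS
      rw [← hFS] at hy
      exact hyS (Finset.mem_filter.1 hy).2)
  rw [Finset.mem_filter] at ha hbS
  exact ⟨a, b, ha.1, hb, ha.2, fun h => hbS ⟨hb, h⟩, hab⟩

/-- The two shared steps force the second path to use the indices and signs of the first, shifted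
cyclically by one. Its last step therefore repeats the first step of the first path. -/
theorem MonotonePath.last_step {i j k i' j' k' : Fin m} {α β γ α' β' γ' : ℤˣ}
    {p₀ p₁ p₂ p₃ p₄ : Fin m → ℤ} (h : MonotonePath i j k α β γ p₀ p₁ p₂ p₃)
    (h' : MonotonePath i' j' k' α' β' γ' p₁ p₂ p₃ p₄) :
    p₄ = p₃ + Pi.single i (α : ℤ) + Pi.single j (β : ℤ) := by
  obtain ⟨hij, hjk, hik, -, h2, h3⟩ := h
  obtain ⟨hij', hjk', hik', h2', h3', h4'⟩ := h'
  have hm2 : Marked j k p₁ p₂ := ⟨hjk, β, γ, h2⟩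
  have hm3 : Marked k i p₂ p₃ := ⟨hik.symm, γ, α, h3⟩
  have hm2' : Marked i' j' p₁ p₂ := ⟨hij', α', β', h2'⟩
  have hm3' : Marked j' k' p₂ p₃ := ⟨hjk', β', γ', h3'⟩
  have hk : k = j' := by
    have e1 := (hm2.two_dvd_iff k).symm.trans (hm2'.two_dvd_iff k)
    have e2 := (hm3.two_dvd_iff k).symm.trans (hm3'.two_dvd_iff k)
    grind
  subst hk
  have hγ : (γ : ℤ) = β' := by
    have e1 := congrFun (h2.symm.trans h2') k
    simpa [hjk.symm, hij'.symm] using e1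
  have e1 := h2.symm.trans h2'
  have e2 := h3.symm.trans h3'
  rw [hγ] at e1 e2
  have e3 : Pi.single i' (α' : ℤ) = (Pi.single j (β : ℤ) : Fin m → ℤ) := by
    rw [add_right_cancel_iff, add_right_inj] at e1
    exact e1.symm
  have e4 : Pi.single k' (γ' : ℤ) = (Pi.single i (α : ℤ) : Fin m → ℤ) := by
    rw [add_right_inj] at e2
    exact e2.symm
  rw [h4', e3, e4]

/-- Any four of five labels contain a congruent pair. This yields two disjoint congruent pairs and
then a path p₀, …, p₄ with p₀ congruent to p₃ and p₁ to p₄; the overlapping monotone paths give p₁ -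
p₀ = p₄ - p₃, against the relation between squares. -/
theorem Cluster.card_ne_five (hn : n = 2 ∨ n = 3) (hv : Function.Injective v)
    (hgen : IsGeneric (resonances n) v) (hr : ∀ k, r ≠ v k) {F : Finset (Fin m → ℤ)}
    (h : Cluster v r F) : F.card ≠ 5 := by
  classical
  intro hF
  have : NeZero n := ⟨by omega⟩
  have hreal := h.realizes hr
  have hcommon : ∀ x y z, x ∈ F → y ∈ F → z ∈ F → x ≠ y → Congruent x y →
      ¬ (Adjacent z x ∧ Adjacent z y) := fun x y z hx hy hz hxy hc =>
    (hreal z hz).not_congruent_of_common hv (hreal x hx) (hreal y hy) hxy hc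
  obtain ⟨x, hx, hxF⟩ : ∃ x : Fin 5 → Fin m → ℤ, Function.Injective x ∧ ∀ t, x t ∈ F :=
    ⟨fun t => ((F.equivFinOfCardEq hF).symm t).1,
      Subtype.val_injective.comp (F.equivFinOfCardEq hF).symm.injective, fun t => Subtype.prop _⟩
  obtain ⟨t, s, -, -, hts, hc1⟩ := h.exists_congruent_of_injective hn hgen hr hF.le hx hxF 0
  -- Leaving out a member s of the first pair ensures that the second pair is a different one.
  obtain ⟨p, q, hps, hqs, hpq, hc2⟩ := h.exists_congruent_of_injective hn hgen hr hF.le hx hxF s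
  -- Three mutually congruent labels would need three distinct neighbours, six labels in all. Hence
  -- the two pairs are disjoint.
  have htriple : ∀ a b c, a ∈ F → b ∈ F → c ∈ F → a ≠ b → a ≠ c → b ≠ c → Congruent a b →
      Congruent a c → False := by
    intro a b c ha hb hc hab hac hbc hcab hcac
    obtain ⟨a', ha', haa⟩ := h.exists_adjacent_of_mem (by omega) ha
    obtain ⟨b', hb', hbb⟩ := h.exists_adjacent_of_mem (by omega) hb
    obtain ⟨c', hc', hcc⟩ := h.exists_adjacent_of_mem (by omega) hc
    have hcbc := hcab.symm.trans hcac
    have hrefl : ∀ z : Fin m → ℤ, Congruent z z := fun z k => by simp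
    have hnadj : ∀ {z w : Fin m → ℤ}, Adjacent z w → ¬ Congruent z w := fun h h' =>
      Adjacent.not_congruent h' h
    have h1 : a ≠ a' := by rintro rfl; exact hnadj haa (hrefl _)
    have h2 : a ≠ b' := by rintro rfl; exact hnadj hbb hcab.symm
    have h3 : a ≠ c' := by rintro rfl; exact hnadj hcc hcac.symm
    have h4 : b ≠ a' := by rintro rfl; exact hnadj haa hcab
    have h5 : b ≠ b' := by rintro rfl; exact hnadj hbb (hrefl _)
    have h6 : b ≠ c' := by rintro rfl; exact hnadj hcc hcbc.symm
    have h7 : c ≠ a' := by rintro rfl; exact hnadj haa hcac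
    have h8 : c ≠ b' := by rintro rfl; exact hnadj hbb hcbc
    have h9 : c ≠ c' := by rintro rfl; exact hnadj hcc (hrefl _)
    have h10 : a' ≠ b' := by
      rintro rfl
      exact hcommon a b a' ha hb ha' hab hcab ⟨haa.symm, hbb.symm⟩
    have h11 : a' ≠ c' := by
      rintro rfl
      exact hcommon a c a' ha hc ha' hac hcac ⟨haa.symm, hcc.symm⟩
    have h12 : b' ≠ c' := by
      rintro rfl
      exact hcommon b c b' hb hc hb' hbc hcbc ⟨hbb.symm, hcc.symm⟩
    have h13 : ({a, b, c, a', b', c'} : Finset (Fin m → ℤ)).card ≤ F.card :=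
      Finset.card_le_card (by
        intro z hz
        simp only [Finset.mem_insert, Finset.mem_singleton] at hz
        rcases hz with rfl | rfl | rfl | rfl | rfl | rfl <;> assumption)
    rw [Finset.card_insert_of_notMem (by simp [*]), Finset.card_insert_of_notMem (by simp [*]),
      Finset.card_insert_of_notMem (by simp [*]), Finset.card_insert_of_notMem (by simp [*]),
      Finset.card_insert_of_notMem (by simp [*]), Finset.card_singleton] at h13
    omega
  by_cases htp : t = p
  · subst htp
    exact htriple (x t) (x s) (x q) (hxF _) (hxF _) (hxF _) (hx.ne hts) (hx.ne hpq)
      (hx.ne hqs.symm) hc1 hc2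
  by_cases htq : t = q
  · subst htq
    exact htriple (x t) (x s) (x p) (hxF _) (hxF _) (hxF _) (hx.ne hts) (hx.ne hpq.symm)
      (hx.ne hps.symm) hc1 hc2.symm
  have h4 : ({t, s, p, q} : Finset (Fin 5)).card = 4 := by
    rw [Finset.card_insert_of_notMem (by simp [*]),
      Finset.card_insert_of_notMem (by simp [hps.symm, hqs.symm]),
      Finset.card_insert_of_notMem (by simp [*]), Finset.card_singleton]
  obtain ⟨u, hu⟩ : ∃ u, u ∉ ({t, s, p, q} : Finset (Fin 5)) := by
    by_contra! hcon
    have := Finset.card_le_card (fun z _ => hcon z : Finset.univ ⊆ ({t, s, p, q} : Finset (Fin 5)))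
    rw [h4, Finset.card_univ, Fintype.card_fin] at this
    omega
  simp only [Finset.mem_insert, Finset.mem_singleton, not_or] at hu
  have hnodup : [x t, x s, x p, x q, x u].Nodup := by
    have : [t, s, p, q, u].Nodup := by
      simp
      grind
    exact this.map hx
  have hFeq : F = {x t, x s, x p, x q, x u} := by
    symm
    apply Finset.eq_of_subset_of_card_le
    · intro z hz
      simp only [Finset.mem_insert, Finset.mem_singleton] at hz
      rcases hz with rfl | rfl | rfl | rfl | rfl <;> exact hxF _
    · rw [hF]
      have := List.toFinset_card_of_nodup hnodup
      simp only [List.toFinset_cons, List.toFinset_nil, insert_empty_eq, List.length_cons,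
        List.length_nil] at this
      omega
  have hFset : ∀ z, z ∈ ({x t, x s, x p, x q, x u} : Set (Fin m → ℤ)) ↔ z ∈ F := by
    intro z
    rw [hFeq]
    simp
  have hFset' : ∀ z, z ∈ ({x t, x s, x p, x q} : Set (Fin m → ℤ)) → z ∈ F := by
    intro z hz
    rw [← hFset]
    simp only [Set.mem_insert_iff, Set.mem_singleton_iff] at hz ⊢
    tauto
  obtain ⟨p₃, hp3, p₀, hp0, p₁, hp1, p₄, hp4, hc03, hc14, hne03, hne14, a01, a12, a23, a34⟩ :=
    exists_path_five (Adj := Adjacent) (Cong := Congruent) (fun _ _ => Adjacent.symm)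
      (a := x t) (b := x s) (c := x p) (d := x q) (e := x u)
      (by
        intro S hSu y hy hyS
        rw [hFset] at hy
        simp only [hFset]
        exact h.exists_adjacent_of_predicate S (hxF u) hSu hy hyS)
      (fun _ _ => Congruent.symm) hc1 hc2 (fun _ _ => Adjacent.not_congruent)
      (fun a b z ha hb hz => hcommon a b z (hFset' a ha) (hFset' b hb) ((hFset z).1 hz)) hnodup
  have hm0 := hFset' _ hp0
  have hm1 := hFset' _ hp1
  have hm3 := hFset' _ hp3
  have hm4 := hFset' _ hp4
  obtain ⟨i, j, k, α, β, γ, hpath⟩ := h.exists_monotonePath hv hgen hr hF.le hm0 hm1 (hxF u) hm3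
    a01 a12 a23 hne03.symm hc03.symm
  obtain ⟨i', j', k', α', β', γ', hpath'⟩ := h.exists_monotonePath hv hgen hr hF.le hm1 (hxF u) hm3
    hm4 a12 a23 a34 hne14 hc14
  have hlast := hpath.last_step hpath'
  obtain ⟨hij, hjk, hik, e1, e2, e3⟩ := hpath
  -- The parallelogram relation -p₀ + p₁ + p₃ - p₄ = 0 would require 4αβ = 0 at the entry (i,j) of
  -- the squares.
  have hsum := h.sum_mul_eq_zero hgen hr hF.le (x := ![p₀, p₁, p₃, p₄]) (by norm_num)
    (by intro t; fin_cases t <;> assumption) ![-1, 1, 1, -1] (by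
      simp only [Fin.sum_univ_four, Matrix.cons_val]
      rw [hlast, e1]
      funext z
      simp
      ring) hij
  have f3 : p₃ = p₀ + Pi.single i (2 * α : ℤ) + Pi.single j (2 * β : ℤ) +
      Pi.single k (2 * γ : ℤ) := by
    rw [e3, e2, e1, two_mul, two_mul, two_mul, Pi.single_add, Pi.single_add, Pi.single_add]
    abel
  simp only [Fin.sum_univ_four, Matrix.cons_val] at hsum
  rw [hlast, e1, f3] at hsum
  simp [hij, hij.symm, hik, hjk] at hsum
  have h5 : (4 * α * β : ℤ) = 0 := by linear_combination -hsum
  simp at h5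

/-- A generic cluster with at most four labels consists of labels that are pairwise incongruent
modulo two, or of the labels of a monotone path. -/
theorem Cluster.incongruent_or_exists_monotonePath [NeZero n] (hv : Function.Injective v)
    (hgen : IsGeneric (resonances n) v) (hr : ∀ k, r ≠ v k) {F : Finset (Fin m → ℤ)}
    (h : Cluster v r F) (hF : F.card ≤ 4) :
    (∀ a ∈ F, ∀ b ∈ F, a ≠ b → ¬ Congruent a b) ∨
      ∃ a b c d i j k α β γ, MonotonePath i j k α β γ a b c d ∧
        ∀ z, z ∈ F ↔ z = a ∨ z = b ∨ z = c ∨ z = d := by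
  classical
  by_cases hinc : ∀ a ∈ F, ∀ b ∈ F, a ≠ b → ¬ Congruent a b
  · exact Or.inl hinc
  right
  push Not at hinc
  obtain ⟨a, ha, b, hb, hab, hcong⟩ := hinc
  have hreal := h.realizes hr
  have hcommon : ∀ z ∈ F, ¬ (Adjacent z a ∧ Adjacent z b) := fun z hz =>
    (hreal z hz).not_congruent_of_common hv (hreal a ha) (hreal b hb) hab hcong
  have hcard : 1 < F.card := Finset.one_lt_card.2 ⟨a, ha, b, hb, hab⟩
  obtain ⟨c, hc, hac⟩ := h.exists_adjacent_of_mem hcard ha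
  obtain ⟨d, hd, hbd⟩ := h.exists_adjacent_of_mem hcard hb
  have h1 : a ≠ c := by rintro rfl; exact Adjacent.not_congruent (fun k => by simp) hac
  have h2 : b ≠ c := by rintro rfl; exact Adjacent.not_congruent hcong hac
  have h3 : a ≠ d := by rintro rfl; exact Adjacent.not_congruent hcong.symm hbd
  have h4 : b ≠ d := by rintro rfl; exact Adjacent.not_congruent (fun k => by simp) hbd
  have h5 : c ≠ d := by rintro rfl; exact hcommon c hc ⟨hac.symm, hbd.symm⟩
  have hFeq : ({a, b, c, d} : Finset (Fin m → ℤ)) = F := by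
    apply Finset.eq_of_subset_of_card_le
    · intro z hz
      simp only [Finset.mem_insert, Finset.mem_singleton] at hz
      rcases hz with rfl | rfl | rfl | rfl <;> assumption
    · rw [Finset.card_insert_of_notMem (by simp [*]), Finset.card_insert_of_notMem (by simp [*]),
        Finset.card_insert_of_notMem (by simp [*]), Finset.card_singleton]
      omega
  have hFset : ∀ z, z ∈ ({a, b, c, d} : Set (Fin m → ℤ)) ↔ z ∈ F := by
    intro z
    rw [← hFeq]
    simp
  have hmem : ∀ z, z ∈ F ↔ z = a ∨ z = b ∨ z = c ∨ z = d := by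
    intro z
    rw [← hFset]
    simp
  rcases exists_path_four (Adj := Adjacent) (fun _ _ => Adjacent.symm) (a := a) (b := b) (c := c)
    (d := d) (by
      intro S hSa hSb
      simp only [hFset]
      exact h.exists_adjacent_of_predicate S ha hSa hb hSb) (Adjacent.not_congruent hcong)
    (fun z hz => hcommon z ((hFset z).1 hz)) (by simp; grind) with ⟨e1, e2, e3⟩ | ⟨e1, e2, e3⟩
  · obtain ⟨i, j, k, α, β, γ, hp⟩ := h.exists_monotonePath hv hgen hr (by omega) ha hc hd hb e1 e2
      e3 hab hcong
    exact ⟨a, c, d, b, i, j, k, α, β, γ, hp, fun z => by rw [hmem]; tauto⟩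
  · obtain ⟨i, j, k, α, β, γ, hp⟩ := h.exists_monotonePath hv hgen hr (by omega) ha hd hc hb e1 e2
      e3 hab hcong
    exact ⟨a, d, c, b, i, j, k, α, β, γ, hp, fun z => by rw [hmem]; tauto⟩

end Components

/-! ### The labels of a component do not depend on the paths. -/

section Labels

variable {n m : ℕ} {v : Fin m → Fin n → ℤ} {r : NormalSite v}

/-- The signed labels of the paths from `r`. -/
def pathLabels (v : Fin m → Fin n → ℤ) (r : NormalSite v) : Set (Fin m → ℤ) :=
  {d | ∃ a s L, PathLabel v r a s L ∧ d = (s : ℤ) • L}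

theorem black_step_marked {i j : Fin m} (hij : i ≠ j) (s : ℤˣ) (L : Fin m → ℤ) :
    Marked i j ((s : ℤ) • L) ((s : ℤ) • (Pi.single j 1 - Pi.single i 1 + L)) := by
  refine ⟨hij, -s, s, ?_⟩
  rw [smul_add, smul_sub, ← Pi.single_smul, ← Pi.single_smul, Units.val_neg, Pi.single_neg]
  simp only [smul_eq_mul, mul_one]
  abel

theorem red_step_marked {i j : Fin m} (hij : i ≠ j) (s : ℤˣ) (L : Fin m → ℤ) :
    Marked i j ((s : ℤ) • L) (((-s : ℤˣ) : ℤ) • (Pi.single j 1 + Pi.single i 1 - L)) := by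
  refine ⟨hij, -s, -s, ?_⟩
  rw [smul_sub, smul_add, ← Pi.single_smul, ← Pi.single_smul, Units.val_neg, neg_smul _ L]
  simp only [smul_eq_mul, mul_one]
  abel

/-- A path whose label is outside F has a first step that leaves F, and this step supplies the new
label. -/
theorem Cluster.exists_grow {F : Finset (Fin m → ℤ)} (h : Cluster v r.1 F)
    (hF : (F : Set (Fin m → ℤ)) ⊆ pathLabels v r) (hne : ¬ pathLabels v r ⊆ F) :
    ∃ F', Cluster v r.1 F' ∧ (F' : Set (Fin m → ℤ)) ⊆ pathLabels v r ∧ F'.card = F.card + 1 := by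
  have key : ∀ {a s L}, PathLabel v r a s L → (s : ℤ) • L ∈ F ∨
      ∃ x ∈ F, ∃ y ∈ pathLabels v r, y ∉ F ∧ Adjacent x y := by
    intro a s L hp
    induction hp with
    | nil =>
      left
      simpa using h.zero_mem
    | @black a b s L i j hp hb ih =>
      rcases ih with ih | ih
      · by_cases hmem : (s : ℤ) • (Pi.single j 1 - Pi.single i 1 + L) ∈ F
        · exact Or.inl hmem
        · exact Or.inr ⟨_, ih, _, ⟨b, s, _, hp.black hb, rfl⟩, hmem, i, j,
            black_step_marked hb.1 s L⟩
      · exact Or.inr ih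
    | @red a b s L i j hp hb ih =>
      rcases ih with ih | ih
      · by_cases hmem : ((-s : ℤˣ) : ℤ) • (Pi.single j 1 + Pi.single i 1 - L) ∈ F
        · exact Or.inl hmem
        · exact Or.inr ⟨_, ih, _, ⟨b, -s, _, hp.red hb, rfl⟩, hmem, i, j,
            red_step_marked hb.1 s L⟩
      · exact Or.inr ih
  obtain ⟨d, ⟨a, s, L, hp, rfl⟩, hd⟩ := Set.not_subset.1 hne
  rcases key hp with hmem | ⟨x, hx, y, hy, hyF, hxy⟩
  · exact absurd hmem hd
  · have hreal : Realizes v r.1 y := by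
      obtain ⟨a, s, L, hp, rfl⟩ := hy
      exact hp.realizes
    refine ⟨insert y F, h.grow hx hxy hyF hreal, ?_, Finset.card_insert_of_notMem hyF⟩
    rw [Finset.coe_insert]
    exact Set.insert_subset hy hF

/-- The labels of a component form a cluster with at most four elements. -/
theorem exists_cluster_eq_pathLabels (hn : n = 2 ∨ n = 3) (hv : Function.Injective v)
    (hgen : IsGeneric (resonances n) v) (r : NormalSite v) :
    ∃ F, Cluster v r.1 F ∧ F.card ≤ 4 ∧ (F : Set (Fin m → ℤ)) = pathLabels v r := by
  by_contra! hcon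
  have key : ∀ e ≤ 4, ∃ F, Cluster v r.1 F ∧ F.card = e + 1 ∧
      (F : Set (Fin m → ℤ)) ⊆ pathLabels v r := by
    intro e
    induction e with
    | zero =>
      intro _
      refine ⟨{0}, Cluster.root, by simp, ?_⟩
      simp only [Finset.coe_singleton, Set.singleton_subset_iff]
      exact ⟨r, 1, 0, PathLabel.nil, by simp⟩
    | succ e ih =>
      intro he
      obtain ⟨F, hF, hcard, hsub⟩ := ih (by omega)
      obtain ⟨F', h1, h2, h3⟩ := hF.exists_grow hsub fun h =>
        hcon F hF (by omega) (Set.Subset.antisymm hsub h)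
      exact ⟨F', h1, by omega, h2⟩
  obtain ⟨F, hF, hcard, -⟩ := key 4 le_rfl
  exact hF.card_ne_five hn hv hgen (fun k h => r.2 ⟨k, h.symm⟩) hcard

/-- The label of a site of a component does not depend on the path. -/
theorem PathLabel.unique (hn : n = 2 ∨ n = 3) (hv : Function.Injective v)
    (hgen : IsGeneric (resonances n) v) {a : NormalSite v} {s s' : ℤˣ} {L L' : Fin m → ℤ}
    (h : PathLabel v r a s L) (h' : PathLabel v r a s' L') : s = s' ∧ L = L' := by
  have : NeZero n := ⟨by omega⟩
  obtain ⟨F, hF, hcard, hFeq⟩ := exists_cluster_eq_pathLabels hn hv hgen r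
  obtain ⟨T, hT, hTF⟩ := hF.exists_support
  have hmem : ∀ {s : ℤˣ} {L}, PathLabel v r a s L → (s : ℤ) • L ∈ F := by
    intro s L h
    rw [← Finset.mem_coe, hFeq]
    exact ⟨a, s, L, h, rfl⟩
  obtain ⟨d, hd⟩ : ∃ d, d = (s : ℤ) • L := ⟨_, rfl⟩
  obtain ⟨d', hd'⟩ : ∃ d', d' = (s' : ℤ) • L' := ⟨_, rfl⟩
  have hdF : d ∈ F := hd ▸ hmem h
  have hdF' : d' ∈ F := hd' ▸ hmem h'
  have hreal : Realizes v r.1 d := hd ▸ h.realizes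
  have hreal' : Realizes v r.1 d' := hd' ▸ h'.realizes
  have hpos : position v r.1 d = a.1 := hd ▸ h.position_eq
  have hpos' : position v r.1 d' = a.1 := hd' ▸ h'.position_eq
  have hs : 1 + ∑ k, d k = s := hd ▸ h.one_add_sum
  have hs' : 1 + ∑ k, d' k = s' := hd' ▸ h'.one_add_sum
  -- The label, relative to the site a, of the closed path that two paths from r to a form.
  obtain ⟨e, he⟩ : ∃ e, e = (s : ℤ) • (d' - d) := ⟨_, rfl⟩
  have heT : ∀ i ∉ T, e i = 0 := by
    intro i hi
    simp [he, hTF d hdF i hi, hTF d' hdF' i hi]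
  have he8 : ∀ i, |e i| ≤ 8 := by
    intro i
    have h1 := hF.abs_add_one_le d hdF i
    have h2 := hF.abs_add_one_le d' hdF' i
    have h3 := abs_sub (d' i) (d i)
    have h4 : |e i| = |d' i - d i| := by
      rw [he, Pi.smul_apply, smul_eq_mul, abs_mul]
      rcases Int.units_eq_one_or s with rfl | rfl <;> simp
    omega
  have hereal : Realizes v a.1 e := by
    rw [he, ← hs, ← hpos]
    exact hreal.reroot hreal'
  have hepos : position v a.1 e = a.1 := by
    rw [he, ← hs]
    nth_rewrite 1 [← hpos]
    rw [position_reroot hreal hreal', hpos']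
  have he0 : e = 0 := by
    rcases hereal.sum_eq with hsum | hsum
    · rw [position, hsum, add_zero, one_smul, add_eq_left] at hepos
      exact hgen.eq_zero_of_comb_eq_zero (T := T) (by omega) heT he8 hepos
    · have h1 : comb v e = -((2 : ℤ) • a.1) := by
        rw [position, hsum] at hepos
        funext j
        have := congrFun hepos j
        simp at this ⊢
        omega
      have h2 := hereal.norm_eq
      rw [h1, hsum] at h2
      rcases hgen.eq_zero_or_of_odd_closed_path (T := T) (by omega) heT he8 (by
        rw [h1]
        simp only [dotProduct_add, add_dotProduct, dotProduct_neg, neg_dotProduct,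
          dotProduct_smul, smul_dotProduct, smul_eq_mul] at h2 ⊢
        linarith) with h3 | ⟨i, h3⟩
      · exact h3
      · rw [h3] at hereal
        exact absurd hereal (not_realizes_neg_two (fun k h => a.2 ⟨k, h.symm⟩) i)
  have hdd : d = d' := by
    rw [he] at he0
    have := (smul_eq_zero.1 he0).resolve_left (Units.ne_zero s)
    exact (sub_eq_zero.1 this).symm
  have hss : s = s' := by
    apply Units.ext
    rw [← hs, ← hs', hdd]
  refine ⟨hss, ?_⟩
  rw [hd, hd', hss] at hdd
  exact smul_right_injective _ (Units.ne_zero s') hdd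

end Labels

/-! ### Monic factors of products of linear and rootless quadratic polynomials. -/

section Factors

open Polynomial

variable {R : Type*} [CommRing R]

theorem exists_eq_X_sub_C_of_monic_natDegree_one {f : R[X]} (hf : f.Monic)
    (h : f.natDegree = 1) : ∃ w, f = X - C w :=
  ⟨-f.coeff 0, by rw [C_neg, sub_neg_eq_add]; exact hf.eq_X_add_C h⟩

variable [IsDomain R]

theorem eq_of_mul_eq_linear_mul {v : R} {q f g : R[X]} (hroot : ∀ w, q.eval w ≠ 0)
    (hf : f.Monic) (hf1 : f.natDegree = 1) (h : f * g = (X - C v) * q) : f = X - C v ∧ g = q := by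
  obtain ⟨w, rfl⟩ := exists_eq_X_sub_C_of_monic_natDegree_one hf hf1
  have h1 := congrArg (eval w) h
  simp only [eval_mul, eval_sub, eval_X, eval_C, sub_self, zero_mul] at h1
  have h2 : w = v := sub_eq_zero.1 ((mul_eq_zero.1 h1.symm).resolve_right (hroot w))
  subst h2
  exact ⟨rfl, mul_left_cancel₀ (X_sub_C_ne_zero w) h⟩

theorem eq_linear_of_mul_eq {u v : R} {q f g : R[X]} (hroot : ∀ w, q.eval w ≠ 0)
    (hf : f.Monic) (hf1 : f.natDegree = 1) (h : f * g = (X - C u) * (X - C v) * q) :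
    f = X - C u ∨ f = X - C v := by
  obtain ⟨w, rfl⟩ := exists_eq_X_sub_C_of_monic_natDegree_one hf hf1
  have h1 := congrArg (eval w) h
  simp only [eval_mul, eval_sub, eval_X, eval_C, sub_self, zero_mul] at h1
  rcases mul_eq_zero.1 ((mul_eq_zero.1 h1.symm).resolve_right (hroot w)) with h2 | h2
  · left; rw [sub_eq_zero.1 h2]
  · right; rw [sub_eq_zero.1 h2]

theorem eq_quadratic_of_mul_eq {u v : R} {q f g : R[X]} (hroot : ∀ w, q.eval w ≠ 0)
    (hf : f.Monic) (hg : g.Monic) (hf2 : f.natDegree = 2) (hg2 : g.natDegree = 2)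
    (h : f * g = (X - C u) * (X - C v) * q) : f = (X - C u) * (X - C v) ∨ f = q := by
  have hlin : ∀ p : R[X], p.Monic → p.natDegree = 2 → p.eval u = 0 →
      ∃ p₁ : R[X], p = (X - C u) * p₁ ∧ p₁.Monic ∧ p₁.natDegree = 1 := by
    intro p hp hp2 hu
    obtain ⟨p₁, rfl⟩ := dvd_iff_isRoot.2 hu
    have h1 : p₁.Monic := (monic_X_sub_C u).of_mul_monic_left hp
    refine ⟨p₁, rfl, h1, ?_⟩
    rw [(monic_X_sub_C u).natDegree_mul h1, natDegree_X_sub_C] at hp2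
    omega
  have h1 := congrArg (eval u) h
  simp only [eval_mul, eval_sub, eval_X, eval_C, sub_self, zero_mul] at h1
  rcases mul_eq_zero.1 h1 with h2 | h2
  · left
    obtain ⟨f₁, rfl, h3, h4⟩ := hlin f hf hf2 h2
    rw [mul_assoc, mul_assoc] at h
    rw [(eq_of_mul_eq_linear_mul hroot h3 h4 (mul_left_cancel₀ (X_sub_C_ne_zero u) h)).1]
  · right
    obtain ⟨g₁, rfl, h3, h4⟩ := hlin g hg hg2 h2
    rw [mul_left_comm, mul_assoc] at h
    have h5 := mul_left_cancel₀ (X_sub_C_ne_zero u) h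
    rw [mul_comm] at h5
    exact (eq_of_mul_eq_linear_mul hroot h3 h4 h5).2

/-- The right side is (4X - 2)² - 3. A square would factor the constant 3 into two constants with
sum 8X - 4. -/
theorem sq_ne_discriminant (S : ℂ[X]) : S ^ 2 ≠ 1 - 16 * X * (1 - X) := by
  intro h
  have h1 : (C 4 * X - C 2 - S) * (C 4 * X - C 2 + S) = C 3 := by
    have e1 : (C 4 : ℂ[X]) = 4 := rfl
    have e2 : (C 2 : ℂ[X]) = 2 := rfl
    have e3 : (C 3 : ℂ[X]) = 3 := rfl
    rw [e1, e2, e3]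
    linear_combination -h
  have h2 : IsUnit (C 3 : ℂ[X]) := isUnit_C.2 (isUnit_iff_ne_zero.2 (by norm_num))
  rw [← h1] at h2
  have h3 := natDegree_eq_zero_of_isUnit (isUnit_of_mul_isUnit_left h2)
  have h4 := natDegree_eq_zero_of_isUnit (isUnit_of_mul_isUnit_right h2)
  obtain ⟨x, hx⟩ := natDegree_eq_zero.1 h3
  obtain ⟨y, hy⟩ := natDegree_eq_zero.1 h4
  have h5 : (C (x + y) : ℂ[X]).coeff 1 = (C 8 * X - C 4 : ℂ[X]).coeff 1 := by
    rw [C_add, hx, hy]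
    congr 1
    have e1 : (C 4 : ℂ[X]) = 4 := rfl
    have e2 : (C 2 : ℂ[X]) = 2 := rfl
    have e3 : (C 8 : ℂ[X]) = 8 := rfl
    rw [e1, e2, e3]
    ring
  simp [coeff_C] at h5

end Factors

/-! ### Irreducibility for the labels of a monotone path. -/

section MonotonePath

open Polynomial

/-- The characteristic polynomial of the path matrix with base point `l` and steps `x + y`,
`y + z`, `z + x`. -/
def pathPoly {R : Type*} [CommRing R] (l x y z : R) : R[X] :=
  (X - C l) * (X - C (l + x + y)) * (X - C (l + x + 2 * y + z)) *
    (X - C (l + 2 * x + 2 * y + 2 * z)) +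
  C (4 * (x * y)) * ((X - C (l + x + 2 * y + z)) * (X - C (l + 2 * x + 2 * y + 2 * z))) +
  C (4 * (y * z)) * ((X - C l) * (X - C (l + 2 * x + 2 * y + 2 * z))) +
  C (4 * (z * x)) * ((X - C l) * (X - C (l + x + y))) +
  C (16 * (x * y * (z * x)))

theorem pathPoly_map {R R' : Type*} [CommRing R] [CommRing R'] (f : R →+* R') (l x y z : R) :
    (pathPoly l x y z).map f = pathPoly (f l) (f x) (f y) (f z) := by
  simp only [pathPoly, Polynomial.map_add, Polynomial.map_mul, Polynomial.map_sub, Polynomial.map_X,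
    Polynomial.map_C, map_add f, map_mul f, map_ofNat f]

/-- A quadratic factor of the restriction of `pathPoly` to a coordinate plane. -/
def planeQuadratic (a b : ℂ[X]) : ℂ[X][X] :=
  (X - C a) * (X - C b) + C (4 * (X * (1 - X)))

/-- With b - a = 1 the discriminant is 1 - 16X(1 - X), which is not a square. -/
theorem planeQuadratic_eval_ne_zero {a b : ℂ[X]} (h : b - a = 1) (w : ℂ[X]) :
    (planeQuadratic a b).eval w ≠ 0 := by
  intro h0
  simp only [planeQuadratic, eval_add, eval_mul, eval_sub, eval_X, eval_C] at h0
  refine sq_ne_discriminant (2 * w - a - b) ?_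
  linear_combination 4 * h0 + (b - a + 1) * h

/-- For x = 0 both edges with a factor x disappear, and the matrix splits into two single entries
and one block of size two. The planes of y and z behave in the same way. -/
theorem pathPoly_plane_x (l : ℂ[X]) : pathPoly l 0 X (1 - X) =
    (X - C l) * (X - C (l + 2)) * planeQuadratic (l + X) (l + X + 1) := by
  simp only [pathPoly, planeQuadratic, map_add, map_mul, map_sub, map_zero, map_one, map_ofNat]
  ring

theorem pathPoly_plane_z (l : ℂ[X]) : pathPoly l (1 - X) X 0 =
    (X - C (l + X + 1)) * (X - C (l + 2)) * planeQuadratic l (l + 1) := by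
  simp only [pathPoly, planeQuadratic, map_add, map_mul, map_sub, map_zero, map_one, map_ofNat]
  ring

theorem pathPoly_plane_y (l : ℂ[X]) : pathPoly l X 0 (1 - X) =
    (X - C l) * (X - C (l + X)) * planeQuadratic (l + 1) (l + 2) := by
  simp only [pathPoly, planeQuadratic, map_add, map_mul, map_sub, map_zero, map_one, map_ofNat]
  ring

variable {m : ℕ}

/-- The monomial `ε X_i`. -/
def unitMulX (ε : ℤˣ) (i : Fin m) : MvPolynomial (Fin m) ℂ :=
  ((ε : ℤ) : MvPolynomial (Fin m) ℂ) * MvPolynomial.X i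

/-- The restriction of polynomials to the line joining two points. -/
def lineHom (a b : Fin m → ℂ) : MvPolynomial (Fin m) ℂ →+* ℂ[X] :=
  (MvPolynomial.aeval fun t => C (a t) * X + C (b t) * (1 - X) :
    MvPolynomial (Fin m) ℂ →ₐ[ℂ] ℂ[X]).toRingHom

theorem lineHom_X (a b : Fin m → ℂ) (t : Fin m) :
    lineHom a b (MvPolynomial.X t) = C (a t) * X + C (b t) * (1 - X) := by
  simp [lineHom]

theorem eval_one_lineHom (a b : Fin m → ℂ) (p : MvPolynomial (Fin m) ℂ) :
    (lineHom a b p).eval 1 = MvPolynomial.eval a p := by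
  have : (evalRingHom 1).comp (lineHom a b) = MvPolynomial.eval a := by
    apply MvPolynomial.ringHom_ext
    · intro c
      simp [lineHom]
    · intro t
      simp [lineHom_X]
  exact RingHom.congr_fun this p

theorem eval_zero_lineHom (a b : Fin m → ℂ) (p : MvPolynomial (Fin m) ℂ) :
    (lineHom a b p).eval 0 = MvPolynomial.eval b p := by
  have : (evalRingHom 0).comp (lineHom a b) = MvPolynomial.eval b := by
    apply MvPolynomial.ringHom_ext
    · intro c
      simp [lineHom]
    · intro t
      simp [lineHom_X]
  exact RingHom.congr_fun this p

/-- The points px, py, pz are those where one of the signed variables x, y, z is 1 and the other two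
are 0. On the lines joining them the polynomial splits into two linear factors and a rootless
quadratic; the restrictions of a factor of degree 1 or 2 would have to agree at the common points,
and none do. -/
theorem irreducible_pathPoly {i j k : Fin m} (hij : i ≠ j) (hjk : j ≠ k) (hik : i ≠ k)
    (α β γ : ℤˣ) (l : MvPolynomial (Fin m) ℂ)
    (hmonic : (pathPoly l (unitMulX α i) (unitMulX β j)
      (unitMulX γ k)).Monic)
    (hdeg : (pathPoly l (unitMulX α i) (unitMulX β j)
      (unitMulX γ k)).natDegree = 4) :
    Irreducible (pathPoly l (unitMulX α i) (unitMulX β j)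
      (unitMulX γ k)) := by
  obtain ⟨px, hpx⟩ : ∃ px : Fin m → ℂ, px = Pi.single i ((α : ℤ) : ℂ) := ⟨_, rfl⟩
  obtain ⟨py, hpy⟩ : ∃ py : Fin m → ℂ, py = Pi.single j ((β : ℤ) : ℂ) := ⟨_, rfl⟩
  obtain ⟨pz, hpz⟩ : ∃ pz : Fin m → ℂ, pz = Pi.single k ((γ : ℤ) : ℂ) := ⟨_, rfl⟩
  have hu : ∀ ε : ℤˣ, ((ε : ℤ) : ℂ[X]) * ((ε : ℤ) : ℂ[X]) = 1 := by
    intro ε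
    rw [← Int.cast_mul, Int.units_coe_mul_self, Int.cast_one]
  have hline : ∀ (a b : Fin m → ℂ) (ε : ℤˣ) (t : Fin m),
      lineHom a b (unitMulX ε t) = ((ε : ℤ) : ℂ[X]) * (C (a t) * X + C (b t) * (1 - X)) := by
    intro a b ε t
    rw [unitMulX, map_mul, map_intCast, lineHom_X]
  have hPx : (pathPoly l (unitMulX α i) (unitMulX β j)
      (unitMulX γ k)).map (lineHom py pz) =
      pathPoly (lineHom py pz l) 0 X (1 - X) := by
    rw [pathPoly_map, hline, hline, hline, hpy, hpz]
    congr 1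
    · simp [hij, hik]
    · simp [hjk, ← mul_assoc, hu]
    · simp [hjk.symm, ← mul_assoc, hu]
  have hPz : (pathPoly l (unitMulX α i) (unitMulX β j)
      (unitMulX γ k)).map (lineHom py px) =
      pathPoly (lineHom py px l) (1 - X) X 0 := by
    rw [pathPoly_map, hline, hline, hline, hpy, hpx]
    congr 1
    · simp [hij, ← mul_assoc, hu]
    · simp [hij.symm, ← mul_assoc, hu]
    · simp [hjk.symm, hik.symm]
  have hPy : (pathPoly l (unitMulX α i) (unitMulX β j)
      (unitMulX γ k)).map (lineHom px pz) =
      pathPoly (lineHom px pz l) X 0 (1 - X) := by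
    rw [pathPoly_map, hline, hline, hline, hpx, hpz]
    congr 1
    · simp [hik, ← mul_assoc, hu]
    · simp [hjk, hij.symm]
    · simp [hik.symm, ← mul_assoc, hu]
  rw [pathPoly_plane_x] at hPx
  rw [pathPoly_plane_z] at hPz
  rw [pathPoly_plane_y] at hPy
  have hqx := planeQuadratic_eval_ne_zero
    (add_sub_cancel_left (lineHom py pz l + X) 1)
  have hqz := planeQuadratic_eval_ne_zero (add_sub_cancel_left (lineHom py px l) 1)
  have hqy := planeQuadratic_eval_ne_zero
    (show lineHom px pz l + 2 - (lineHom px pz l + 1) = 1 by ring)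
  rw [hmonic.irreducible_iff_natDegree']
  refine ⟨fun h => by rw [h, natDegree_one] at hdeg; omega, ?_⟩
  intro g f hg hf hfg hmem
  rw [hdeg, Finset.mem_Ioc] at hmem
  have hdegfg : g.natDegree + f.natDegree = 4 := by rw [← hg.natDegree_mul hf, hfg, hdeg]
  have hfactor : ∀ φ : MvPolynomial (Fin m) ℂ →+* ℂ[X], f.map φ * g.map φ =
      (pathPoly l (unitMulX α i) (unitMulX β j)
      (unitMulX γ k)).map φ := by
    intro φ
    rw [← Polynomial.map_mul, mul_comm, hfg]
  have hx := (hfactor _).trans hPx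
  have hz := (hfactor _).trans hPz
  have hy := (hfactor _).trans hPy
  obtain ⟨L, hL⟩ : ∃ L, L = MvPolynomial.eval py l := ⟨_, rfl⟩
  obtain ⟨L', hL'⟩ : ∃ L', L' = MvPolynomial.eval pz l := ⟨_, rfl⟩
  have hcases : f.natDegree = 1 ∨ f.natDegree = 2 := by omega
  rcases hcases with hd | hd
  · have hd' : ∀ φ : MvPolynomial (Fin m) ℂ →+* ℂ[X], (f.map φ).natDegree = 1 := fun φ => by
      rw [hf.natDegree_map, hd]
    obtain ⟨w, rfl⟩ := exists_eq_X_sub_C_of_monic_natDegree_one hf hd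
    have hX : ∀ (φ : MvPolynomial (Fin m) ℂ →+* ℂ[X]) (u : ℂ[X]),
        (X - C w : (MvPolynomial (Fin m) ℂ)[X]).map φ = X - C u → φ w = u := by
      intro φ u h
      rw [Polynomial.map_sub, Polynomial.map_X, Polynomial.map_C, sub_right_inj] at h
      exact C_injective h
    have h1 := (eq_linear_of_mul_eq hqx (hf.map _) (hd' _) hx).imp (hX _ _) (hX _ _)
    have h2 := (eq_linear_of_mul_eq hqz (hf.map _) (hd' _) hz).imp (hX _ _) (hX _ _)
    have h3 := (eq_linear_of_mul_eq hqy (hf.map _) (hd' _) hy).imp (hX _ _) (hX _ _)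
    -- At py both admissible roots on the line to px equal L + 2. On the line to pz this selects the
    -- root l + 2, hence the value L' + 2 at pz; the line from px to pz allows only L' there.
    have e2 : MvPolynomial.eval py w = L + 2 := by
      rw [← eval_one_lineHom py px w]
      rcases h2 with h | h <;> rw [h] <;> simp [eval_one_lineHom, ← hL]
      ring
    have e1 : MvPolynomial.eval pz w = L' + 2 := by
      rcases h1 with h | h
      · have e3 := eval_one_lineHom py pz w
        rw [h, e2, eval_one_lineHom, ← hL] at e3
        simp at e3
      · rw [← eval_zero_lineHom py pz w, h]
        simp [eval_zero_lineHom, ← hL']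
    have e3 : MvPolynomial.eval pz w = L' := by
      rw [← eval_zero_lineHom px pz w]
      rcases h3 with h | h <;> rw [h] <;> simp [eval_zero_lineHom, ← hL']
    rw [e1] at e3
    simp at e3
  · have hd' : ∀ φ : MvPolynomial (Fin m) ℂ →+* ℂ[X], (f.map φ).natDegree = 2 := fun φ => by
      rw [hf.natDegree_map, hd]
    have hdg : ∀ φ : MvPolynomial (Fin m) ℂ →+* ℂ[X], (g.map φ).natDegree = 2 := fun φ => by
      rw [hg.natDegree_map]
      omega
    have h1 := eq_quadratic_of_mul_eq hqx (hf.map _) (hg.map _) (hd' _) (hdg _) hx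
    have h2 := eq_quadratic_of_mul_eq hqz (hf.map _) (hg.map _) (hd' _) (hdg _) hz
    have hev : ∀ (b : Fin m → ℂ) (t : ℂ), ((f.map (lineHom py b)).eval (C t)).eval 1 =
        (f.map (MvPolynomial.eval py)).eval t := by
      intro b t
      rw [eval_map, eval_map, ← coe_evalRingHom, hom_eval₂]
      congr 1
      · exact RingHom.ext fun p => eval_one_lineHom py b p
      · simp
    -- At py the two lines leave the candidates (t-L)(t-L-2), (t-L-1)(t-L-2) and (t-L-2)²,
    -- (t-L)(t-L-1). The values at t = L and t = L + 2 separate them.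
    have e0 := (hev pz L).trans (hev px L).symm
    have e2 := (hev pz (L + 2)).trans (hev px (L + 2)).symm
    rcases h1 with h1 | h1 <;> rcases h2 with h2 | h2 <;> rw [h1, h2] at e0 e2 <;>
      simp [planeQuadratic, eval_one_lineHom, ← hL] at e0 e2 <;>
      first
        | (norm_num at e2; done)
        | (ring_nf at e0; norm_num at e0)

theorem charpoly_fin_four_of_tridiagonal {R : Type*} [CommRing R] (N : Matrix (Fin 4) (Fin 4) R)
    (h02 : N 0 2 = 0) (h20 : N 2 0 = 0) (h03 : N 0 3 = 0) (h30 : N 3 0 = 0) (h13 : N 1 3 = 0)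
    (h31 : N 3 1 = 0) :
    N.charpoly = (X - C (N 0 0)) * (X - C (N 1 1)) * (X - C (N 2 2)) * (X - C (N 3 3)) -
      C (N 0 1 * N 1 0) * ((X - C (N 2 2)) * (X - C (N 3 3))) -
      C (N 1 2 * N 2 1) * ((X - C (N 0 0)) * (X - C (N 3 3))) -
      C (N 2 3 * N 3 2) * ((X - C (N 0 0)) * (X - C (N 1 1))) +
      C (N 0 1 * N 1 0 * (N 2 3 * N 3 2)) := by
  rw [Matrix.charpoly, Matrix.det_succ_row_zero]
  simp [Fin.sum_univ_succ, Matrix.det_fin_three, Matrix.charmatrix_apply, Fin.succAbove,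
    Matrix.diagonal_apply, h02, h20, h03, h30, h13, h31]
  ring
-- The monomials of the two opposite entries multiply to X_i X_j, and the product of the signs of
-- the ends is -αβ: it is 1 on black edges, where α = -β, and -1 on red ones.
theorem labelMatrix_mul_symm {ι Λ : Type*} [CommRing Λ] {δ : ι → Fin m → ℤ} {a b : ι} (hab : a ≠ b)
    {i j : Fin m} (hij : i ≠ j) {α β : ℤˣ}
    (h : δ b = δ a + Pi.single i (α : ℤ) + Pi.single j (β : ℤ))
    (ha : IsUnit (1 + ∑ k, δ a k)) (hb : IsUnit (1 + ∑ k, δ b k)) :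
    labelMatrix Λ δ a b * labelMatrix Λ δ b a =
      - (4 * ((((α : ℤ) : MvPolynomial (Fin m) Λ) * MvPolynomial.X i) *
        (((β : ℤ) : MvPolynomial (Fin m) Λ) * MvPolynomial.X j))) := by
  have hadj : Adjacent (δ a) (δ b) := ⟨i, j, hij, α, β, h⟩
  rw [labelMatrix, labelMatrix, if_neg hab, if_neg hab.symm, if_pos hadj, if_pos hadj.symm]
  have hprod : (∏ k, (MvPolynomial.X k : MvPolynomial (Fin m) Λ) ^ (δ a k - δ b k).toNat) *
      ∏ k, MvPolynomial.X k ^ (δ b k - δ a k).toNat = MvPolynomial.X i * MvPolynomial.X j := by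
    rw [← Finset.prod_mul_distrib, ← Finset.prod_subset (Finset.subset_univ {i, j}),
      Finset.prod_pair hij]
    · congr 1 <;> rw [← pow_add] <;> conv_rhs => rw [← pow_one (MvPolynomial.X _)]
      · congr 1
        rw [h]
        rcases Int.units_eq_one_or α with rfl | rfl <;> simp [hij]
      · congr 1
        rw [h]
        rcases Int.units_eq_one_or β with rfl | rfl <;> simp [hij.symm]
    · intro k _ hk
      simp only [Finset.mem_insert, Finset.mem_singleton, not_or] at hk
      rw [h]
      simp [hk.1, hk.2]
  have hsum : 1 + ∑ k, δ b k = 1 + ∑ k, δ a k + α + β := by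
    rw [h]
    simp [Finset.sum_add_distrib]
    ring
  have hsign : (1 + ∑ k, δ b k) * (1 + ∑ k, δ a k) = - (α * β : ℤ) := by
    rw [hsum] at hb ⊢
    rw [Int.isUnit_iff] at ha hb
    generalize 1 + ∑ k, δ a k = s at *
    rcases Int.units_eq_one_or α with rfl | rfl <;> rcases Int.units_eq_one_or β with rfl | rfl <;>
      rcases ha with rfl | rfl <;> simp at hb ⊢
  have hsign' := congrArg (Int.cast : ℤ → MvPolynomial (Fin m) Λ) hsign
  push_cast at hsign' ⊢
  linear_combination (4 * (((∏ k, (MvPolynomial.X k : MvPolynomial (Fin m) Λ) ^ (δ a k - δ b k).toNat) *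
      ∏ k, MvPolynomial.X k ^ (δ b k - δ a k).toNat))) * hsign' - 4 * α * β * hprod

theorem Adjacent.abs_sub_le {a b : Fin m → ℤ} (h : Adjacent a b) (k : Fin m) :
    |b k - a k| ≤ 1 := by
  obtain ⟨i, j, hij, ε, ε', rfl⟩ := h
  simp only [Pi.add_apply, Pi.single_apply]
  rcases Int.units_eq_one_or ε with rfl | rfl <;> rcases Int.units_eq_one_or ε' with rfl | rfl <;>
    split_ifs with h1 h2 h2 <;> first | (exact absurd (h1.symm.trans h2) hij) | simp
theorem MonotonePath.apply_eq {i j k : Fin m} {α β γ : ℤˣ} {a b c d : Fin m → ℤ}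
    (h : MonotonePath i j k α β γ a b c d) :
    (b i = a i + α ∧ c i = a i + α ∧ d i = a i + 2 * α) ∧
    (b j = a j + β ∧ c j = a j + 2 * β ∧ d j = a j + 2 * β) ∧
    (b k = a k ∧ c k = a k + γ ∧ d k = a k + 2 * γ) := by
  obtain ⟨hij, hjk, hik, hb, hc, hd⟩ := h
  simp only [hd, hc, hb, Pi.add_apply, Pi.single_apply, hij, hij.symm, hjk, hjk.symm, hik,
    hik.symm, if_true, if_false]
  refine ⟨⟨?_, ?_, ?_⟩, ⟨?_, ?_, ?_⟩, ?_, ?_, ?_⟩ <;> ring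

theorem MonotonePath.injective {i j k : Fin m} {α β γ : ℤˣ} {a b c d : Fin m → ℤ}
    (h : MonotonePath i j k α β γ a b c d) : Function.Injective ![a, b, c, d] := by
  obtain ⟨⟨h1, h2, h3⟩, ⟨h4, h5, h6⟩, h7, h8, h9⟩ := h.apply_eq
  have hα := Int.isUnit_iff.1 α.isUnit
  have hβ := Int.isUnit_iff.1 β.isUnit
  have hγ := Int.isUnit_iff.1 γ.isUnit
  intro s t hst
  have hi := congrFun hst i
  have hj := congrFun hst j
  have hk := congrFun hst k
  fin_cases s <;> fin_cases t <;> simp at hi hj hk ⊢ <;> omega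

theorem irreducible_charpoly_of_monotonePath {i j k : Fin m} {α β γ : ℤˣ} {a b c d : Fin m → ℤ}
    (h : MonotonePath i j k α β γ a b c d) (hs : ∀ s, IsUnit (1 + ∑ t, ![a, b, c, d] s t)) :
    Irreducible (labelMatrix ℂ ![a, b, c, d]).charpoly := by
  obtain ⟨hij, hjk, hik, hb, hc, hd⟩ := id h
  obtain ⟨δ, hδ⟩ : ∃ δ, δ = ![a, b, c, d] := ⟨_, rfl⟩
  have h0 : δ 0 = a := by rw [hδ]; rfl
  have h1 : δ 1 = b := by rw [hδ]; rfl
  have h2 : δ 2 = c := by rw [hδ]; rfl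
  have h3 : δ 3 = d := by rw [hδ]; rfl
  rw [← hδ] at hs ⊢
  -- Non-consecutive labels of a monotone path differ by 2 in some entry and are not adjacent, so
  -- the matrix is tridiagonal.
  have hzero : ∀ s t, s ≠ t → (∃ u, 1 < |δ t u - δ s u|) →
      labelMatrix ℂ δ s t = 0 ∧ labelMatrix ℂ δ t s = 0 := by
    rintro s t hst ⟨u, hu⟩
    have hn : ¬ Adjacent (δ s) (δ t) := fun hadj => absurd (hadj.abs_sub_le u) (not_le.2 hu)
    rw [labelMatrix, labelMatrix, if_neg hst, if_neg hst.symm, if_neg hn,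
      if_neg fun hadj => hn hadj.symm]
    exact ⟨rfl, rfl⟩
  obtain ⟨⟨-, -, hi⟩, ⟨-, hj, -⟩, hk, -, hk'⟩ := h.apply_eq
  have htwo : ∀ (ε : ℤˣ) (x : ℤ), 1 < |x + 2 * ε - x| := fun ε x => by
    rcases Int.units_eq_one_or ε with rfl | rfl <;> simp
  have hz02 := hzero 0 2 (by decide) ⟨j, by rw [h0, h2, hj]; exact htwo β _⟩
  have hz13 := hzero 1 3 (by decide) ⟨k, by rw [h1, h3, hk', hk]; exact htwo γ _⟩
  have hz03 := hzero 0 3 (by decide) ⟨i, by rw [h0, h3, hi]; exact htwo α _⟩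
  have hm01 := labelMatrix_mul_symm (Λ := ℂ) (show (0 : Fin 4) ≠ 1 by decide) hij
    (by rw [h0, h1]; exact hb) (hs 0) (hs 1)
  have hm12 := labelMatrix_mul_symm (Λ := ℂ) (show (1 : Fin 4) ≠ 2 by decide) hjk
    (by rw [h1, h2]; exact hc) (hs 1) (hs 2)
  have hm23 := labelMatrix_mul_symm (Λ := ℂ) (show (2 : Fin 4) ≠ 3 by decide) hik.symm
    (by rw [h2, h3]; exact hd) (hs 2) (hs 3)
  obtain ⟨l, hl⟩ : ∃ l : MvPolynomial (Fin m) ℂ, l = labelMatrix ℂ δ 0 0 := ⟨_, rfl⟩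
  have hdiag : ∀ s, labelMatrix ℂ δ s s =
      ∑ t, ((δ s t : ℤ) : MvPolynomial (Fin m) ℂ) * MvPolynomial.X t := fun s => by
    rw [labelMatrix, if_pos rfl]
  have hsingle : ∀ (t : Fin m) (ε : ℤˣ),
      ∑ u, (((Pi.single t (ε : ℤ) : Fin m → ℤ) u : ℤ) : MvPolynomial (Fin m) ℂ) *
        MvPolynomial.X u = unitMulX ε t := by
    intro t ε
    rw [Finset.sum_eq_single t (fun u _ hu => by simp [hu]) (by simp), Pi.single_eq_same, unitMulX]
  have hstep : ∀ s t p q (ε ε' : ℤˣ),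
      δ t = δ s + Pi.single p (ε : ℤ) + Pi.single q (ε' : ℤ) →
      labelMatrix ℂ δ t t = labelMatrix ℂ δ s s + unitMulX ε p + unitMulX ε' q := by
    intro s t p q ε ε' h
    rw [hdiag, hdiag, ← hsingle, ← hsingle, ← Finset.sum_add_distrib, ← Finset.sum_add_distrib, h]
    refine Finset.sum_congr rfl fun u _ => ?_
    simp only [Pi.add_apply]
    push_cast
    ring
  have hl1 := hstep 0 1 i j α β (by rw [h0, h1]; exact hb)
  have hl2 := hstep 1 2 j k β γ (by rw [h1, h2]; exact hc)
  have hl3 := hstep 2 3 k i γ α (by rw [h2, h3]; exact hd)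
  have hpoly : (labelMatrix ℂ δ).charpoly =
      pathPoly l (unitMulX α i) (unitMulX β j) (unitMulX γ k) := by
    rw [charpoly_fin_four_of_tridiagonal _ hz02.1 hz02.2 hz03.1 hz03.2 hz13.1 hz13.2, hm01, hm12,
      hm23, hl3, hl2, hl1, ← hl]
    simp only [pathPoly, unitMulX, map_add, map_mul, map_neg, map_ofNat]
    ring
  rw [hpoly]
  apply irreducible_pathPoly hij hjk hik
  · rw [← hpoly]
    exact Matrix.charpoly_monic _
  · rw [← hpoly, Matrix.charpoly_natDegree_eq_dim, Fintype.card_fin]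

theorem labelMatrix_charpoly_comp_equiv {ι ι' Λ : Type*} [CommRing Λ] [Fintype ι] [DecidableEq ι]
    [Fintype ι'] [DecidableEq ι'] (δ : ι → Fin m → ℤ) (e : ι' ≃ ι) :
    (labelMatrix Λ (δ ∘ e)).charpoly = (labelMatrix Λ δ).charpoly := by
  rw [← Matrix.charpoly_reindex e]
  congr 1
  ext1 s t
  obtain ⟨s, rfl⟩ := e.surjective s
  obtain ⟨t, rfl⟩ := e.surjective t
  simp only [Matrix.reindex_apply, Matrix.submatrix_apply, Equiv.symm_apply_apply]
  simp only [labelMatrix, Function.comp_apply, EmbeddingLike.apply_eq_iff_eq]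

/-- The characteristic polynomial of the label matrix of a component is irreducible. -/
theorem Cluster.irreducible_charpoly {n : ℕ} [NeZero n] {v : Fin m → Fin n → ℤ} {r : Fin n → ℤ}
    {F : Finset (Fin m → ℤ)} (hv : Function.Injective v) (hgen : IsGeneric (resonances n) v)
    (hr : ∀ k, r ≠ v k) (h : Cluster v r F) (hF : F.card ≤ 4) {ι : Type*} [Fintype ι]
    [DecidableEq ι] {δ : ι → Fin m → ℤ} (hδ : Function.Injective δ)
    (hrange : ∀ d, d ∈ F ↔ ∃ s, δ s = d) (hs : ∀ s, IsUnit (1 + ∑ t, δ s t)) :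
    Irreducible (labelMatrix ℂ δ).charpoly := by
  rcases h.incongruent_or_exists_monotonePath hv hgen hr hF with
    hinc | ⟨a, b, c, d, i, j, k, α, β, γ, hp, hmem⟩
  · obtain ⟨s₀, -⟩ := (hrange _).1 h.zero_mem
    have : Nonempty ι := ⟨s₀⟩
    apply irreducible_charpoly_labelMatrix
    · intro s h2
      exact absurd (isUnit_of_dvd_unit h2 (hs s)) (by decide)
    · intro s t hst
      have := hinc _ ((hrange _).2 ⟨s, rfl⟩) _ ((hrange _).2 ⟨t, rfl⟩) (hδ.ne hst)
      simpa only [Congruent, not_forall] using this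
    · intro S hS hSu
      obtain ⟨a, ha, b, hb, hbS, hab⟩ := h.exists_adjacent (S.image δ)
        (fun d hd => by
          obtain ⟨s, -, rfl⟩ := Finset.mem_image.1 hd
          exact (hrange _).2 ⟨s, rfl⟩)
        (hS.image δ)
        (fun hSF => hSu <| Finset.eq_univ_of_forall fun s => by
          have := (hrange _).2 ⟨s, rfl⟩
          rw [← hSF] at this
          exact hδ.mem_finset_image.1 this)
      obtain ⟨s, hs, rfl⟩ := Finset.mem_image.1 ha
      obtain ⟨t, rfl⟩ := (hrange _).1 hb
      exact ⟨s, hs, t, fun ht => hbS (Finset.mem_image_of_mem δ ht), hab⟩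
  · have hex : ∀ s : Fin 4, ∃ x, δ x = ![a, b, c, d] s := by
      intro s
      apply (hrange _).1
      rw [hmem]
      fin_cases s <;> simp
    choose f hf using hex
    have hbij : Function.Bijective f := by
      constructor
      · apply Function.Injective.of_comp (f := δ)
        have : δ ∘ f = ![a, b, c, d] := funext hf
        rw [this]
        exact hp.injective
      · intro x
        rcases (hmem _).1 ((hrange _).2 ⟨x, rfl⟩) with h | h | h | h
        · exact ⟨0, hδ ((hf 0).trans h.symm)⟩
        · exact ⟨1, hδ ((hf 1).trans h.symm)⟩
        · exact ⟨2, hδ ((hf 2).trans h.symm)⟩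
        · exact ⟨3, hδ ((hf 3).trans h.symm)⟩
    have hcomp : δ ∘ Equiv.ofBijective f hbij = ![a, b, c, d] := funext hf
    rw [← labelMatrix_charpoly_comp_equiv δ (Equiv.ofBijective f hbij), hcomp]
    apply irreducible_charpoly_of_monotonePath hp
    intro s
    rw [← hf]
    exact hs _

end MonotonePath

/-! ### Characteristic polynomials under conjugation and affine change. -/

section Charpoly

open Polynomial

theorem charpoly_eq_of_mul_eq {ι K : Type*} [Fintype ι] [DecidableEq ι] [CommRing K]
    {N M : Matrix ι ι K} (d : ι → K) (hd : ∀ a, IsUnit (d a))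
    (h : ∀ a b, N a b * d b = d a * M a b) : N.charpoly = M.charpoly := by
  have hu : IsUnit (Matrix.diagonal d) := by
    rw [Matrix.isUnit_iff_isUnit_det, Matrix.det_diagonal, IsUnit.prod_univ_iff]
    exact hd
  obtain ⟨U, hU⟩ := hu
  have h1 : N * U.val = U.val * M := by
    ext a b
    rw [hU, Matrix.mul_diagonal, Matrix.diagonal_mul, h]
  have h2 : N = U.val * M * U⁻¹.val := by
    rw [← h1, mul_assoc, Units.mul_inv, mul_one]
  rw [h2, Matrix.coe_units_inv]
  exact Matrix.charpoly_units_conj U M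

theorem charpoly_scalar_add_smul_comp {ι R : Type*} [Fintype ι] [DecidableEq ι] [CommRing R]
    (N : Matrix ι ι R) (c u : R) :
    (Matrix.scalar ι c + u • N).charpoly.comp (C u * X + C c) =
      C u ^ Fintype.card ι * N.charpoly := by
  rw [Matrix.charpoly, Matrix.charpoly, ← Matrix.det_smul, ← coe_compRingHom_apply,
    RingHom.map_det]
  congr 1
  ext1 a b
  rcases eq_or_ne a b with rfl | hab
  · simp
    ring
  · simp [hab]

/-- The substitution t ↦ ut + c is an automorphism when u is a unit, and it carries this polynomial
to a unit times the characteristic polynomial of N. -/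
theorem irreducible_charpoly_scalar_add_smul {ι R : Type*} [Fintype ι] [DecidableEq ι] [CommRing R]
    {N : Matrix ι ι R} (c u : R) [Invertible u] (h : Irreducible N.charpoly) :
    Irreducible (Matrix.scalar ι c + u • N).charpoly := by
  rw [← MulEquiv.irreducible_iff (algEquivCMulXAddC u c)]
  have h1 : algEquivCMulXAddC u c (Matrix.scalar ι c + u • N).charpoly =
      C u ^ Fintype.card ι * N.charpoly := by
    rw [← charpoly_scalar_add_smul_comp N c u]
    simp [algEquivCMulXAddC, comp, aeval_def]
  rw [h1, irreducible_isUnit_mul]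
  · exact h
  · exact ((isUnit_of_invertible u).map C).pow _

end Charpoly

/-! ### Components of the geometric graph and their labels. -/

section Blocks

variable {n m : ℕ} {v : Fin m → Fin n → ℤ}

theorem geomGraph_reachable_of_black {i j : Fin m} {a b : NormalSite v}
    (h : BlackEdge v i j a.1 b.1) : (geomGraph v).Reachable a b := by
  by_cases hab : a = b
  · rw [hab]
  · exact SimpleGraph.Adj.reachable
      ((SimpleGraph.fromRel_adj _ _ _).2 ⟨hab, Or.inl ⟨i, j, Or.inl h⟩⟩)

theorem geomGraph_reachable_of_red {i j : Fin m} {a b : NormalSite v}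
    (h : RedEdge v i j a.1 b.1) : (geomGraph v).Reachable a b := by
  by_cases hab : a = b
  · rw [hab]
  · exact SimpleGraph.Adj.reachable
      ((SimpleGraph.fromRel_adj _ _ _).2 ⟨hab, Or.inl ⟨i, j, Or.inr h⟩⟩)

theorem PathLabel.reachable {r a : NormalSite v} {s : ℤˣ} {L : Fin m → ℤ}
    (h : PathLabel v r a s L) : (geomGraph v).Reachable r a := by
  induction h with
  | nil => exact SimpleGraph.Reachable.refl _
  | black _ hb ih => exact ih.trans (geomGraph_reachable_of_black hb)
  | red _ hb ih => exact ih.trans (geomGraph_reachable_of_red hb)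

/-- The signed label of a normal site. -/
def signedLabel (R : Rooting v) (a : NormalSite v) : Fin m → ℤ := (R.sign a : ℤ) • R.form a

theorem Rooting.reachable_root (R : Rooting v) (a : NormalSite v) :
    (geomGraph v).Reachable (R.root a) a := (R.label a).reachable

theorem Rooting.root_eq_of_mem (R : Rooting v) {A : (geomGraph v).ConnectedComponent}
    {a b : NormalSite v} (ha : a ∈ A.supp) (hb : b ∈ A.supp) : R.root a = R.root b :=
  R.root_eq _ _ (SimpleGraph.ConnectedComponent.exact (ha.trans hb.symm))

theorem Rooting.injOn_signedLabel (R : Rooting v) {A : (geomGraph v).ConnectedComponent}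
    {a b : NormalSite v} (ha : a ∈ A.supp) (hb : b ∈ A.supp)
    (h : signedLabel R a = signedLabel R b) : a = b := by
  apply Subtype.ext
  rw [← (R.label a).position_eq, ← (R.label b).position_eq, R.root_eq_of_mem ha hb]
  exact congrArg (position v (R.root b).1) h

theorem Rooting.mem_pathLabels_iff (hn : n = 2 ∨ n = 3) (hv : Function.Injective v)
    (hgen : IsGeneric (resonances n) v) (R : Rooting v) {A : (geomGraph v).ConnectedComponent}
    {a : NormalSite v} (ha : a ∈ A.supp) (d : Fin m → ℤ) :
    d ∈ pathLabels v (R.root a) ↔ ∃ b : A.supp, signedLabel R b.1 = d := by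
  constructor
  · rintro ⟨b, s, L, hp, rfl⟩
    have hb : b ∈ A.supp := by
      have h1 := (R.reachable_root a).symm.trans hp.reachable
      have h2 := SimpleGraph.ConnectedComponent.sound h1
      rw [SimpleGraph.ConnectedComponent.mem_supp_iff] at ha ⊢
      rw [← h2, ha]
    refine ⟨⟨b, hb⟩, ?_⟩
    have h3 := R.label b
    rw [R.root_eq_of_mem hb ha] at h3
    obtain ⟨h4, h5⟩ := h3.unique hn hv hgen hp
    rw [signedLabel, h4, h5]
  · rintro ⟨b, rfl⟩
    refine ⟨b.1, R.sign b, R.form b, ?_, rfl⟩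
    rw [R.root_eq_of_mem ha b.2]
    exact R.label b

theorem Rooting.finite_supp (hn : n = 2 ∨ n = 3) (hv : Function.Injective v)
    (hgen : IsGeneric (resonances n) v) (R : Rooting v) (A : (geomGraph v).ConnectedComponent) :
    Finite A.supp := by
  obtain ⟨a, ha⟩ := A.nonempty_supp
  obtain ⟨F, hF, hcard, hFeq⟩ := exists_cluster_eq_pathLabels hn hv hgen (R.root a)
  have hmem : ∀ b : A.supp, signedLabel R b.1 ∈ F := by
    intro b
    rw [← Finset.mem_coe, hFeq, R.mem_pathLabels_iff hn hv hgen ha]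
    exact ⟨b, rfl⟩
  exact Finite.of_injective (fun b : A.supp => (⟨signedLabel R b.1, hmem b⟩ : F))
    fun b c hbc => Subtype.ext (R.injOn_signedLabel b.2 c.2 (congrArg Subtype.val hbc))

theorem Rooting.irreducible_charpoly (hn : n = 2 ∨ n = 3) (hv : Function.Injective v)
    (hgen : IsGeneric (resonances n) v) (R : Rooting v) (A : (geomGraph v).ConnectedComponent)
    [Fintype A.supp] [DecidableEq A.supp] :
    Irreducible (labelMatrix ℂ fun a : A.supp => signedLabel R a.1).charpoly := by
  have : NeZero n := ⟨by omega⟩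
  obtain ⟨a, ha⟩ := A.nonempty_supp
  obtain ⟨F, hF, hcard, hFeq⟩ := exists_cluster_eq_pathLabels hn hv hgen (R.root a)
  apply hF.irreducible_charpoly hv hgen (fun k h => (R.root a).2 ⟨k, h.symm⟩) hcard
  · exact fun b c hbc => Subtype.ext (R.injOn_signedLabel b.2 c.2 hbc)
  · intro d
    rw [← Finset.mem_coe, hFeq, R.mem_pathLabels_iff hn hv hgen ha]
  · intro b
    rw [show signedLabel R b.1 = (R.sign b.1 : ℤ) • R.form b.1 from rfl, (R.label b.1).one_add_sum]
    exact (R.sign b.1).isUnit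

/-- Since labels do not depend on the path, an edge forces its relation between the labels of its
ends. Conversely the conservation laws recover the edge from that relation. -/
theorem Rooting.black_iff (hn : n = 2 ∨ n = 3) (hv : Function.Injective v)
    (hgen : IsGeneric (resonances n) v) (R : Rooting v) {A : (geomGraph v).ConnectedComponent}
    {a b : NormalSite v} (ha : a ∈ A.supp) (hb : b ∈ A.supp) (i j : Fin m) :
    BlackEdge v i j a.1 b.1 ↔ i ≠ j ∧ R.sign b = R.sign a ∧
      R.form b = Pi.single j 1 - Pi.single i 1 + R.form a := by
  have h1 := R.label b
  rw [R.root_eq_of_mem hb ha] at h1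
  constructor
  · intro h
    obtain ⟨h2, h3⟩ := h1.unique hn hv hgen ((R.label a).black h)
    exact ⟨h.1, h2, h3⟩
  · rintro ⟨hij, h2, h3⟩
    obtain ⟨-, h4, h5⟩ := h1.invariants
    obtain ⟨-, h6, h7⟩ := (R.label a).invariants
    refine ⟨hij, ?_, ?_⟩
    · rw [h4, h6, h2, h3, comb_add, comb_sub, comb_single, comb_single, one_smul, one_smul]
      abel
    · rw [h5, h7, h2, h3, pairing_add, pairing_sub, pairing_single, pairing_single]
      simp only [Int.cast_one, one_mul]
      ring

theorem Rooting.red_iff (hn : n = 2 ∨ n = 3) (hv : Function.Injective v)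
    (hgen : IsGeneric (resonances n) v) (R : Rooting v) {A : (geomGraph v).ConnectedComponent}
    {a b : NormalSite v} (ha : a ∈ A.supp) (hb : b ∈ A.supp) (i j : Fin m) :
    RedEdge v i j a.1 b.1 ↔ i ≠ j ∧ R.sign b = - R.sign a ∧
      R.form b = Pi.single j 1 + Pi.single i 1 - R.form a := by
  have h1 := R.label b
  rw [R.root_eq_of_mem hb ha] at h1
  constructor
  · intro h
    obtain ⟨h2, h3⟩ := h1.unique hn hv hgen ((R.label a).red h)
    exact ⟨h.1, h2, h3⟩
  · rintro ⟨hij, h2, h3⟩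
    obtain ⟨-, h4, h5⟩ := h1.invariants
    obtain ⟨-, h6, h7⟩ := (R.label a).invariants
    refine ⟨hij, ?_, ?_⟩
    · rw [h4, h6, h2, h3, comb_sub, comb_add, comb_single, comb_single, one_smul, one_smul,
        Units.val_neg, neg_smul]
      abel
    · rw [h5, h7, h2, h3, pairing_sub, pairing_add, pairing_single, pairing_single, Units.val_neg]
      simp only [Int.cast_one, one_mul]
      ring

end Blocks

/-! ### Uniqueness of edges between two sites. -/

section Entries

variable {n m : ℕ} {v : Fin m → Fin n → ℤ}

theorem sum_sum_ite_eq {ι M : Type*} [Fintype ι] [AddCommMonoid M] {P : ι → ι → Prop}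
    {_ : ∀ i j, Decidable (P i j)} {i₀ j₀ : ι} (hP : ∀ i j, P i j ↔ i = i₀ ∧ j = j₀) (g : ι → ι → M) :
    (∑ i, ∑ j, if P i j then g i j else 0) = g i₀ j₀ := by
  rw [Finset.sum_eq_single i₀, Finset.sum_eq_single j₀]
  · rw [if_pos ((hP _ _).2 ⟨rfl, rfl⟩)]
  · intro j _ hj
    rw [if_neg fun h => hj ((hP _ _).1 h).2]
  · simp
  · intro i _ hi
    exact Finset.sum_eq_zero fun j _ => if_neg fun h => hi ((hP _ _).1 h).1
  · simp

theorem sum_sum_ite_eq_zero {ι M : Type*} [Fintype ι] [AddCommMonoid M] {P : ι → ι → Prop}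
    {_ : ∀ i j, Decidable (P i j)} (hP : ∀ i j, ¬ P i j) (g : ι → ι → M) :
    (∑ i, ∑ j, if P i j then g i j else 0) = 0 :=
  Finset.sum_eq_zero fun i _ => Finset.sum_eq_zero fun j _ => if_neg (hP i j)

theorem single_sub_single_eq {i j i' j' : Fin m} (hij' : i' ≠ j')
    (h : (Pi.single j' 1 - Pi.single i' 1 : Fin m → ℤ) = Pi.single j 1 - Pi.single i 1) :
    i' = i ∧ j' = j := by
  have h1 := congrFun h i'
  have h2 := congrFun h j'
  simp only [Pi.sub_apply, Pi.single_apply] at h1 h2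
  grind

theorem single_add_single_eq {i j i' j' : Fin m} (hij : i < j) (hij' : i' < j')
    (h : (Pi.single j' 1 + Pi.single i' 1 : Fin m → ℤ) = Pi.single j 1 + Pi.single i 1) :
    i' = i ∧ j' = j := by
  have h1 := congrFun h i'
  have h2 := congrFun h j'
  simp only [Pi.add_apply, Pi.single_apply] at h1 h2
  grind

theorem Rooting.black_unique (hn : n = 2 ∨ n = 3) (hv : Function.Injective v)
    (hgen : IsGeneric (resonances n) v) (R : Rooting v) {A : (geomGraph v).ConnectedComponent}
    {a b : NormalSite v} (ha : a ∈ A.supp) (hb : b ∈ A.supp) {i j : Fin m}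
    (h : BlackEdge v i j a.1 b.1) (i' j' : Fin m) :
    BlackEdge v i' j' a.1 b.1 ↔ i' = i ∧ j' = j := by
  constructor
  · intro h'
    obtain ⟨-, -, h1⟩ := (R.black_iff hn hv hgen ha hb i j).1 h
    obtain ⟨hij', -, h2⟩ := (R.black_iff hn hv hgen ha hb i' j').1 h'
    exact single_sub_single_eq hij' (add_right_cancel (h2.symm.trans h1))
  · rintro ⟨rfl, rfl⟩
    exact h

theorem Rooting.red_unique (hn : n = 2 ∨ n = 3) (hv : Function.Injective v)
    (hgen : IsGeneric (resonances n) v) (R : Rooting v) {A : (geomGraph v).ConnectedComponent}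
    {a b : NormalSite v} (ha : a ∈ A.supp) (hb : b ∈ A.supp) {i j : Fin m} (hlt : i < j)
    (h : RedEdge v i j a.1 b.1) (i' j' : Fin m) :
    (i' < j' ∧ RedEdge v i' j' a.1 b.1) ↔ i' = i ∧ j' = j := by
  constructor
  · rintro ⟨hlt', h'⟩
    obtain ⟨-, -, h1⟩ := (R.red_iff hn hv hgen ha hb i j).1 h
    obtain ⟨-, -, h2⟩ := (R.red_iff hn hv hgen ha hb i' j').1 h'
    exact single_add_single_eq hlt hlt' (sub_left_injective (h2.symm.trans h1))
  · rintro ⟨rfl, rfl⟩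
    exact ⟨hlt, h⟩

theorem Rooting.not_black_of_red (hn : n = 2 ∨ n = 3) (hv : Function.Injective v)
    (hgen : IsGeneric (resonances n) v) (R : Rooting v) {A : (geomGraph v).ConnectedComponent}
    {a b : NormalSite v} (ha : a ∈ A.supp) (hb : b ∈ A.supp) {i j : Fin m}
    (h : RedEdge v i j a.1 b.1) (i' j' : Fin m) : ¬ BlackEdge v i' j' a.1 b.1 := by
  intro h'
  have h1 := ((R.red_iff hn hv hgen ha hb i j).1 h).2.1
  rw [((R.black_iff hn hv hgen ha hb i' j').1 h').2.1] at h1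
  rcases Int.units_eq_one_or (R.sign a) with h2 | h2 <;> rw [h2] at h1 <;> exact absurd h1 (by decide)

theorem RedEdge.symm_marks {i j : Fin m} {a b : Fin n → ℤ} (h : RedEdge v i j a b) :
    RedEdge v j i a b :=
  ⟨h.1.symm, h.2.1.trans (add_comm _ _), h.2.2.trans (add_comm _ _)⟩

theorem BlackEdge.symm {i j : Fin m} {a b : Fin n → ℤ} (h : BlackEdge v i j a b) :
    BlackEdge v j i b a :=
  ⟨h.1.symm, by rw [← neg_sub b a, h.2.1, neg_sub], by have := h.2.2; omega⟩

/-- The signs of the ends restrict the signs of the step: opposite signs give a black edge in one of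
its two directions, two signs -σ(a) give a red edge, and two signs σ(a) would give the impossible
sign 3σ(a). -/
theorem Rooting.black_or_red_of_adjacent (hn : n = 2 ∨ n = 3) (hv : Function.Injective v)
    (hgen : IsGeneric (resonances n) v) (R : Rooting v) {A : (geomGraph v).ConnectedComponent}
    {a b : NormalSite v} (ha : a ∈ A.supp) (hb : b ∈ A.supp)
    (h : Adjacent (signedLabel R a) (signedLabel R b)) :
    (∃ i j, BlackEdge v i j a.1 b.1) ∨ ∃ i j, RedEdge v i j a.1 b.1 := by
  obtain ⟨i, j, hij, ε, ε', h⟩ := h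
  have hsa := (R.label a).one_add_sum
  have hsb := (R.label b).one_add_sum
  rw [← signedLabel] at hsa hsb
  have hsum : (R.sign b : ℤ) = R.sign a + ε + ε' := by
    rw [← hsa, ← hsb, h]
    simp [Finset.sum_add_distrib]
    ring
  have hform : ∀ c, R.form c = (R.sign c : ℤ) • signedLabel R c := by
    intro c
    rw [signedLabel, smul_smul, Int.units_coe_mul_self, one_smul]
  have key : (ε = - R.sign a ∧ ε' = R.sign a ∧ R.sign b = R.sign a) ∨
      (ε = R.sign a ∧ ε' = - R.sign a ∧ R.sign b = R.sign a) ∨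
      (ε = - R.sign a ∧ ε' = - R.sign a ∧ R.sign b = - R.sign a) := by
    generalize R.sign a = s at hsum ⊢
    generalize R.sign b = t at hsum ⊢
    clear h
    rcases Int.units_eq_one_or s with rfl | rfl <;> rcases Int.units_eq_one_or t with rfl | rfl <;>
      rcases Int.units_eq_one_or ε with rfl | rfl <;>
      rcases Int.units_eq_one_or ε' with rfl | rfl <;> revert hsum <;> decide
  rcases key with ⟨rfl, rfl, h3⟩ | ⟨rfl, rfl, h3⟩ | ⟨rfl, rfl, h3⟩
  · left
    refine ⟨i, j, (R.black_iff hn hv hgen ha hb i j).2 ⟨hij, h3, ?_⟩⟩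
    rw [hform b, h, h3, hform a]
    funext k
    simp only [Pi.smul_apply, Pi.add_apply, Pi.sub_apply, Pi.single_apply, Units.val_neg,
      smul_eq_mul]
    rcases Int.units_eq_one_or (R.sign a) with hs | hs <;> rw [hs] <;> split_ifs <;> simp <;>
      ring
  · left
    refine ⟨j, i, (R.black_iff hn hv hgen ha hb j i).2 ⟨hij.symm, h3, ?_⟩⟩
    rw [hform b, h, h3, hform a]
    funext k
    simp only [Pi.smul_apply, Pi.add_apply, Pi.sub_apply, Pi.single_apply, Units.val_neg,
      smul_eq_mul]
    rcases Int.units_eq_one_or (R.sign a) with hs | hs <;> rw [hs] <;> split_ifs <;> simp <;>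
      ring
  · right
    refine ⟨i, j, (R.red_iff hn hv hgen ha hb i j).2 ⟨hij, h3, ?_⟩⟩
    rw [hform b, h, h3, hform a]
    funext k
    simp only [Pi.smul_apply, Pi.add_apply, Pi.sub_apply, Pi.single_apply, Units.val_neg,
      smul_eq_mul]
    rcases Int.units_eq_one_or (R.sign a) with hs | hs <;> rw [hs] <;> split_ifs <;> simp <;>
      ring

/-- Two sites of a component are joined by exactly one black edge, by exactly one red edge, or by
none. -/
theorem Rooting.edge_trichotomy (hn : n = 2 ∨ n = 3) (hv : Function.Injective v)
    (hgen : IsGeneric (resonances n) v) (R : Rooting v) {A : (geomGraph v).ConnectedComponent}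
    {a b : NormalSite v} (ha : a ∈ A.supp) (hb : b ∈ A.supp) :
    (∃ i j, BlackEdge v i j a.1 b.1) ∨ (∃ i j, i < j ∧ RedEdge v i j a.1 b.1) ∨
      ((∀ i j, ¬ BlackEdge v i j a.1 b.1) ∧ (∀ i j, ¬ RedEdge v i j a.1 b.1) ∧
        ¬ Adjacent (signedLabel R a) (signedLabel R b)) := by
  by_cases h1 : ∃ i j, BlackEdge v i j a.1 b.1
  · exact Or.inl h1
  by_cases h2 : ∃ i j, RedEdge v i j a.1 b.1
  · obtain ⟨i, j, h⟩ := h2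
    rcases lt_or_gt_of_ne h.1 with hlt | hlt
    · exact Or.inr (Or.inl ⟨i, j, hlt, h⟩)
    · exact Or.inr (Or.inl ⟨j, i, hlt, h.symm_marks⟩)
  · refine Or.inr (Or.inr ⟨fun i j h => h1 ⟨i, j, h⟩, fun i j h => h2 ⟨i, j, h⟩, fun h => ?_⟩)
    rcases R.black_or_red_of_adjacent hn hv hgen ha hb h with h | h
    · exact h1 h
    · exact h2 h

theorem Rooting.marked_of_black (hn : n = 2 ∨ n = 3) (hv : Function.Injective v)
    (hgen : IsGeneric (resonances n) v) (R : Rooting v) {A : (geomGraph v).ConnectedComponent}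
    {a b : NormalSite v} (ha : a ∈ A.supp) (hb : b ∈ A.supp) {i j : Fin m}
    (h : BlackEdge v i j a.1 b.1) : Marked i j (signedLabel R a) (signedLabel R b) := by
  obtain ⟨hij, h1, h2⟩ := (R.black_iff hn hv hgen ha hb i j).1 h
  rw [signedLabel, signedLabel, h1, h2]
  exact black_step_marked hij _ _

theorem Rooting.marked_of_red (hn : n = 2 ∨ n = 3) (hv : Function.Injective v)
    (hgen : IsGeneric (resonances n) v) (R : Rooting v) {A : (geomGraph v).ConnectedComponent}
    {a b : NormalSite v} (ha : a ∈ A.supp) (hb : b ∈ A.supp) {i j : Fin m}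
    (h : RedEdge v i j a.1 b.1) : Marked i j (signedLabel R a) (signedLabel R b) := by
  obtain ⟨hij, h1, h2⟩ := (R.red_iff hn hv hgen ha hb i j).1 h
  rw [signedLabel, signedLabel, h1, h2]
  exact red_step_marked hij _ _

theorem Marked.prod_zpow {i j : Fin m} {d e : Fin m → ℤ} (h : Marked i j d e) (y : Fin m → ℂ) :
    ∏ k, y k ^ |e k - d k| = y i * y j := by
  obtain ⟨hij, ε, ε', rfl⟩ := h
  rw [← Finset.prod_subset (Finset.subset_univ {i, j}), Finset.prod_pair hij]
  · congr 1
    · rcases Int.units_eq_one_or ε with rfl | rfl <;> simp [hij]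
    · rcases Int.units_eq_one_or ε' with rfl | rfl <;> simp [hij.symm]
  · intro k _ hk
    simp only [Finset.mem_insert, Finset.mem_singleton, not_or] at hk
    simp [hk.1, hk.2]

end Entries

/-! ### Comparison of M'_A, C_A and the label matrix. -/

section Families

variable {n m : ℕ} {v : Fin m → Fin n → ℤ}

/-- The scalar `|r|² + 4 ∑ ξ_i` by which `M'_A` and `2 C_A` differ. -/
def energyShift (r : Fin n → ℤ) : MvPolynomial (Fin m) ℤ :=
  ((r ⬝ᵥ r : ℤ) : MvPolynomial (Fin m) ℤ) + 4 * ∑ i, MvPolynomial.X i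

/-- The evaluation of integer polynomials at the point `ξ`. -/
def evalAt (ξ : Fin m → ℝ) : MvPolynomial (Fin m) ℤ →+* ℂ :=
  MvPolynomial.eval₂Hom (Int.castRingHom ℂ) fun i => (ξ i : ℂ)

theorem evalAt_X (ξ : Fin m → ℝ) (i : Fin m) : evalAt ξ (MvPolynomial.X i) = ξ i := by
  simp [evalAt]

theorem blockC_of_black (hn : n = 2 ∨ n = 3) (hv : Function.Injective v)
    (hgen : IsGeneric (resonances n) v) (R : Rooting v) {A : (geomGraph v).ConnectedComponent}
    (ξ : Fin m → ℝ) {a b : A.supp} (hab : a ≠ b) {i j : Fin m}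
    (h : BlackEdge v i j a.1.1 b.1.1) :
    blockC R A ξ a b = 2 * ((R.sign b.1 : ℤ) : ℂ) * (Real.sqrt (ξ i * ξ j) : ℂ) := by
  rw [blockC, if_neg hab, sum_sum_ite_eq (i₀ := i) (j₀ := j)]
  intro i' j'
  rw [R.black_unique hn hv hgen a.2 b.2 h, or_iff_left]
  exact fun h' => R.not_black_of_red hn hv hgen a.2 b.2 h'.2 _ _ h

theorem blockC_of_red (hn : n = 2 ∨ n = 3) (hv : Function.Injective v)
    (hgen : IsGeneric (resonances n) v) (R : Rooting v) {A : (geomGraph v).ConnectedComponent}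
    (ξ : Fin m → ℝ) {a b : A.supp} (hab : a ≠ b) {i j : Fin m} (hlt : i < j)
    (h : RedEdge v i j a.1.1 b.1.1) :
    blockC R A ξ a b = 2 * ((R.sign b.1 : ℤ) : ℂ) * (Real.sqrt (ξ i * ξ j) : ℂ) := by
  rw [blockC, if_neg hab, sum_sum_ite_eq (i₀ := i) (j₀ := j)]
  intro i' j'
  rw [R.red_unique hn hv hgen a.2 b.2 hlt h,
    or_iff_right (R.not_black_of_red hn hv hgen a.2 b.2 h _ _)]

theorem blockC_of_not_joined (R : Rooting v) {A : (geomGraph v).ConnectedComponent}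
    (ξ : Fin m → ℝ) {a b : A.supp} (hab : a ≠ b) (hblack : ∀ i j, ¬ BlackEdge v i j a.1.1 b.1.1)
    (hred : ∀ i j, ¬ RedEdge v i j a.1.1 b.1.1) : blockC R A ξ a b = 0 := by
  rw [blockC, if_neg hab, sum_sum_ite_eq_zero, mul_zero]
  rintro i j (h | h)
  · exact hblack i j h
  · exact hred i j h.2

/-- With p = d_a - d_b entrywise, ξ^{p⁺} = √ξ^{p + |p|}. The powers |p| multiply to √(ξ_i ξ_j), as p
is ±1 at i and j and 0 elsewhere. -/
theorem labelMatrix_mul_prod_eq {ι : Type*} (δ : ι → Fin m → ℤ) {ξ : Fin m → ℝ} (hξ : ∀ i, 0 < ξ i)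
    {a b : ι} (hab : a ≠ b) {i j : Fin m} (h : Marked i j (δ a) (δ b)) :
    evalAt ξ (labelMatrix ℤ δ a b) * ∏ k, (Real.sqrt (ξ k) : ℂ) ^ δ b k =
      (∏ k, (Real.sqrt (ξ k) : ℂ) ^ δ a k) *
        (2 * ((1 + ∑ k, δ b k : ℤ) : ℂ) * (Real.sqrt (ξ i * ξ j) : ℂ)) := by
  have hy : ∀ k, (Real.sqrt (ξ k) : ℂ) ≠ 0 := fun k =>
    Complex.ofReal_ne_zero.2 (Real.sqrt_pos.2 (hξ k)).ne'
  have hsq : ∀ k, (ξ k : ℂ) = (Real.sqrt (ξ k) : ℂ) ^ (2 : ℤ) := fun k => by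
    rw [zpow_ofNat, ← Complex.ofReal_pow, Real.sq_sqrt (hξ k).le]
  have hprod : (∏ k, (ξ k : ℂ) ^ (δ a k - δ b k).toNat) * ∏ k, (Real.sqrt (ξ k) : ℂ) ^ δ b k =
      (∏ k, (Real.sqrt (ξ k) : ℂ) ^ δ a k) * (Real.sqrt (ξ i * ξ j) : ℂ) := by
    rw [Real.sqrt_mul (hξ i).le, Complex.ofReal_mul, ← h.prod_zpow fun k => (Real.sqrt (ξ k) : ℂ),
      ← Finset.prod_mul_distrib, ← Finset.prod_mul_distrib]
    refine Finset.prod_congr rfl fun k _ => ?_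
    rw [hsq, ← zpow_natCast, ← zpow_mul, ← zpow_add₀ (hy k), ← zpow_add₀ (hy k)]
    congr 1
    rcases abs_cases (δ b k - δ a k) with h | h <;> omega
  rw [labelMatrix, if_neg hab, if_pos ⟨i, j, h⟩]
  simp only [map_mul, map_ofNat, map_intCast, map_prod, map_pow, evalAt_X]
  linear_combination (2 * ((1 + ∑ k, δ b k : ℤ) : ℂ)) * hprod

theorem signedLabel_one_add_sum (R : Rooting v) (a : NormalSite v) :
    1 + ∑ k, signedLabel R a k = R.sign a := (R.label a).one_add_sum

theorem evalAt_labelMatrix_conj (hn : n = 2 ∨ n = 3) (hv : Function.Injective v)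
    (hgen : IsGeneric (resonances n) v) (R : Rooting v) (A : (geomGraph v).ConnectedComponent)
    {ξ : Fin m → ℝ} (hξ : ∀ i, 0 < ξ i) (a b : A.supp) :
    evalAt ξ (labelMatrix ℤ (fun a : A.supp => signedLabel R a.1) a b) *
        ∏ k, (Real.sqrt (ξ k) : ℂ) ^ signedLabel R b.1 k =
      (∏ k, (Real.sqrt (ξ k) : ℂ) ^ signedLabel R a.1 k) * blockC R A ξ a b := by
  by_cases hab : a = b
  · subst hab
    rw [mul_comm]
    congr 1
    rw [labelMatrix, blockC, if_pos rfl, if_pos rfl]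
    simp only [map_sum, map_mul, map_intCast, evalAt_X, signedLabel, Pi.smul_apply, smul_eq_mul]
    push_cast
    rw [Finset.mul_sum]
    exact Finset.sum_congr rfl fun k _ => by ring
  rcases R.edge_trichotomy hn hv hgen a.2 b.2 with ⟨i, j, h⟩ | ⟨i, j, hlt, h⟩ | ⟨h1, h2, h3⟩
  · rw [labelMatrix_mul_prod_eq (fun a : A.supp => signedLabel R a.1) hξ hab
      (R.marked_of_black hn hv hgen a.2 b.2 h), blockC_of_black hn hv hgen R ξ hab h,
      signedLabel_one_add_sum]
  · rw [labelMatrix_mul_prod_eq (fun a : A.supp => signedLabel R a.1) hξ hab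
      (R.marked_of_red hn hv hgen a.2 b.2 h), blockC_of_red hn hv hgen R ξ hab hlt h,
      signedLabel_one_add_sum]
  · rw [blockC_of_not_joined R ξ hab h1 h2, labelMatrix, if_neg hab, if_neg h3]
    simp

theorem isUnit_prod_sqrt_zpow (R : Rooting v) (A : (geomGraph v).ConnectedComponent)
    {ξ : Fin m → ℝ} (hξ : ∀ i, 0 < ξ i) (a : A.supp) :
    IsUnit (∏ k, (Real.sqrt (ξ k) : ℂ) ^ signedLabel R a.1 k) :=
  isUnit_iff_ne_zero.2 <| Finset.prod_ne_zero_iff.2 fun k _ => zpow_ne_zero _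
    (Complex.ofReal_ne_zero.2 (Real.sqrt_pos.2 (hξ k)).ne')

theorem diagX_mul_exp_mul_inv (R : Rooting v) (x : Fin m → ℝ) {p q : NormalSite v × ℤˣ} {θ : ℝ}
    (h : θ = (q.2 : ℤ) * ∑ i, (R.form q.1 i : ℝ) * x i - (p.2 : ℤ) * ∑ i, (R.form p.1 i : ℝ) * x i) :
    diagX R x p * Complex.exp (Complex.I * θ) * (diagX R x q)⁻¹ = 1 := by
  rw [diagX, diagX, ← Complex.exp_neg, ← Complex.exp_add, ← Complex.exp_add, Complex.exp_eq_one_iff]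
  refine ⟨0, ?_⟩
  rw [h]
  push_cast
  ring

theorem sum_form_of_black {i j : Fin m} {L L' : Fin m → ℤ}
    (h : L' = Pi.single j 1 - Pi.single i 1 + L) (x : Fin m → ℝ) :
    ∑ k, (L' k : ℝ) * x k = x j - x i + ∑ k, (L k : ℝ) * x k := by
  rw [h]
  simp [add_mul, sub_mul, Finset.sum_add_distrib, Pi.single_apply]

theorem sum_form_of_red {i j : Fin m} {L L' : Fin m → ℤ}
    (h : L' = Pi.single j 1 + Pi.single i 1 - L) (x : Fin m → ℝ) :
    ∑ k, (L' k : ℝ) * x k = x j + x i - ∑ k, (L k : ℝ) * x k := by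
  rw [h]
  simp [add_mul, sub_mul, Finset.sum_add_distrib, Pi.single_apply]

theorem blockM'_apply (R : Rooting v) (A : (geomGraph v).ConnectedComponent) (ξ x : Fin m → ℝ)
    (a b : A.supp) : blockM' R A ξ x a b =
      (if a = b then diagOmega R ξ (a.1, R.sign a.1) else 0) + ((R.sign b.1 : ℤ) : ℂ) *
        (diagX R x (a.1, R.sign a.1) *
          quadCoeff v ξ x (a.1, R.sign a.1) (b.1, - R.sign b.1) *
          (diagX R x (b.1, R.sign b.1))⁻¹) := by
  have h : ((a.1, R.sign a.1) = (b.1, R.sign b.1)) ↔ a = b := by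
    constructor
    · intro h
      exact Subtype.ext (Prod.ext_iff.1 h).1
    · rintro rfl
      rfl
  simp only [blockM', Matrix.submatrix_apply, matM', matM, h]
  split_ifs <;> ring

theorem not_blackEdge_self (hv : Function.Injective v) (i j : Fin m) (a : Fin n → ℤ) :
    ¬ BlackEdge v i j a a := by
  rintro ⟨hij, h, -⟩
  rw [sub_self] at h
  exact hij (hv (sub_eq_zero.1 h.symm).symm)

theorem quadCoeff_self (hv : Function.Injective v) (ξ x : Fin m → ℝ) (a : NormalSite v) (s : ℤˣ) :
    quadCoeff v ξ x (a, s) (a, -s) = 0 := by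
  have h : blackSum v ξ x a a = 0 :=
    sum_sum_ite_eq_zero (fun i j => not_blackEdge_self hv i j a.1) _
  rcases Int.units_eq_one_or s with rfl | rfl <;> simp [quadCoeff, h]

/-- The energy law cancels the |v_i|² against |a|² and leaves |r|², and the mass law makes the
coefficient of 4∑ξ_i equal to 1. Only the term -2ξ_i of the frequencies keeps track of the label. -/
theorem diagOmega_eq (R : Rooting v) (ξ : Fin m → ℝ) (a : NormalSite v) :
    diagOmega R ξ (a, R.sign a) = evalAt ξ (energyShift (R.root a).1) +
      2 * (((R.sign a : ℤ) : ℂ) * ((∑ i, ξ i * (R.form a i : ℝ) : ℝ) : ℂ)) := by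
  obtain ⟨h1, -, h2⟩ := (R.label a).invariants
  have hs := Int.units_coe_mul_self (R.sign a)
  have h1' := congrArg (Int.cast : ℤ → ℂ) h1
  have h2' := congrArg (Int.cast : ℤ → ℂ) h2
  have hs' := congrArg (Int.cast : ℤ → ℂ) hs
  obtain ⟨T, hT⟩ : ∃ T, T = ∑ i, ξ i := ⟨_, rfl⟩
  have h3 : ∑ i, tangentialFreq v ξ i * (R.form a i : ℝ) =
      (pairing (fun k => v k ⬝ᵥ v k) (R.form a) : ℤ) - 2 * ∑ i, ξ i * (R.form a i : ℝ) +
        4 * T * (∑ k, R.form a k : ℤ) := by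
    simp only [tangentialFreq, pairing, ← hT]
    push_cast
    rw [Finset.mul_sum, Finset.mul_sum, ← Finset.sum_sub_distrib, ← Finset.sum_add_distrib]
    refine Finset.sum_congr rfl fun k _ => ?_
    ring
  have hT' : ∑ i, (ξ i : ℂ) = T := by rw [hT, Complex.ofReal_sum]
  rw [diagOmega, h3, normalFreq, energyShift, h2, ← hT]
  simp only [map_add, map_mul, map_sum, map_intCast, map_ofNat, evalAt_X, hT']
  push_cast at h1' h2' hs' ⊢
  generalize (∑ i, (ξ i : ℂ) * (R.form a i : ℂ)) = U
  linear_combination (((R.root a).1 ⬝ᵥ (R.root a).1 : ℤ) : ℂ) * hs' - 4 * T * h1'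

/-- The label changes along the edge exactly by the phase of its coefficient, so conjugation by X
removes x. The coefficients 4 in q against 2 in C account for the factor 2. -/
theorem quadCoeff_conj (hn : n = 2 ∨ n = 3) (hv : Function.Injective v)
    (hgen : IsGeneric (resonances n) v) (R : Rooting v) (A : (geomGraph v).ConnectedComponent)
    (ξ x : Fin m → ℝ) {a b : A.supp} (hab : a ≠ b) :
    ((R.sign b.1 : ℤ) : ℂ) * (diagX R x (a.1, R.sign a.1) *
      quadCoeff v ξ x (a.1, R.sign a.1) (b.1, - R.sign b.1) *
        (diagX R x (b.1, R.sign b.1))⁻¹) = 2 * blockC R A ξ a b := by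
  rcases R.edge_trichotomy hn hv hgen a.2 b.2 with ⟨i, j, h⟩ | ⟨i, j, hlt, h⟩ | ⟨h1, h2, h3⟩
  · obtain ⟨hij, h1, h2⟩ := (R.black_iff hn hv hgen a.2 b.2 i j).1 h
    rw [blockC_of_black hn hv hgen R ξ hab h]
    rcases Int.units_eq_one_or (R.sign a.1) with hs | hs
    · have hsum : blackSum v ξ x a.1 b.1 = (Real.sqrt (ξ j * ξ i) : ℂ) *
          Complex.exp (Complex.I * ((x j - x i : ℝ) : ℂ)) :=
        sum_sum_ite_eq (R.black_unique hn hv hgen b.2 a.2 h.symm) _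
      have hX := diagX_mul_exp_mul_inv R x (p := (a.1, R.sign a.1)) (q := (b.1, R.sign b.1))
        (θ := x j - x i) (by simp [h1, hs, sum_form_of_black h2])
      have hq : quadCoeff v ξ x (a.1, R.sign a.1) (b.1, - R.sign b.1) =
          4 * blackSum v ξ x a.1 b.1 := by simp [quadCoeff, h1, hs]
      rw [hq, hsum, mul_comm (ξ i)]
      linear_combination 4 * ((R.sign b.1 : ℤ) : ℂ) * (Real.sqrt (ξ j * ξ i) : ℂ) * hX
    · have hsum : blackSum v ξ x b.1 a.1 = (Real.sqrt (ξ i * ξ j) : ℂ) *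
          Complex.exp (Complex.I * ((x i - x j : ℝ) : ℂ)) :=
        sum_sum_ite_eq (R.black_unique hn hv hgen a.2 b.2 h) _
      have hX := diagX_mul_exp_mul_inv R x (p := (a.1, R.sign a.1)) (q := (b.1, R.sign b.1))
        (θ := x i - x j) (by simp [h1, hs, sum_form_of_black h2])
      have hq : quadCoeff v ξ x (a.1, R.sign a.1) (b.1, - R.sign b.1) =
          4 * blackSum v ξ x b.1 a.1 := by simp [quadCoeff, h1, hs]
      rw [hq, hsum]
      linear_combination 4 * ((R.sign b.1 : ℤ) : ℂ) * (Real.sqrt (ξ i * ξ j) : ℂ) * hX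
  · obtain ⟨hij, h1, h2⟩ := (R.red_iff hn hv hgen a.2 b.2 i j).1 h
    rw [blockC_of_red hn hv hgen R ξ hab hlt h]
    have hsum : ∀ s : ℤ, redSum v ξ x s a.1 b.1 = (Real.sqrt (ξ i * ξ j) : ℂ) *
        Complex.exp (Complex.I * (s : ℂ) * ((x i + x j : ℝ) : ℂ)) := fun s =>
      sum_sum_ite_eq (R.red_unique hn hv hgen a.2 b.2 hlt h) _
    have hq : quadCoeff v ξ x (a.1, R.sign a.1) (b.1, - R.sign b.1) =
        4 * redSum v ξ x (- R.sign a.1 : ℤ) a.1 b.1 := by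
      rcases Int.units_eq_one_or (R.sign a.1) with hs | hs <;> simp [quadCoeff, h1, hs]
    have hX := diagX_mul_exp_mul_inv R x (p := (a.1, R.sign a.1)) (q := (b.1, R.sign b.1))
      (θ := (- R.sign a.1 : ℤ) * (x i + x j)) (by
        rw [h1, sum_form_of_red h2]
        push_cast
        ring)
    have hcast : (((- R.sign a.1 : ℤ) : ℂ) * ((x i + x j : ℝ) : ℂ)) =
        (((- R.sign a.1 : ℤ) : ℝ) * (x i + x j) : ℝ) := by
      push_cast
      ring
    rw [hq, hsum, mul_assoc Complex.I, hcast]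
    linear_combination 4 * ((R.sign b.1 : ℤ) : ℂ) * (Real.sqrt (ξ i * ξ j) : ℂ) * hX
  · have hq : quadCoeff v ξ x (a.1, R.sign a.1) (b.1, - R.sign b.1) = 0 := by
      have e1 : blackSum v ξ x a.1 b.1 = 0 :=
        sum_sum_ite_eq_zero (fun i j h => h1 j i h.symm) _
      have e2 : blackSum v ξ x b.1 a.1 = 0 := sum_sum_ite_eq_zero h1 _
      have e3 : ∀ s : ℤ, redSum v ξ x s a.1 b.1 = 0 := fun s =>
        sum_sum_ite_eq_zero (fun i j h => h2 i j h.2) _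
      simp [quadCoeff, e1, e2, e3]
    rw [blockC_of_not_joined R ξ hab h1 h2, hq]
    simp

theorem blockM'_eq (hn : n = 2 ∨ n = 3) (hv : Function.Injective v)
    (hgen : IsGeneric (resonances n) v) (R : Rooting v) (A : (geomGraph v).ConnectedComponent)
    (ξ x : Fin m → ℝ) (a b : A.supp) : blockM' R A ξ x a b =
      (if a = b then evalAt ξ (energyShift (R.root a.1).1) else 0) + 2 * blockC R A ξ a b := by
  rw [blockM'_apply]
  by_cases hab : a = b
  · subst hab
    rw [if_pos rfl, if_pos rfl, quadCoeff_self hv, diagOmega_eq, blockC, if_pos rfl]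
    simp
  · rw [if_neg hab, if_neg hab, zero_add, zero_add, quadCoeff_conj hn hv hgen R A ξ x hab]

theorem hasIrreducibleCharpoly_blockC (hn : n = 2 ∨ n = 3) (hv : Function.Injective v)
    (hgen : IsGeneric (resonances n) v) (R : Rooting v) (A : (geomGraph v).ConnectedComponent)
    [Fintype A.supp] : HasIrreducibleCharpoly fun ξ (_ : Fin m → ℝ) => blockC R A ξ := by
  classical
  refine ⟨(labelMatrix ℤ fun a : A.supp => signedLabel R a.1).charpoly, ?_, ?_⟩
  · intro ξ _ hξ
    rw [show MvPolynomial.eval₂Hom (Int.castRingHom ℂ) (fun i => (ξ i : ℂ)) = evalAt ξ from rfl,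
      ← Matrix.charpoly_map]
    symm
    have key := charpoly_eq_of_mul_eq
      (N := (labelMatrix ℤ fun a : A.supp => signedLabel R a.1).map (evalAt ξ))
      _ (isUnit_prod_sqrt_zpow R A hξ) (evalAt_labelMatrix_conj hn hv hgen R A hξ)
    convert key
  · rw [labelMatrix_charpoly_map]
    exact R.irreducible_charpoly hn hv hgen A

theorem hasIrreducibleCharpoly_blockM' (hn : n = 2 ∨ n = 3) (hv : Function.Injective v)
    (hgen : IsGeneric (resonances n) v) (R : Rooting v) (A : (geomGraph v).ConnectedComponent)
    [Fintype A.supp] : HasIrreducibleCharpoly fun ξ x => blockM' R A ξ x := by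
  classical
  obtain ⟨r, hr⟩ := A.nonempty_supp
  obtain ⟨c, hc⟩ : ∃ c : MvPolynomial (Fin m) ℤ, c = energyShift (R.root r).1 := ⟨_, rfl⟩
  obtain ⟨N, hN⟩ : ∃ N : Matrix A.supp A.supp (MvPolynomial (Fin m) ℤ),
    N = labelMatrix ℤ fun a : A.supp => signedLabel R a.1 := ⟨_, rfl⟩
  refine ⟨(Matrix.scalar A.supp c + (2 : MvPolynomial (Fin m) ℤ) • N).charpoly, ?_, ?_⟩
  · intro ξ x hξ
    rw [show MvPolynomial.eval₂Hom (Int.castRingHom ℂ) (fun i => (ξ i : ℂ)) = evalAt ξ from rfl,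
      ← Matrix.charpoly_map]
    symm
    have key := charpoly_eq_of_mul_eq (M := blockM' R A ξ x)
      (N := (Matrix.scalar A.supp c + (2 : MvPolynomial (Fin m) ℤ) • N).map (evalAt ξ))
      _ (isUnit_prod_sqrt_zpow R A hξ) ?_
    · convert key
    · intro a b
      have h := evalAt_labelMatrix_conj hn hv hgen R A hξ a b
      rw [← hN] at h
      rw [blockM'_eq hn hv hgen, R.root_eq_of_mem a.2 hr, ← hc]
      simp only [Matrix.map_apply, Matrix.add_apply, Matrix.smul_apply, map_add, smul_eq_mul,
        map_mul, map_ofNat, Matrix.scalar_apply, Matrix.diagonal_apply]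
      by_cases hab : a = b
      · subst hab
        rw [if_pos rfl, if_pos rfl]
        linear_combination 2 * h
      · rw [if_neg hab, if_neg hab, map_zero]
        linear_combination 2 * h
  · rw [← Matrix.charpoly_map]
    have hmap : (Matrix.scalar A.supp c + (2 : MvPolynomial (Fin m) ℤ) • N).map
        (MvPolynomial.map (Int.castRingHom ℂ)) =
        Matrix.scalar A.supp (MvPolynomial.map (Int.castRingHom ℂ) c) +
          (2 : MvPolynomial (Fin m) ℂ) • labelMatrix ℂ fun a : A.supp => signedLabel R a.1 := by
      rw [← labelMatrix_map (Int.castRingHom ℂ), ← hN]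
      ext1 a b
      by_cases hab : a = b
      · subst hab
        simp
      · simp [hab]
    rw [hmap]
    have : Invertible (2 : MvPolynomial (Fin m) ℂ) :=
      (Invertible.map (MvPolynomial.C : ℂ →+* MvPolynomial (Fin m) ℂ) (2 : ℂ)).copy _
        (map_ofNat _ 2).symm
    exact irreducible_charpoly_scalar_add_smul _ _ (R.irreducible_charpoly hn hv hgen A)

end Families

end NLSBlocks

end

theorem mainTheorem7 (n : ℕ) (hn : n = 2 ∨ n = 3) :
    ∃ res : Finset (Σ k : ℕ, MvPolynomial (Fin k × Fin n) ℤ),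
      (∀ p ∈ res, p.2 ≠ 0) ∧
      ∀ (m : ℕ) (v : Fin m → Fin n → ℤ), Function.Injective v → NLSBlocks.IsGeneric res v →
        ∀ (R : NLSBlocks.Rooting v) (A : (NLSBlocks.geomGraph v).ConnectedComponent),
          ∃ _ : Fintype A.supp,
            NLSBlocks.HasIrreducibleCharpoly (fun ξ x => NLSBlocks.blockM' R A ξ x) ∧
            NLSBlocks.HasIrreducibleCharpoly (fun ξ _ => NLSBlocks.blockC R A ξ) := by
  have : NeZero n := ⟨by omega⟩
  refine ⟨NLSBlocks.resonances n, fun p hp => NLSBlocks.ne_zero_of_mem_resonances hp, ?_⟩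
  intro m v hv hgen R A
  have := R.finite_supp hn hv hgen A
  have := Fintype.ofFinite A.supp
  exact ⟨this, NLSBlocks.hasIrreducibleCharpoly_blockM' hn hv hgen R A,
    NLSBlocks.hasIrreducibleCharpoly_blockC hn hv hgen R A⟩
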